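/- **Setting.** Let $F_2=\langle a,b\rangle$ be the free group on two generators, whose elements are identified with reduced words over $L_2=\{a,b,a^{-1},b^{-1}\}$, and let $|w|$ be the length of $w$. A word $w$ is *minimal* if $|\phi(w)|\ge |w|$ for all $\phi\in\operatorname{Aut}F_2$. An *automorphic conjugacy class* is an orbit $W$ of $\operatorname{Aut}F_2$ on $F_2$. Let $C_2$ be the set of reduced words $x_1\cdots x_n$ with $x_n\ne x_1^{-1}$ (including the empty word). For nonempty $u\in C_2$ and $w\in C_2$, let $(u)_w$ be the number of occurrences of the subwords $u$ and $u^{-1}$ in $w$ regarded as a cyclic word, with $(u)_w=0$ if $|u|>|w|$. A word $w\in C_2$ is a *root word* if $|(ab)_w-(ab^{-1})_w|=(aa)_w=(bb)_w$, and is *alternating* if $(aa)_w=0=(bb)_w$. A *root class* is an automorphic conjugacy class that contains a root word. Let $J\le\operatorname{Aut}F_2$ be generated by the inner automorphisms and the automorphisms permuting $L_2$; write $w\sim_J v$ if $\phi(w)=v$ for some $\phi\in J$, and let $[w]$ be the class of $w$ under $\sim_J$. A *one-letter automorphism* is an automorphism of the form $x\mapsto x$, $y\mapsto yx$, where $x,y\in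 L_2$ and $y\notin\{x,x^{-1}\}$. The directed multigraph $\Gamma(W)$ has as vertices the $\sim_J$-classes of minimal words in $W$, and the number of edges from $[w]$ to $[v]$ is the number of classes modulo $\operatorname{Inn}F_2$ of one-letter automorphisms $\phi$ (a class counting once if it contains such a $\phi$) with $\phi(w)\in[v]$; this does not depend on the representatives. **Theorem.** Let $W$ be a root class that contains an alternating minimal word, and assume that the minimal words of $W$ do not have length $1$ (that is, $a\notin W$). Then exactly one vertex $[w_0]$ of $\Gamma(W)$ contains an alternating minimal word, and $\Gamma(W)$ is one of the following directed multigraphs, up to an isomorphism that sends $[w_0]$ to the vertex indicated. - (R4) A single vertex $[w_0]$ with four loops. - (R5) Two vertices $[w_0]$ and $u$, with two loops at $[w_0]$, two edges from $[w_0]$ to $u$ and two edges from $u$ to $[w_0]$. - (R6) Three vertices $[w_0]$, $u$, $v$, with two edges from $[w_0]$ to each of $u$ and $v$, one edge from each of $u$ and $v$ to $[w_0]$, one edge from $u$ to $v$ and one edge from $v$ to $u$. - (R7) The bow tie centred at $[w_0]$: five vertices $[w_0],u_1,u_2,u_3,u_4$, with exactly one edge in each direction between $[w_0]$ and each $u_i$,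 between $u_1$ and $u_2$, and between $u_3$ and $u_4$. There are no edges other than those listed. Moreover, for every root class $W$ (with or without an alternating minimal word), the number of vertices of $\Gamma(W)$ is $1$, $2$, $3$ or $5$. -/

import Mathlib

/-- The free group `F₂` on two generators. Its elements are identified with reduced words through
`FreeGroup.toWord`, and `FreeGroup.norm` is the length of the reduced word. -/
abbrev F2 : Type := FreeGroup (Fin 2)

namespace F2

/-- The generator `a`. -/
def a : F2 := FreeGroup.of 0

/-- The generator `b`. -/
def b : F2 := FreeGroup.of 1

/-- The alphabet `L₂ = {a, b, a⁻¹, b⁻¹}`. -/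
def letters : Set F2 := {a, b, a⁻¹, b⁻¹}

/-- `w` is minimal: no automorphism of `F₂` decreases its length. -/
def IsMinimal (w : F2) : Prop := ∀ φ : MulAut F2, w.norm ≤ (φ w).norm

/-- Automorphic conjugacy classes: the orbits of `Aut F₂` on `F₂`. -/
def IsAutClass (W : Set F2) : Prop := ∃ w : F2, W = {v | ∃ φ : MulAut F2, φ w = v}

/-- Membership in `C₂`: the reduced word `x₁ ⋯ xₙ` of `w` satisfies `xₙ ≠ x₁⁻¹`. -/
def IsCyclic (w : F2) : Prop := FreeGroup.IsCyclicallyReduced w.toWord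

/-- The number `(u)_w` of occurrences of the subwords `u` and `u⁻¹` in the cyclic word `w`, counted
by their starting position `i`: an occurrence at `i` is a prefix of the `i`-th rotation of `w`.
It is `0` when `u` is longer than `w`. -/
def subwordCount (u w : F2) : ℕ :=
  ((Finset.range w.toWord.length).filter fun i =>
    u.toWord <+: w.toWord.rotate i ∨ (u⁻¹).toWord <+: w.toWord.rotate i).card

/-- Root words: elements `w` of `C₂` with `|(ab)_w - (ab⁻¹)_w| = (aa)_w = (bb)_w`. -/
def IsRootWord (w : F2) : Prop :=
  IsCyclic w ∧
    |(subwordCount (a * b) w : ℤ) - (subwordCount (a * b⁻¹) w : ℤ)| = (subwordCount (a * a) w : ℤ) ∧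
    subwordCount (a * a) w = subwordCount (b * b) w

/-- Alternating words: elements `w` of `C₂` with `(aa)_w = 0 = (bb)_w`. -/
def IsAlternating (w : F2) : Prop :=
  IsCyclic w ∧ subwordCount (a * a) w = 0 ∧ subwordCount (b * b) w = 0

/-- A root class is an automorphic conjugacy class that contains a root word. -/
def IsRootClass (W : Set F2) : Prop := IsAutClass W ∧ ∃ w ∈ W, IsRootWord w

/-- The permutations (type I automorphisms): automorphisms that permute `L₂`. -/
def IsPermutation (φ : MulAut F2) : Prop := φ '' letters = letters

/-- The one-letter automorphisms `({y}, x)`, for letters `x` and `y ∉ {x, x⁻¹}`: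
the automorphism that maps `x` to `x` and `y` to `yx`. -/
def IsOneLetter (φ : MulAut F2) : Prop :=
  ∃ x ∈ letters, ∃ y ∈ letters, y ≠ x ∧ y ≠ x⁻¹ ∧ φ x = x ∧ φ y = y * x

/-- The subgroup `Inn F₂` of inner automorphisms. -/
def Inn : Subgroup (MulAut F2) := (MulAut.conj : F2 →* MulAut F2).range

/-- The subgroup `J` of `Aut F₂` generated by the inner automorphisms and the permutations. -/
def J : Subgroup (MulAut F2) := Subgroup.closure ({φ | φ ∈ Inn} ∪ {φ | IsPermutation φ})

/-- The relation `w ∼_J v`. -/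
def JEquiv (w v : F2) : Prop := ∃ φ ∈ J, φ w = v

theorem JEquiv.refl (w : F2) : JEquiv w w := ⟨1, J.one_mem, rfl⟩

theorem JEquiv.symm {w v : F2} (h : JEquiv w v) : JEquiv v w := by
  obtain ⟨φ, hφ, rfl⟩ := h
  exact ⟨φ⁻¹, J.inv_mem hφ, by simp⟩

theorem JEquiv.trans {u v w : F2} (h : JEquiv u v) (h' : JEquiv v w) : JEquiv u w := by
  obtain ⟨φ, hφ, rfl⟩ := h
  obtain ⟨ψ, hψ, rfl⟩ := h'
  exact ⟨ψ * φ, J.mul_mem hψ hφ, rfl⟩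

/-- The minimal words in `W`. -/
def MinimalWord (W : Set F2) : Type := {w : F2 // w ∈ W ∧ IsMinimal w}

/-- `∼_J` as an equivalence relation on the minimal words in `W`. -/
def jSetoid (W : Set F2) : Setoid (MinimalWord W) where
  r w v := JEquiv w.1 v.1
  iseqv := ⟨fun w => JEquiv.refl w.1, JEquiv.symm, JEquiv.trans⟩

/-- The vertices of `Γ(W)`: the classes of minimal words in `W` under `∼_J`. -/
def Vertex (W : Set F2) : Type := Quotient (jSetoid W)

/-- The classes `[φ]` modulo `Inn F₂` of the one-letter automorphisms `φ` with `φ(w) ∈ [v]`. -/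
def edgeClasses (w v : F2) : Set (MulAut F2 ⧸ Inn) :=
  {q | ∃ φ : MulAut F2, IsOneLetter φ ∧ (φ : MulAut F2 ⧸ Inn) = q ∧ JEquiv (φ w) v}

/-- The number of edges from `[w]` to `[v]`. -/
noncomputable def edgeCount (w v : F2) : ℕ := (edgeClasses w v).ncard

instance Inn.normal : Inn.Normal := by
  refine ⟨?_⟩
  rintro _ ⟨g, rfl⟩ φ
  exact ⟨φ g, by ext x; simp [MulAut.conj_apply]⟩

theorem IsPermutation.apply_mem {π : MulAut F2} (h : IsPermutation π) {x : F2}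
    (hx : x ∈ letters) : π x ∈ letters := h ▸ Set.mem_image_of_mem π hx

theorem IsPermutation.inv {π : MulAut F2} (h : IsPermutation π) : IsPermutation π⁻¹ := by
  unfold IsPermutation at h ⊢
  conv_lhs => rw [← h]
  rw [← Set.image_comp]
  convert Set.image_id _
  ext x
  simp

theorem IsOneLetter.conj {φ π : MulAut F2} (hφ : IsOneLetter φ) (hπ : IsPermutation π) :
    IsOneLetter (π * φ * π⁻¹) := by
  obtain ⟨x, hx, y, hy, h1, h2, h3, h4⟩ := hφ
  refine ⟨π x, hπ.apply_mem hx, π y, hπ.apply_mem hy, ?_, ?_, ?_, ?_⟩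
  · exact fun h => h1 (π.injective h)
  · exact fun h => h2 (π.injective (by simpa using h))
  · simp [MulAut.mul_apply, h3]
  · simp [MulAut.mul_apply, h4]

theorem edgeClasses_subset_of_permutation {π : MulAut F2} (hπ : IsPermutation π) (w v : F2) :
    (fun q : MulAut F2 ⧸ Inn => (π : MulAut F2 ⧸ Inn) * q * (π : MulAut F2 ⧸ Inn)⁻¹) ''
      edgeClasses w v ⊆ edgeClasses (π w) v := by
  rintro _ ⟨_, ⟨φ, hφ, rfl, h⟩, rfl⟩
  refine ⟨π * φ * π⁻¹, hφ.conj hπ, rfl, ?_⟩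
  have : (π * φ * π⁻¹) (π w) = π (φ w) := by simp [MulAut.mul_apply]
  rw [this]
  exact JEquiv.trans (JEquiv.symm ⟨π, Subgroup.subset_closure (Or.inr hπ), rfl⟩) h

theorem edgeCount_permutation {π : MulAut F2} (hπ : IsPermutation π) (w v : F2) :
    edgeCount (π w) v = edgeCount w v := by
  unfold edgeCount
  rw [← Set.ncard_image_of_injective (edgeClasses w v)
    (f := fun q => (π : MulAut F2 ⧸ Inn) * q * (π : MulAut F2 ⧸ Inn)⁻¹)
    (fun p q h => by simpa using h)]
  congr 1
  refine Set.Subset.antisymm (fun q hq => ?_) (edgeClasses_subset_of_permutation hπ w v)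
  have h := edgeClasses_subset_of_permutation hπ.inv (π w) v ⟨q, hq, rfl⟩
  rw [show π⁻¹ (π w) = w by simp] at h
  refine ⟨_, h, ?_⟩
  simp [mul_assoc]

theorem edgeCount_inner {ψ : MulAut F2} (hψ : ψ ∈ Inn) (w v : F2) :
    edgeCount (ψ w) v = edgeCount w v := by
  have key : ∀ φ : MulAut F2, JEquiv (φ (ψ w)) (φ w) := fun φ => by
    refine JEquiv.symm ⟨φ * ψ * φ⁻¹,
      Subgroup.subset_closure (Or.inl (Inn.normal.conj_mem ψ hψ φ)), ?_⟩
    simp [MulAut.mul_apply]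
  unfold edgeCount
  congr 1
  ext q
  exact ⟨fun ⟨φ, h1, h2, h3⟩ => ⟨φ, h1, h2, (key φ).symm.trans h3⟩,
    fun ⟨φ, h1, h2, h3⟩ => ⟨φ, h1, h2, (key φ).trans h3⟩⟩

theorem edgeCount_of_mem_J {ψ : MulAut F2} (hψ : ψ ∈ J) :
    ∀ w v : F2, edgeCount (ψ w) v = edgeCount w v := by
  induction hψ using Subgroup.closure_induction with
  | mem x hx => exact hx.elim (fun h => edgeCount_inner h) (fun h => edgeCount_permutation h)
  | one => exact fun _ _ => rfl
  | mul x y _ _ h1 h2 =>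
    intro w v
    rw [MulAut.mul_apply, h1, h2]
  | inv x _ h =>
    intro w v
    rw [← h (x⁻¹ w) v]
    simp

theorem edgeCount_congr {w w' v v' : F2} (hw : JEquiv w w') (hv : JEquiv v v') :
    edgeCount w v = edgeCount w' v' := by
  obtain ⟨ψ, hψ, rfl⟩ := hw
  rw [edgeCount_of_mem_J hψ]
  unfold edgeCount
  congr 1
  ext q
  exact ⟨fun ⟨φ, h1, h2, h3⟩ => ⟨φ, h1, h2, h3.trans hv⟩,
    fun ⟨φ, h1, h2, h3⟩ => ⟨φ, h1, h2, h3.trans hv.symm⟩⟩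

/-- A directed multigraph on `V`, loops allowed, given by its numbers of edges. -/
structure MultiDigraph (V : Type) where
  /-- The number of edges from one vertex to another. -/
  edges : V → V → ℕ

/-- The directed multigraph `Γ(W)`. -/
noncomputable def Gamma (W : Set F2) : MultiDigraph (Vertex W) where
  edges := Quotient.lift₂ (fun w v : MinimalWord W => edgeCount w.1 v.1)
    (fun _ _ _ _ hw hv => edgeCount_congr hw hv)

/-- The vertex `v` of `Γ(W)` contains an alternating (minimal) word. -/
def Vertex.HasAlternating {W : Set F2} (v : Vertex W) : Prop :=
  ∃ w : MinimalWord W, IsAlternating w.1 ∧ (Quotient.mk (jSetoid W) w : Vertex W) = v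

/-- There is an isomorphism of directed multigraphs from `G` to `H` that maps `v` to `u`. -/
def MultiDigraph.PointedIso {V U : Type} (G : MultiDigraph V) (v : V) (H : MultiDigraph U)
    (u : U) : Prop :=
  ∃ e : V ≃ U, e v = u ∧ ∀ x y : V, G.edges x y = H.edges (e x) (e y)

/-- The directed multigraph on `{0, …, n - 1}` whose numbers of edges are the entries of `M`. -/
def ofMatrix {n : ℕ} (M : Matrix (Fin n) (Fin n) ℕ) : MultiDigraph (Fin n) := ⟨M⟩

/-- One vertex with four loops. -/
def graphR4 : MultiDigraph (Fin 1) := ofMatrix !![4]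

/-- The centre `0` has two loops, and two edges run each way between `0` and `1`. -/
def graphR5 : MultiDigraph (Fin 2) := ofMatrix
  !![2, 2;
     2, 0]

/-- Two edges run from the centre `0` to each of `1`, `2`, one edge from each of these to `0`,
and one edge each way between `1` and `2`. -/
def graphR6 : MultiDigraph (Fin 3) := ofMatrix
  !![0, 2, 2;
     1, 0, 1;
     1, 1, 0]

/-- The bow tie with centre `0`: the triangles `{0, 1, 2}` and `{0, 3, 4}`, with one edge each way
along each side. -/
def graphR7 : MultiDigraph (Fin 5) := ofMatrix
  !![0, 1, 1, 1, 1;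
     1, 0, 1, 0, 0;
     1, 1, 0, 0, 0;
     1, 0, 0, 0, 1;
     1, 0, 0, 1, 0]

end F2

/-! Modulo inner automorphisms there are only four one-letter automorphisms: `tv`, `tv'` and their
inverses (`move`). For an element g let s0 and s1 be the numbers of squares of a and of b in its
cyclic word, and t the signed count of turns (ab minus ab⁻¹). Under `tv`, `tv'`, `tv⁻¹`, `tv'⁻¹` the
cyclic length grows by s1 + t, s0 + t, s1 - t, s0 - t (`cycNorm_tv` and its companions). Evaluating
these formulas along a move and its inverse, and along relations in Out such as tv⁻¹ tv' = swap flip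
tv, expresses s0, s1 and t of an image without looking at words again.

Minimality is handled by monotonicity. Nielsen's theorem (`elementary_eq_top`) and the relations in
Out write every automorphism, modulo Inn, as j χ j' with j, j' in `J` and χ a product of copies of
`tv` and `tv'` (`isFactored`). If s0 + t ≥ 0 and s1 + t ≥ 0, the cyclic length never decreases along
χ (`IsPositive.cycNorm_le`). So a locally minimal element is minimal in its orbit, and all other
minimal elements are reached from it by length-preserving moves (`mem_of_level`). Hence Γ(W) can be
read off from any finite table of elements closed under such moves (`IsLevelTable`).

An alternating minimal w has s0 = s1 = t = 0 (`IsBalanced`), so all four moves preserve its length.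
For x = tv w the three numbers s0, s1, t agree. If they vanish, x is conjugate to w
(`isConj_tv_of_squares_eq_zero`). If they are positive, `tv` and `tv'` lengthen x, while `tv⁻¹`
returns to w and `tv'⁻¹` leads, up to `J`, to tv' w. Thus everything happens in two triangles at w,
one with tv w and tv' w, the other with tv⁻¹ w and tv'⁻¹ w. R4 and R5 arise when both or just one of
`tv`, `tv'` fix the class of w. Otherwise a parity argument (`not_isConj_of_exchange`) separates the
two outer vertices of each triangle, and the triangles either coincide (R6) or meet only in w (R7),
by `neighbours`.

A general root word can be flipped to have s0 = s1 = t ≥ 0. If t > 0, either tv⁻¹ w or tv'⁻¹ w is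
balanced, or these two and w form a closed table, so that there are at most three vertices. -/

namespace FreeGroup

/-! ### Cyclically reduced words, conjugacy and cyclic length -/

variable {α : Type*}

theorem isCyclicallyReduced_iff_append_self {L : List (α × Bool)} :
    IsCyclicallyReduced L ↔ IsReduced (L ++ L) := by
  rw [isCyclicallyReduced_iff, IsReduced, IsReduced, List.isChain_append]
  tauto

theorem IsCyclicallyReduced.concat_of_cons {x : α × Bool} {L : List (α × Bool)}
    (h : IsCyclicallyReduced (x :: L)) : IsCyclicallyReduced (L ++ [x]) := by
  rcases L.eq_nil_or_concat' with rfl | ⟨M, y, rfl⟩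
  · simp
  · obtain ⟨h1, h2⟩ := h
    refine ⟨?_, ?_⟩
    · refine List.isChain_append.2 ⟨h1.tail, by simp, ?_⟩
      rw [← List.cons_append, List.getLast?_concat] at h2
      simpa using h2
    · rw [IsReduced, List.isChain_cons] at h1
      intro u hu v hv
      simp only [List.getLast?_append, List.getLast?_singleton, Option.some_or,
        Option.mem_def, Option.some.injEq] at hu
      subst hu
      refine h1.1 v ?_
      cases M <;> simpa using hv

theorem IsCyclicallyReduced.rotate {L : List (α × Bool)} (h : IsCyclicallyReduced L) (n : ℕ) :
    IsCyclicallyReduced (L.rotate n) := by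
  induction n generalizing L with
  | zero => simpa using h
  | succ n ih =>
    cases L with
    | nil => simp
    | cons x L =>
      rw [List.rotate_cons_succ]
      exact ih h.concat_of_cons

theorem IsCyclicallyReduced.cons_of_concat {x : α × Bool} {L : List (α × Bool)}
    (h : IsCyclicallyReduced (L ++ [x])) : IsCyclicallyReduced (x :: L) := by
  have := h.rotate L.length
  rwa [List.rotate_append_length_eq] at this

theorem mk_eq_mk_iff_of_isReduced [DecidableEq α] {L M : List (α × Bool)} (hL : IsReduced L)
    (hM : IsReduced M) : mk L = mk M ↔ L = M := by
  refine ⟨fun h => ?_, fun h => h ▸ rfl⟩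
  rw [← hL.reduce_eq, ← hM.reduce_eq]
  exact reduce.sound h

theorem toWord_mk_of_isReduced [DecidableEq α] {L : List (α × Bool)} (hL : IsReduced L) :
    (mk L).toWord = L := by
  rw [toWord_mk, hL.reduce_eq]

theorem isReduced_invRev {L : List (α × Bool)} (hL : IsReduced L) : IsReduced (invRev L) := by
  classical
  rw [isReduced_iff_reduce_eq, reduce_invRev, hL.reduce_eq]

/-- Peel off the last letter of the conjugator. If it cancels against either end of `L`, conjugating
by it merely rotates `L`. If it cancels at neither end, the whole conjugate is reduced as written;
it then begins with a letter and ends with its inverse, so it is not cyclically reduced. -/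
theorem isRotated_of_conj_mk [DecidableEq α] (g : List (α × Bool)) :
    ∀ {L M : List (α × Bool)}, IsReduced g → IsCyclicallyReduced L → IsCyclicallyReduced M →
      mk g * mk L * (mk g)⁻¹ = mk M → L ~r M := by
  induction g using List.reverseRecOn with
  | nil =>
    intro L M _ hL hM h
    rw [← one_eq_mk, one_mul, inv_one, mul_one,
      mk_eq_mk_iff_of_isReduced hL.isReduced hM.isReduced] at h
    rw [h]
  | append_singleton g x ih =>
    intro L M hg hL hM h
    have hg' : IsReduced g := hg.infix ⟨[], [x], by simp⟩
    obtain ⟨x1, x2⟩ := x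
    rw [← mul_mk, mul_inv_rev, mul_assoc, mul_assoc, ← mul_assoc (mk L), ← mul_assoc (mk [_]),
      ← mul_assoc (mk g)] at h
    rcases eq_or_ne L [] with rfl | hne
    · rw [← one_eq_mk, one_mul, mul_inv_cancel, mul_one, mul_inv_cancel, one_eq_mk,
        mk_eq_mk_iff_of_isReduced IsReduced.nil hM.isReduced] at h
      rw [h]
    by_cases h1 : L.head? = some (x1, !x2)
    · obtain ⟨L1, rfl⟩ : ∃ L1, L = (x1, !x2) :: L1 := by
        cases L <;> simp_all
      have key : mk [(x1, x2)] * (mk ((x1, !x2) :: L1) * (mk [(x1, x2)])⁻¹)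
          = mk (L1 ++ [(x1, !x2)]) := by
        have : (mk [(x1, x2)])⁻¹ = mk [(x1, !x2)] := by simp [invRev]
        have e1 : mk ((x1, !x2) :: L1) = (mk [(x1, x2)])⁻¹ * mk L1 := by rw [this, mul_mk]; rfl
        rw [e1, ← mul_mk, ← this]; group
      rw [key] at h
      refine List.IsRotated.trans ⟨1, ?_⟩ (ih hg' hL.concat_of_cons hM h)
      simp
    by_cases h2 : L.getLast? = some (x1, x2)
    · obtain ⟨L1, rfl⟩ : ∃ L1, L = L1 ++ [(x1, x2)] := by
        rcases L.eq_nil_or_concat' with rfl | ⟨M, y, rfl⟩ <;> simp_all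
      have key : mk [(x1, x2)] * (mk (L1 ++ [(x1, x2)]) * (mk [(x1, x2)])⁻¹)
          = mk ((x1, x2) :: L1) := by
        rw [← mul_mk, mul_assoc, mul_inv_cancel, mul_one, mul_mk]; rfl
      rw [key] at h
      refine List.IsRotated.trans ⟨L1.length, ?_⟩ (ih hg' hL.cons_of_concat hM h)
      rw [List.rotate_append_length_eq]; rfl
    exfalso
    have hred : IsReduced ((g ++ [(x1, x2)]) ++ L ++ ((x1, !x2) :: invRev g)) := by
      have e : invRev (g ++ [(x1, x2)]) = (x1, !x2) :: invRev g := by simp [invRev]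
      have h3 := isReduced_invRev hg
      rw [e] at h3
      refine List.isChain_append.2 ⟨List.isChain_append.2 ⟨hg, hL.1, ?_⟩, h3, ?_⟩
      · intro u hu v hv huv
        simp only [List.getLast?_append, List.getLast?_singleton, Option.some_or,
          Option.mem_def, Option.some.injEq] at hu
        subst hu
        obtain ⟨v1, v2⟩ := v
        simp only [Option.mem_def] at hv
        rw [hv] at h1
        simp only at huv
        subst huv
        simp at h1
        simpa using h1.symm
      · intro u hu v hv huv
        simp only [List.head?_cons, Option.mem_def, Option.some.injEq] at hv
        subst hv
        rw [List.getLast?_append_of_ne_nil _ hne] at hu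
        obtain ⟨v1, v2⟩ := u
        simp only [Option.mem_def] at hu
        rw [hu] at h2
        simp only at huv
        subst huv
        simp at h2
        cases v2 <;> cases x2 <;> simp_all
    have hM' : M = (g ++ [(x1, x2)]) ++ L ++ ((x1, !x2) :: invRev g) := by
      rw [← mk_eq_mk_iff_of_isReduced hM.isReduced hred, ← h]
      have : (x1, !x2) :: invRev g = invRev (g ++ [(x1, x2)]) := by simp [invRev]
      rw [this, ← mul_mk, ← mul_mk, ← inv_mk, ← mul_mk]; group
    have hc := hM.2
    have hlast : M.getLast? = some (((g ++ [(x1, x2)]).head (by simp)).1,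
        !((g ++ [(x1, x2)]).head (by simp)).2) := by
      rw [hM']
      cases g with
      | nil =>
        have : [] ++ [(x1, x2)] ++ L ++ (x1, !x2) :: invRev []
          = ((x1, x2) :: L) ++ [(x1, !x2)] := by simp
        rw [this, List.getLast?_concat]; rfl
      | cons y g =>
        have : y :: g ++ [(x1, x2)] ++ L ++ (x1, !x2) :: invRev (y :: g)
          = (y :: g ++ [(x1, x2)] ++ L ++ (x1, !x2) :: invRev g) ++ [(y.1, !y.2)] := by
          simp [invRev]
        rw [this, List.getLast?_concat]; rfl
    have hhead : M.head? = some ((g ++ [(x1, x2)]).head (by simp)) := by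
      rw [hM']
      cases g <;> simp
    have := hc _ hlast _ hhead rfl
    simp at this

/-- Conjugate cyclically reduced words are rotations of each other. -/
theorem isRotated_of_isConj [DecidableEq α] {L M : List (α × Bool)} (hL : IsCyclicallyReduced L)
    (hM : IsCyclicallyReduced M) (h : IsConj (mk L) (mk M)) : L ~r M := by
  obtain ⟨g, hg⟩ := isConj_iff.1 h
  refine isRotated_of_conj_mk g.toWord isReduced_toWord hL hM ?_
  rwa [mk_toWord]

theorem isConj_mk_of_isRotated {L M : List (α × Bool)} (h : L ~r M) : IsConj (mk L) (mk M) := by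
  obtain ⟨n, rfl⟩ := h
  rw [← List.rotate_mod]
  rcases L.eq_nil_or_concat' with rfl | ⟨M, y, rfl⟩
  · rw [List.rotate_nil]
  have hn : n % (M ++ [y]).length ≤ (M ++ [y]).length := (Nat.mod_lt _ (by simp)).le
  generalize n % (M ++ [y]).length = n at *
  rw [List.rotate_eq_drop_append_take hn, isConj_iff]
  refine ⟨(mk ((M ++ [y]).take n))⁻¹, ?_⟩
  conv_lhs => rw [← List.take_append_drop n (M ++ [y])]
  rw [← mul_mk, ← mul_mk, List.take_append_drop]; group

theorem reduceCyclically_eq_self [DecidableEq α] {L : List (α × Bool)}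
    (h : IsCyclicallyReduced L) : reduceCyclically L = L := by
  induction L using List.bidirectionalRec with
  | nil => simp
  | singleton x => simp
  | cons_append x l y _ =>
    rw [reduceCyclically.cons_append, if_neg]
    · rfl
    · rintro ⟨h1, h2⟩
      have := (isCyclicallyReduced_cons_append_iff.1 h).2 h1
      rw [this] at h2
      simp at h2

/-- The cyclic reduction of the reduced word of `g`. -/
def cycWord [DecidableEq α] (g : FreeGroup α) : List (α × Bool) := reduceCyclically g.toWord

/-- The cyclic length of `g`: the length of the shortest words conjugate to `g`. -/
def cycNorm [DecidableEq α] (g : FreeGroup α) : ℕ := (cycWord g).length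

section

variable [DecidableEq α]

theorem isCyclicallyReduced_cycWord (g : FreeGroup α) : IsCyclicallyReduced (cycWord g) :=
  reduceCyclically.isCyclicallyReduced isReduced_toWord

theorem isConj_mk_cycWord (g : FreeGroup α) : IsConj (mk (cycWord g)) g := by
  rw [isConj_iff]
  refine ⟨mk (reduceCyclically.conjugator g.toWord), ?_⟩
  rw [inv_mk, mul_mk, mul_mk]
  unfold cycWord
  rw [reduceCyclically.conj_conjugator_reduceCyclically, mk_toWord]

theorem cycWord_mk {L : List (α × Bool)} (h : IsCyclicallyReduced L) : cycWord (mk L) = L := by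
  rw [cycWord, toWord_mk_of_isReduced h.isReduced, reduceCyclically_eq_self h]

theorem cycNorm_mk {L : List (α × Bool)} (h : IsCyclicallyReduced L) :
    cycNorm (mk L) = L.length := by
  rw [cycNorm, cycWord_mk h]

theorem isRotated_cycWord {g h : FreeGroup α} (hgh : IsConj g h) : cycWord g ~r cycWord h :=
  isRotated_of_isConj (isCyclicallyReduced_cycWord g) (isCyclicallyReduced_cycWord h)
    (((isConj_mk_cycWord g).trans hgh).trans (isConj_mk_cycWord h).symm)

theorem cycNorm_congr {g h : FreeGroup α} (hgh : IsConj g h) : cycNorm g = cycNorm h :=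
  (isRotated_cycWord hgh).perm.length_eq

theorem cycNorm_le_norm (g : FreeGroup α) : cycNorm g ≤ g.norm := by
  unfold cycNorm norm cycWord
  conv_rhs => rw [← reduceCyclically.conj_conjugator_reduceCyclically g.toWord]
  simp only [List.length_append]
  omega

theorem cycNorm_eq_norm {g : FreeGroup α} (h : IsCyclicallyReduced g.toWord) :
    cycNorm g = g.norm := by
  rw [cycNorm, cycWord, reduceCyclically_eq_self h, norm]

theorem isCyclicallyReduced_of_cycNorm_eq {g : FreeGroup α} (h : cycNorm g = g.norm) :
    IsCyclicallyReduced g.toWord := by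
  have h1 := reduceCyclically.conj_conjugator_reduceCyclically g.toWord
  have h2 := congrArg List.length h1
  unfold cycNorm norm cycWord at h
  simp only [List.length_append, invRev_length] at h2
  have h3 : reduceCyclically.conjugator g.toWord = [] := List.length_eq_zero_iff.1 (by omega)
  rw [h3] at h1
  simp only [List.nil_append, invRev_empty, List.append_nil] at h1
  rw [← h1]
  exact isCyclicallyReduced_cycWord g

end

end FreeGroup

/-! ### Outer automorphisms: generators, relations, permutations and the four moves -/

namespace F2

/-- The endomorphism of `F₂` that maps `a` to `u` and `b` to `v`. -/
def endo (u v : F2) : F2 →* F2 := FreeGroup.lift ![u, v]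

@[simp] theorem endo_a (u v : F2) : endo u v a = u := by simp [endo, a]

@[simp] theorem endo_b (u v : F2) : endo u v b = v := by simp [endo, b]

theorem hom_ext {M : Type*} [Monoid M] {f g : F2 →* M} (ha : f a = g a) (hb : f b = g b) :
    f = g := by
  refine FreeGroup.ext_hom _ _ fun i => ?_
  fin_cases i
  · exact ha
  · exact hb

theorem aut_ext {φ ψ : MulAut F2} (ha : φ a = ψ a) (hb : φ b = ψ b) : φ = ψ := by
  have : φ.toMonoidHom = ψ.toMonoidHom := hom_ext ha hb
  ext x
  exact DFunLike.congr_fun this x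

/-- The one-letter automorphism `a ↦ a`, `b ↦ ba`. -/
def tv : MulAut F2 :=
  MonoidHom.toMulEquiv (endo a (b * a)) (endo a (b * a⁻¹)) (hom_ext (by simp) (by simp))
    (hom_ext (by simp) (by simp))

/-- The permutation `a ↦ a`, `b ↦ b⁻¹`. -/
def flip : MulAut F2 :=
  MonoidHom.toMulEquiv (endo a b⁻¹) (endo a b⁻¹) (hom_ext (by simp) (by simp))
    (hom_ext (by simp) (by simp))

/-- The permutation `a ↦ b`, `b ↦ a`. -/
def swap : MulAut F2 :=
  MonoidHom.toMulEquiv (endo b a) (endo b a) (hom_ext (by simp) (by simp))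
    (hom_ext (by simp) (by simp))

theorem tv_apply (x : F2) : tv x = endo a (b * a) x := rfl
theorem flip_apply (x : F2) : flip x = endo a b⁻¹ x := rfl
theorem swap_apply (x : F2) : swap x = endo b a x := rfl

@[simp] theorem tv_a : tv a = a := by simp [tv_apply]
@[simp] theorem tv_b : tv b = b * a := by simp [tv_apply]
@[simp] theorem flip_a : flip a = a := by simp [flip_apply]
@[simp] theorem flip_b : flip b = b⁻¹ := by simp [flip_apply]
@[simp] theorem swap_a : swap a = b := by simp [swap_apply]
@[simp] theorem swap_b : swap b = a := by simp [swap_apply]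
@[simp] theorem tv_symm_a : MulEquiv.symm tv a = a := by
  rw [MulEquiv.symm_apply_eq]; simp
@[simp] theorem tv_symm_b : MulEquiv.symm tv b = b * a⁻¹ := by
  rw [MulEquiv.symm_apply_eq]; simp

@[simp] theorem swap_mul_swap : swap * swap = 1 := aut_ext (by simp) (by simp)
@[simp] theorem flip_mul_flip : flip * flip = 1 := aut_ext (by simp) (by simp)
@[simp] theorem swap_inv : swap⁻¹ = swap := inv_eq_of_mul_eq_one_left swap_mul_swap
@[simp] theorem flip_inv : flip⁻¹ = flip := inv_eq_of_mul_eq_one_left flip_mul_flip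
@[simp] theorem swap_swap (x : F2) : swap (swap x) = x := by
  rw [← MulAut.mul_apply, swap_mul_swap, MulAut.one_apply]
@[simp] theorem flip_flip (x : F2) : flip (flip x) = x := by
  rw [← MulAut.mul_apply, flip_mul_flip, MulAut.one_apply]

/-- The outer automorphism group of `F₂`. -/
abbrev Out : Type := MulAut F2 ⧸ Inn

/-- The class of an automorphism modulo inner automorphisms. -/
abbrev out : MulAut F2 →* Out := QuotientGroup.mk' Inn

theorem conj_mem_Inn (h : F2) : MulAut.conj h ∈ Inn := ⟨h, rfl⟩

theorem out_eq_of_conj {φ ψ : MulAut F2} (h : F2) (ha : φ a = h * ψ a * h⁻¹)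
    (hb : φ b = h * ψ b * h⁻¹) : out φ = out ψ := by
  have : φ = MulAut.conj h * ψ := aut_ext (by simpa using ha) (by simpa using hb)
  rw [this, map_mul]
  have h1 : out (MulAut.conj h) = 1 := (QuotientGroup.eq_one_iff _).2 (conj_mem_Inn h)
  rw [h1, one_mul]

theorem exists_conj_of_out_eq {φ ψ : MulAut F2} (h : out φ = out ψ) :
    ∃ g : F2, φ = MulAut.conj g * ψ := by
  have h1 : out (φ * ψ⁻¹) = 1 := by rw [map_mul, map_inv, h, mul_inv_cancel]
  obtain ⟨g, hg⟩ := (QuotientGroup.eq_one_iff _).1 h1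
  exact ⟨g, by rw [hg, inv_mul_cancel_right]⟩

theorem isConj_of_out_eq {φ ψ : MulAut F2} (h : out φ = out ψ) (x : F2) :
    IsConj (φ x) (ψ x) := by
  obtain ⟨g, rfl⟩ := exists_conj_of_out_eq h
  exact IsConj.symm (isConj_iff.2 ⟨g, by simp⟩)

theorem isConj_map (φ : MulAut F2) {x y : F2} (h : IsConj x y) : IsConj (φ x) (φ y) :=
  φ.toMonoidHom.map_isConj h

theorem flip_tv_flip : out (flip * tv * flip) = out tv⁻¹ :=
  out_eq_of_conj a⁻¹ (by simp [mul_assoc]) (by simp [mul_assoc])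

/-- The one-letter automorphism `a ↦ ab`, `b ↦ b`. -/
def tv' : MulAut F2 := swap * tv * swap

@[simp] theorem tv'_a : tv' a = a * b := by simp [tv']
@[simp] theorem tv'_b : tv' b = b := by simp [tv']

theorem tv'_inv : tv'⁻¹ = swap * tv⁻¹ * swap := by simp [tv', mul_assoc]
@[simp] theorem tv'_symm_a : MulEquiv.symm tv' a = a * b⁻¹ := by
  rw [MulEquiv.symm_apply_eq]; simp
@[simp] theorem tv'_symm_b : MulEquiv.symm tv' b = b := by
  rw [MulEquiv.symm_apply_eq]; simp

theorem flip_tv'_flip : flip * tv' * flip = tv'⁻¹ := aut_ext (by simp) (by simp)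

/-- This and the next three relations turn a mixed product of two moves into a single move up to a
permutation. They allow inverse moves to be absorbed in `isFactored`, and they are the outer sides
of the triangles in the graphs. -/
theorem out_tv'_inv_mul_tv : out (tv'⁻¹ * tv) = out (flip * swap * tv') :=
  out_eq_of_conj b (by simp [mul_assoc]) (by simp [mul_assoc])

theorem out_tv_inv_mul_tv' : out (tv⁻¹ * tv') = out (swap * flip * tv) :=
  out_eq_of_conj a (by simp [mul_assoc]) (by simp [mul_assoc])

theorem out_tv'_mul_tv_inv : out (tv' * tv⁻¹) = out (swap * flip * tv'⁻¹) :=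
  out_eq_of_conj a (by simp [mul_assoc]) (by simp [mul_assoc])

theorem out_tv_mul_tv'_inv : out (tv * tv'⁻¹) = out (flip * swap * tv⁻¹) :=
  out_eq_of_conj b (by simp [mul_assoc]) (by simp [mul_assoc])

theorem IsPermutation.mul {φ ψ : MulAut F2} (hφ : IsPermutation φ) (hψ : IsPermutation ψ) :
    IsPermutation (φ * ψ) := by
  unfold IsPermutation at *
  conv_rhs => rw [← hφ, ← hψ]
  rw [← Set.image_comp]; rfl

theorem isPermutation_one : IsPermutation 1 := by
  unfold IsPermutation
  exact Set.image_id _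

theorem isPermutation_flip : IsPermutation flip := by
  unfold IsPermutation letters
  simp only [Set.image_insert_eq, Set.image_singleton, map_inv, flip_a, flip_b, inv_inv]
  ext x; simp; tauto

theorem isPermutation_swap : IsPermutation swap := by
  unfold IsPermutation letters
  simp only [Set.image_insert_eq, Set.image_singleton, map_inv, swap_a, swap_b]
  ext x; simp; tauto

theorem a_ne_b : a ≠ b := by decide
theorem a_ne_b_inv : a ≠ b⁻¹ := by decide

/-- The permutation `a ↦ a⁻¹`, `b ↦ b⁻¹`. -/
def negate : MulAut F2 := swap * flip * swap * flip

@[simp] theorem negate_a : negate a = a⁻¹ := by simp [negate]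
@[simp] theorem negate_b : negate b = b⁻¹ := by simp [negate]

/-- The normal form suits later commutations: in Out, `1` and `negate` commute with `tv` and `tv'`,
while `flip` and `negate * flip` invert them. -/
theorem IsPermutation.cases {π : MulAut F2} (h : IsPermutation π) :
    ∃ ρ ∈ ({1, negate, flip, negate * flip} : Set (MulAut F2)), π = ρ ∨ π = ρ * swap := by
  have ha : π a ∈ letters := h.apply_mem (by simp [letters])
  have hb : π b ∈ letters := h.apply_mem (by simp [letters])
  have h1 : π a ≠ π b := fun e => a_ne_b (π.injective e)
  have h2 : π a ≠ (π b)⁻¹ := fun e => a_ne_b_inv (π.injective (by simpa using e))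
  simp only [letters, Set.mem_insert_iff, Set.mem_singleton_iff] at ha hb
  rcases ha with ha | ha | ha | ha <;> rcases hb with hb | hb | hb | hb <;>
    first
      | (exfalso; rw [ha, hb] at h1; exact h1 rfl)
      | (exfalso; rw [ha, hb] at h2; simp at h2; done)
      | (refine ⟨1, by simp, Or.inl (aut_ext ?_ ?_)⟩ <;> simp [ha, hb] <;> done)
      | (refine ⟨1, by simp, Or.inr (aut_ext ?_ ?_)⟩ <;> simp [ha, hb] <;> done)
      | (refine ⟨negate, by simp, Or.inl (aut_ext ?_ ?_)⟩ <;> simp [ha, hb] <;> done)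
      | (refine ⟨negate, by simp, Or.inr (aut_ext ?_ ?_)⟩ <;> simp [ha, hb] <;> done)
      | (refine ⟨flip, by simp, Or.inl (aut_ext ?_ ?_)⟩ <;> simp [ha, hb] <;> done)
      | (refine ⟨flip, by simp, Or.inr (aut_ext ?_ ?_)⟩ <;> simp [ha, hb] <;> done)
      | (refine ⟨negate * flip, by simp, Or.inl (aut_ext ?_ ?_)⟩ <;> simp [ha, hb] <;> done)
      | (refine ⟨negate * flip, by simp, Or.inr (aut_ext ?_ ?_)⟩ <;> simp [ha, hb] <;> done)

theorem IsPermutation.mem_J {π : MulAut F2} (h : IsPermutation π) : π ∈ J :=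
  Subgroup.subset_closure (Or.inr h)

theorem mem_J_of_mem_Inn {φ : MulAut F2} (h : φ ∈ Inn) : φ ∈ J :=
  Subgroup.subset_closure (Or.inl h)

theorem flip_mem_J : flip ∈ J := isPermutation_flip.mem_J

theorem swap_mem_J : swap ∈ J := isPermutation_swap.mem_J

theorem exists_permutation_of_mem_J {ψ : MulAut F2} (h : ψ ∈ J) :
    ∃ π, IsPermutation π ∧ out ψ = out π := by
  induction h using Subgroup.closure_induction with
  | mem x hx =>
    rcases hx with hx | hx
    · exact ⟨1, isPermutation_one, by rw [map_one]; exact (QuotientGroup.eq_one_iff _).2 hx⟩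
    · exact ⟨x, hx, rfl⟩
  | one => exact ⟨1, isPermutation_one, rfl⟩
  | mul x y _ _ h1 h2 =>
    obtain ⟨p, hp, hp'⟩ := h1
    obtain ⟨q, hq, hq'⟩ := h2
    exact ⟨p * q, hp.mul hq, by rw [map_mul, map_mul, hp', hq']⟩
  | inv x _ h1 =>
    obtain ⟨p, hp, hp'⟩ := h1
    exact ⟨p⁻¹, hp.inv, by rw [map_inv, map_inv, hp']⟩

theorem JEquiv.of_isConj {x y : F2} (h : IsConj x y) : JEquiv x y := by
  obtain ⟨g, hg⟩ := isConj_iff.1 h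
  exact ⟨MulAut.conj g, mem_J_of_mem_Inn (conj_mem_Inn g), by simpa using hg⟩

theorem JEquiv.of_out_eq {φ ψ : MulAut F2} (h : out φ = out ψ) (x : F2) :
    JEquiv (φ x) (ψ x) := .of_isConj (isConj_of_out_eq h x)

theorem jEquiv_apply {ψ : MulAut F2} (h : ψ ∈ J) (x : F2) : JEquiv x (ψ x) := ⟨ψ, h, rfl⟩

theorem jEquiv_flip (x : F2) : JEquiv x (flip x) := jEquiv_apply flip_mem_J x

theorem jEquiv_swap (x : F2) : JEquiv x (swap x) := jEquiv_apply swap_mem_J x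

/-- A function on `F₂` that is invariant under conjugation and two permutations is invariant
under `J`. -/
theorem JEquiv.congr_of_invariant {β : Type*} {f : F2 → β} (h1 : ∀ x y, IsConj x y → f x = f y)
    (h2 : ∀ x, f (flip x) = f x) (h3 : ∀ x, f (swap x) = f x) {x y : F2} (h : JEquiv x y) :
    f x = f y := by
  obtain ⟨ψ, hψ, rfl⟩ := h
  obtain ⟨π, hπ, e⟩ := exists_permutation_of_mem_J hψ
  rw [h1 _ _ (isConj_of_out_eq e x)]
  obtain ⟨ρ, hρ, rfl | rfl⟩ := hπ.cases <;>
    simp only [Set.mem_insert_iff, Set.mem_singleton_iff] at hρ <;>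
    rcases hρ with rfl | rfl | rfl | rfl <;>
    simp only [MulAut.mul_apply, MulAut.one_apply, negate, h2, h3]

/-- Representatives of the one-letter automorphisms modulo inner automorphisms. -/
def move : Fin 4 → MulAut F2 := ![tv, tv', tv⁻¹, tv'⁻¹]

theorem move_zero : move 0 = tv := rfl
theorem move_one : move 1 = tv' := rfl
theorem move_two : move 2 = tv⁻¹ := rfl

theorem isOneLetter_move (i : Fin 4) : IsOneLetter (move i) := by
  fin_cases i
  · exact ⟨a, by simp [letters], b, by simp [letters], by decide, by decide, by simp [move],
      by simp [move]⟩
  · exact ⟨b, by simp [letters], a, by simp [letters], by decide, by decide, by simp [move],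
      by simp [move]⟩
  · exact ⟨a⁻¹, by simp [letters], b, by simp [letters], by decide, by decide, by simp [move],
      by simp [move]⟩
  · exact ⟨b⁻¹, by simp [letters], a, by simp [letters], by decide, by decide, by simp [move],
      by simp [move]⟩

/-- The eight choices of letters give four classes: y⁻¹ ↦ y⁻¹x is the same as y ↦ x⁻¹y, which is
conjugate by a power of x to y ↦ yx⁻¹. -/
theorem IsOneLetter.exists_move {φ : MulAut F2} (h : IsOneLetter φ) :
    ∃ i, out φ = out (move i) := by
  obtain ⟨x, hx, y, hy, h1, h2, h3, h4⟩ := h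
  simp only [letters, Set.mem_insert_iff, Set.mem_singleton_iff] at hx hy
  rcases hx with rfl | rfl | rfl | rfl <;> rcases hy with rfl | rfl | rfl | rfl <;>
    first
      | exact absurd rfl h1
      | exact absurd rfl h2
      | exact absurd (inv_inv _).symm h2
      | skip
  · exact ⟨0, out_eq_of_conj 1 (by simp [move, h3]) (by simp [move, h4])⟩
  · rw [map_inv, inv_eq_iff_eq_inv] at h4
    exact ⟨2, out_eq_of_conj a⁻¹ (by simp [move, h3]) (by simp [move, h4, mul_assoc])⟩
  · exact ⟨1, out_eq_of_conj 1 (by simp [move, h4]) (by simp [move, h3])⟩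
  · rw [map_inv, inv_eq_iff_eq_inv] at h4
    exact ⟨3, out_eq_of_conj b⁻¹ (by simp [move, h4, mul_assoc]) (by simp [move, h3])⟩
  · rw [map_inv, inv_inj] at h3
    exact ⟨2, out_eq_of_conj 1 (by simp [move, h3]) (by simp [move, h4])⟩
  · rw [map_inv, inv_eq_iff_eq_inv] at h4
    rw [map_inv, inv_inj] at h3
    exact ⟨0, out_eq_of_conj a (by simp [move, h3, mul_assoc]) (by simp [move, h4, mul_assoc])⟩
  · rw [map_inv, inv_inj] at h3
    exact ⟨3, out_eq_of_conj 1 (by simp [move, h4]) (by simp [move, h3])⟩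
  · rw [map_inv, inv_eq_iff_eq_inv] at h4
    rw [map_inv, inv_inj] at h3
    exact ⟨1, out_eq_of_conj b (by simp [move, h4, mul_assoc]) (by simp [move, h3, mul_assoc])⟩

/-- The exponent sum of the `i`-th generator. -/
def expSum (i : Fin 2) : F2 →* Multiplicative ℤ :=
  FreeGroup.lift fun j => Multiplicative.ofAdd (if i = j then 1 else 0)

theorem expSum_conj (i : Fin 2) {x y : F2} (h : IsConj x y) : expSum i x = expSum i y :=
  isConj_iff_eq.1 ((expSum i).map_isConj h)

/-- Exponent sums are conjugation invariant; that of b in the image of a and that of a in the image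
of b tell the four moves apart. -/
theorem out_move_injective : Function.Injective fun i => out (move i) := by
  intro i j hij
  have ha := fun k => expSum_conj k (isConj_of_out_eq hij a)
  have hb := fun k => expSum_conj k (isConj_of_out_eq hij b)
  have ea : ∀ k, expSum k a = Multiplicative.ofAdd (if k = 0 then 1 else 0) := fun k => by
    simp [expSum, a]
  have eb : ∀ k, expSum k b = Multiplicative.ofAdd (if k = 1 then 1 else 0) := fun k => by
    simp [expSum, b]
  have ha0 := ha 1
  have hb0 := hb 0
  fin_cases i <;> fin_cases j <;>
    first
      | rfl
      | (exfalso
         revert ha0 hb0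
         simp [move, ea, eb]
         try decide)

theorem edgeCount_eq_card (w v : F2) [DecidablePred fun i => JEquiv (move i w) v] :
    edgeCount w v = (Finset.univ.filter fun i => JEquiv (move i w) v).card := by
  unfold edgeCount
  rw [← Set.ncard_coe_finset, ← Set.ncard_image_of_injective _ out_move_injective]
  congr 1
  ext q
  simp only [edgeClasses, Set.mem_ofPred_eq, Set.mem_image, Finset.coe_filter, Finset.mem_univ,
    true_and]
  constructor
  · rintro ⟨φ, h1, rfl, h3⟩
    obtain ⟨i, hi⟩ := h1.exists_move
    exact ⟨i, (JEquiv.of_out_eq hi w).symm.trans h3, hi.symm⟩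
  · rintro ⟨i, h1, rfl⟩
    exact ⟨move i, isOneLetter_move i, rfl, h1⟩

end F2

namespace F2

open FreeGroup

/-! ### Sums over the junctions of a cyclic word -/

/-- The letters `x` and `y` may stand next to each other in a reduced word. -/
abbrev Compatible (x y : Fin 2 × Bool) : Prop := x.1 = y.1 → x.2 = y.2

/-- The sum of `f x y` over the pairs of consecutive letters of a word. -/
def pairSum (f : Fin 2 × Bool → Fin 2 × Bool → ℤ) : List (Fin 2 × Bool) → ℤ
  | [] => 0
  | [_] => 0
  | x :: y :: l => f x y + pairSum f (y :: l)

/-- The sum of `f x y` over the pairs of consecutive letters of a cyclic word. -/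
def cycSum (f : Fin 2 × Bool → Fin 2 × Bool → ℤ) (L : List (Fin 2 × Bool)) : ℤ :=
  pairSum f (L ++ L.take 1)

theorem cycSum_cons (f : Fin 2 × Bool → Fin 2 × Bool → ℤ) (x : Fin 2 × Bool)
    (L : List (Fin 2 × Bool)) : cycSum f (x :: L) = pairSum f (x :: (L ++ [x])) := rfl

theorem pairSum_add (f g : Fin 2 × Bool → Fin 2 × Bool → ℤ) :
    ∀ L, pairSum (fun x y => f x y + g x y) L = pairSum f L + pairSum g L
  | [] => rfl
  | [_] => rfl
  | x :: y :: l => by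
    have := pairSum_add f g (y :: l)
    simp only [pairSum, this]; ring

theorem pairSum_neg (f : Fin 2 × Bool → Fin 2 × Bool → ℤ) :
    ∀ L, pairSum (fun x y => -f x y) L = -pairSum f L
  | [] => rfl
  | [_] => rfl
  | x :: y :: l => by
    have := pairSum_neg f (y :: l)
    simp only [pairSum, this]; ring

theorem pairSum_nonneg {f : Fin 2 × Bool → Fin 2 × Bool → ℤ} (hf : ∀ x y, 0 ≤ f x y) :
    ∀ L, 0 ≤ pairSum f L
  | [] => le_rfl
  | [_] => le_rfl
  | x :: y :: l => add_nonneg (hf x y) (pairSum_nonneg hf (y :: l))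

theorem pairSum_map (f : Fin 2 × Bool → Fin 2 × Bool → ℤ) (π : Fin 2 × Bool → Fin 2 × Bool) :
    ∀ L, pairSum f (L.map π) = pairSum (fun x y => f (π x) (π y)) L
  | [] => rfl
  | [_] => rfl
  | x :: y :: l => by
    have := pairSum_map f π (y :: l)
    simp only [List.map_cons, pairSum] at this ⊢
    rw [this]

theorem pairSum_one (x : Fin 2 × Bool) : ∀ L, pairSum (fun _ _ => 1) (x :: L) = L.length := by
  intro L
  induction L generalizing x with
  | nil => rfl
  | cons y l ih => simp only [pairSum, ih, List.length_cons]; push_cast; ring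

theorem cycSum_add (f g : Fin 2 × Bool → Fin 2 × Bool → ℤ) (L : List (Fin 2 × Bool)) :
    cycSum (fun x y => f x y + g x y) L = cycSum f L + cycSum g L := pairSum_add f g _

theorem cycSum_neg (f : Fin 2 × Bool → Fin 2 × Bool → ℤ) (L : List (Fin 2 × Bool)) :
    cycSum (fun x y => -f x y) L = -cycSum f L := pairSum_neg f _

theorem cycSum_nonneg {f : Fin 2 × Bool → Fin 2 × Bool → ℤ} (hf : ∀ x y, 0 ≤ f x y)
    (L : List (Fin 2 × Bool)) : 0 ≤ cycSum f L := pairSum_nonneg hf _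

theorem cycSum_map (f : Fin 2 × Bool → Fin 2 × Bool → ℤ) (π : Fin 2 × Bool → Fin 2 × Bool)
    (L : List (Fin 2 × Bool)) : cycSum f (L.map π) = cycSum (fun x y => f (π x) (π y)) L := by
  unfold cycSum
  rw [← pairSum_map f π, List.map_append, List.map_take]

theorem cycSum_one (L : List (Fin 2 × Bool)) : cycSum (fun _ _ => 1) L = L.length := by
  cases L with
  | nil => rfl
  | cons x L => rw [cycSum_cons, pairSum_one]; simp

theorem isReduced_closeUp {L : List (Fin 2 × Bool)} (h : IsCyclicallyReduced L) :
    IsReduced (L ++ L.take 1) := by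
  refine (isCyclicallyReduced_iff_append_self.1 h).infix ⟨[], L.drop 1, ?_⟩
  rw [List.nil_append, List.append_assoc, List.take_append_drop]

theorem pairSum_eq_of_coboundary {f g : Fin 2 × Bool → Fin 2 × Bool → ℤ} (h : Fin 2 × Bool → ℤ)
    (hfg : ∀ x y, Compatible x y → f x y = g x y + (h y - h x)) (L : List (Fin 2 × Bool))
    (x z : Fin 2 × Bool) (hL : IsReduced (x :: (L ++ [z]))) :
    pairSum f (x :: (L ++ [z])) = pairSum g (x :: (L ++ [z])) + (h z - h x) := by
  induction L generalizing x with
  | nil => simpa [pairSum] using hfg x z (isReduced_cons_cons.1 hL).1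
  | cons y l ih =>
    rw [List.cons_append, isReduced_cons_cons] at hL
    have h1 := ih y hL.2
    have h2 := hfg x y hL.1
    simp only [List.cons_append, pairSum, h1, h2]; ring

/-- A coboundary telescopes to zero around a cycle. Identities between counts in cyclic words
thereby reduce to a finite check on pairs of letters, with a suitable potential `h`. -/
theorem cycSum_eq_of_coboundary {f g : Fin 2 × Bool → Fin 2 × Bool → ℤ} (h : Fin 2 × Bool → ℤ)
    (hfg : ∀ x y, Compatible x y → f x y = g x y + (h y - h x)) {L : List (Fin 2 × Bool)}
    (hL : IsCyclicallyReduced L) : cycSum f L = cycSum g L := by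
  cases L with
  | nil => rfl
  | cons x L =>
    have := pairSum_eq_of_coboundary h hfg L x x (isReduced_closeUp hL)
    rw [cycSum_cons, cycSum_cons, this]; ring

/-! ### A transducer computing the cyclic word of the image under `tv` -/

/-- The word that the junction of the letters `x` and `y` of a cyclic word contributes to its image
under `a ↦ a`, `b ↦ ba`. -/
def chunk (x y : Fin 2 × Bool) : List (Fin 2 × Bool) :=
  if x = (1, true) then (if y = (0, false) then [(1, true)] else [(1, true), (0, true)])
  else if x = (1, false) then (if y = (0, true) then [(1, false)] else [(1, false), (0, false)])
  else if x = (0, true) then (if y = (1, false) then [] else [(0, true)])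
  else (if y = (1, true) then [] else [(0, false)])

/-- The concatenation of the chunks at the junctions of a word. -/
def transduce : List (Fin 2 × Bool) → List (Fin 2 × Bool)
  | [] => []
  | [_] => []
  | x :: y :: l => chunk x y ++ transduce (y :: l)

theorem length_transduce : ∀ L : List (Fin 2 × Bool),
    ((transduce L).length : ℤ) = pairSum (fun x y => ((chunk x y).length : ℤ)) L
  | [] => rfl
  | [_] => rfl
  | x :: y :: l => by
    have := length_transduce (y :: l)
    simp only [transduce, pairSum, List.length_append, Nat.cast_add, this]

theorem transduce_append (L M : List (Fin 2 × Bool)) (x : Fin 2 × Bool) :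
    transduce (L ++ x :: M) = transduce (L ++ [x]) ++ transduce (x :: M) := by
  induction L with
  | nil => rfl
  | cons y l ih =>
    cases l with
    | nil => simp [transduce]
    | cons z l =>
      simp only [List.cons_append, transduce] at ih ⊢
      rw [ih, List.append_assoc]

/-- The letters with which the image of a reduced word that begins with `x` can begin. -/
abbrev Leads (x h : Fin 2 × Bool) : Prop := h = x ∨ (x.1 = 0 ∧ h = (1, !x.2))

theorem chunk_concat : ∀ x y h : Fin 2 × Bool, Compatible x y → Leads y h →
    (chunk x y ++ [h]).IsChain Compatible ∧ ∀ k ∈ (chunk x y ++ [h]).head?, Leads x k := by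
  decide

theorem chunk_isChain : ∀ x y : Fin 2 × Bool, Compatible x y →
    (chunk x y).IsChain Compatible ∧ ∀ k ∈ (chunk x y).head?, Leads x k := by
  decide

/-- Chunks may be empty, so reducedness cannot be checked on neighbouring chunks alone. The
induction carries the possible first letters of the remaining output, which suffice to attach one
more chunk. -/
theorem head_transduce (L : List (Fin 2 × Bool)) (x : Fin 2 × Bool) (hL : IsReduced (x :: L)) :
    IsReduced (transduce (x :: L)) ∧ ∀ h ∈ (transduce (x :: L)).head?, Leads x h := by
  induction L generalizing x with
  | nil => simp [transduce]
  | cons y l ih =>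
    rw [isReduced_cons_cons] at hL
    obtain ⟨h1, h2⟩ := ih y hL.2
    simp only [transduce]
    generalize transduce (y :: l) = T at h1 h2
    cases T with
    | nil =>
      rw [List.append_nil]
      exact chunk_isChain x y hL.1
    | cons h T =>
      obtain ⟨h3, h4⟩ := chunk_concat x y h hL.1 (h2 h rfl)
      refine ⟨?_, ?_⟩
      · have := FreeGroup.IsReduced.append_overlap (L₁ := chunk x y) (L₂ := [h]) (L₃ := T) h3 h1
          (by simp)
        simpa using this
      · intro k hk
        refine h4 k ?_
        revert hk
        cases chunk x y <;> exact id

/-- The correction at a letter that turns the letterwise image of a word into its chunks. -/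
def corr (x : Fin 2 × Bool) : F2 := if x.2 then 1 else a⁻¹

theorem tv_mk_singleton_mul_corr {x y : Fin 2 × Bool} (h : Compatible x y) :
    tv (mk [x]) * corr y = corr x * mk (chunk x y) := by
  have ha : mk [((0 : Fin 2), true)] = a := rfl
  have hb : mk [((1 : Fin 2), true)] = b := rfl
  have hA : mk [((0 : Fin 2), false)] = a⁻¹ := rfl
  have hB : mk [((1 : Fin 2), false)] = b⁻¹ := rfl
  have hba : mk [((1 : Fin 2), true), (0, true)] = b * a := rfl
  have hBA : mk [((1 : Fin 2), false), (0, false)] = b⁻¹ * a⁻¹ := rfl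
  obtain ⟨i, s⟩ := x
  obtain ⟨j, t⟩ := y
  fin_cases i <;> fin_cases j <;> cases s <;> cases t <;>
    simp [chunk, corr, ha, hb, hA, hB, hba, hBA, ← one_eq_mk, mul_assoc] at h ⊢

/-- The corrections at inner letters telescope; only those at the two ends remain. -/
theorem tv_mk_mul_corr (L : List (Fin 2 × Bool)) (x z : Fin 2 × Bool)
    (hL : IsReduced (x :: (L ++ [z]))) :
    tv (mk (x :: L)) * corr z = corr x * mk (transduce (x :: (L ++ [z]))) := by
  induction L generalizing x with
  | nil =>
    simpa [transduce] using tv_mk_singleton_mul_corr (isReduced_cons_cons.1 hL).1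
  | cons y l ih =>
    rw [List.cons_append, isReduced_cons_cons] at hL
    have h1 := ih y hL.2
    have h2 := tv_mk_singleton_mul_corr hL.1
    rw [← List.singleton_append, ← mul_mk, _root_.map_mul, mul_assoc, h1, ← mul_assoc, h2, mul_assoc,
      mul_mk]
    rfl

/-- The cyclic word of the image of a cyclic word under `a ↦ a`, `b ↦ ba`. -/
def cycTransduce (L : List (Fin 2 × Bool)) : List (Fin 2 × Bool) := transduce (L ++ L.take 1)

theorem isCyclicallyReduced_cycTransduce {L : List (Fin 2 × Bool)} (h : IsCyclicallyReduced L) :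
    IsCyclicallyReduced (cycTransduce L) := by
  cases L with
  | nil => simp [cycTransduce, transduce]
  | cons x L =>
    -- Transducing two turns around the cycle outputs the doubled image; the input needs one closing
    -- letter, hence three copies of the word.
    have h1 : IsReduced ((x :: L) ++ (x :: L) ++ [x]) := by
      have := (h.flatten_replicate 3).isReduced
      refine this.infix ⟨[], L, ?_⟩
      simp [List.replicate]
    have h2 := (head_transduce _ _ h1).1
    rw [isCyclicallyReduced_iff_append_self]
    have : cycTransduce (x :: L) ++ cycTransduce (x :: L)
        = transduce ((x :: L) ++ (x :: L) ++ [x]) := by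
      rw [List.append_assoc, @List.cons_append _ x L [x], transduce_append]; rfl
    rw [this]
    exact h2

/-- Closing the word up makes both end corrections equal, so together they are a conjugation. -/
theorem isConj_tv_mk {L : List (Fin 2 × Bool)} (h : IsCyclicallyReduced L) :
    IsConj (tv (mk L)) (mk (cycTransduce L)) := by
  cases L with
  | nil => simp [cycTransduce, transduce, ← one_eq_mk]
  | cons x L =>
    have := tv_mk_mul_corr L x x (isReduced_closeUp h)
    rw [isConj_iff]
    refine ⟨(corr x)⁻¹, ?_⟩
    rw [mul_assoc, inv_inv, this, inv_mul_cancel_left]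
    rfl

/-- The indicator of the pairs `aa`, `a⁻¹a⁻¹` (for `i = 0`) and `bb`, `b⁻¹b⁻¹` (for `i = 1`). -/
def square (i : Fin 2) (x y : Fin 2 × Bool) : ℤ := if x = y ∧ x.1 = i then 1 else 0

/-- `1` at the pairs `ab`, `b⁻¹a⁻¹`, and `-1` at the pairs `ab⁻¹`, `ba⁻¹`. -/
def turn (x y : Fin 2 × Bool) : ℤ :=
  if x = (0, true) ∧ y = (1, true) ∨ x = (1, false) ∧ y = (0, false) then 1
  else if x = (0, true) ∧ y = (1, false) ∨ x = (1, true) ∧ y = (0, false) then -1 else 0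

theorem square_nonneg (i : Fin 2) (x y : Fin 2 × Bool) : 0 ≤ square i x y := by
  unfold square; split_ifs <;> simp

theorem cycNorm_tv_mk {L : List (Fin 2 × Bool)} (h : IsCyclicallyReduced L) :
    (cycNorm (tv (mk L)) : ℤ) = L.length + cycSum (square 1) L + cycSum turn L := by
  rw [cycNorm_congr (isConj_tv_mk h), cycNorm_mk (isCyclicallyReduced_cycTransduce h),
    cycTransduce, length_transduce, ← cycSum_one, ← cycSum_add, ← cycSum_add]
  -- The transducer gains its letter at the pair ba, whereas `turn` counts the pair ab; the
  -- potential shifts one to the other.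
  refine cycSum_eq_of_coboundary (fun x => if x = (1, true) then 0 else 1) ?_ h
  decide

/-- The action of `flip` on letters. -/
def flipLetter (x : Fin 2 × Bool) : Fin 2 × Bool := if x.1 = 1 then (1, !x.2) else x

/-- The action of `swap` on letters. -/
def swapLetter (x : Fin 2 × Bool) : Fin 2 × Bool := (x.1 + 1, x.2)

theorem apply_mk_of_letter {φ : MulAut F2} {π : Fin 2 × Bool → Fin 2 × Bool}
    (h : ∀ x, φ (mk [x]) = mk [π x]) (L : List (Fin 2 × Bool)) : φ (mk L) = mk (L.map π) := by
  induction L with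
  | nil => rw [List.map_nil, ← one_eq_mk, _root_.map_one]
  | cons x l ih => rw [← List.singleton_append, ← mul_mk, _root_.map_mul, ih, h, mul_mk]; rfl

theorem flip_mk (L : List (Fin 2 × Bool)) : flip (mk L) = mk (L.map flipLetter) := by
  refine apply_mk_of_letter (fun x => ?_) L
  obtain ⟨i, s⟩ := x
  fin_cases i <;> cases s
  · change flip a⁻¹ = a⁻¹; simp
  · change flip a = a; simp
  · change flip b⁻¹ = b; simp
  · change flip b = b⁻¹; simp

theorem swap_mk (L : List (Fin 2 × Bool)) : swap (mk L) = mk (L.map swapLetter) := by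
  refine apply_mk_of_letter (fun x => ?_) L
  obtain ⟨i, s⟩ := x
  fin_cases i <;> cases s
  · change swap a⁻¹ = b⁻¹; simp
  · change swap a = b; simp
  · change swap b⁻¹ = a⁻¹; simp
  · change swap b = a; simp

theorem isCyclicallyReduced_map {π : Fin 2 × Bool → Fin 2 × Bool}
    (hπ : ∀ x y, Compatible x y → Compatible (π x) (π y)) {L : List (Fin 2 × Bool)}
    (h : IsCyclicallyReduced L) : IsCyclicallyReduced (L.map π) := by
  rw [isCyclicallyReduced_iff_append_self, ← List.map_append] at *
  exact List.isChain_map_of_isChain π hπ h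

theorem isCyclicallyReduced_flip {L : List (Fin 2 × Bool)} (h : IsCyclicallyReduced L) :
    IsCyclicallyReduced (L.map flipLetter) := isCyclicallyReduced_map (by decide) h

theorem isCyclicallyReduced_swap {L : List (Fin 2 × Bool)} (h : IsCyclicallyReduced L) :
    IsCyclicallyReduced (L.map swapLetter) := isCyclicallyReduced_map (by decide) h

theorem cycNorm_flip (g : F2) : cycNorm (flip g) = cycNorm g := by
  have h := isCyclicallyReduced_cycWord g
  rw [cycNorm_congr (isConj_map flip (isConj_mk_cycWord g)).symm, flip_mk,
    cycNorm_mk (isCyclicallyReduced_flip h), List.length_map]; rfl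

theorem cycNorm_swap (g : F2) : cycNorm (swap g) = cycNorm g := by
  have h := isCyclicallyReduced_cycWord g
  rw [cycNorm_congr (isConj_map swap (isConj_mk_cycWord g)).symm, swap_mk,
    cycNorm_mk (isCyclicallyReduced_swap h), List.length_map]; rfl

/-- The number of occurrences of `aa` (for `i = 0`) or `bb` (for `i = 1`) and of their inverses in
the cyclic word of `g`. -/
def squares (i : Fin 2) (g : F2) : ℤ := cycSum (square i) (cycWord g)

/-- The difference of the numbers of occurrences of `ab` and `ab⁻¹` and their inverses in the
cyclic word of `g`. -/
def turns (g : F2) : ℤ := cycSum turn (cycWord g)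

theorem squares_nonneg (i : Fin 2) (g : F2) : 0 ≤ squares i g := cycSum_nonneg (square_nonneg i) _

theorem cycNorm_tv (g : F2) : (cycNorm (tv g) : ℤ) = cycNorm g + squares 1 g + turns g := by
  rw [cycNorm_congr (isConj_map tv (isConj_mk_cycWord g)).symm,
    cycNorm_tv_mk (isCyclicallyReduced_cycWord g)]
  rfl

theorem cycNorm_tv' (g : F2) : (cycNorm (tv' g) : ℤ) = cycNorm g + squares 0 g + turns g := by
  have h := isCyclicallyReduced_cycWord g
  have h1 : cycNorm (tv' g) = cycNorm (tv (swap g)) := cycNorm_swap _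
  rw [h1, cycNorm_congr (isConj_map tv (isConj_map swap (isConj_mk_cycWord g))).symm, swap_mk,
    cycNorm_tv_mk (isCyclicallyReduced_swap h), List.length_map, cycSum_map, cycSum_map]
  congr 1
  · congr 1
    congr 1
    funext x y
    revert x y
    decide
  · refine cycSum_eq_of_coboundary
      (fun x => if x = (0, true) ∨ x = (1, false) then 1 else 0) ?_ h
    decide

theorem cycNorm_tv_inv (g : F2) :
    (cycNorm (tv⁻¹ g) : ℤ) = cycNorm g + squares 1 g - turns g := by
  have h := isCyclicallyReduced_cycWord g
  have h1 : cycNorm (tv⁻¹ g) = cycNorm (tv (flip g)) := by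
    rw [← cycNorm_congr (isConj_of_out_eq flip_tv_flip g)]
    exact cycNorm_flip _
  rw [h1, cycNorm_congr (isConj_map tv (isConj_map flip (isConj_mk_cycWord g))).symm, flip_mk,
    cycNorm_tv_mk (isCyclicallyReduced_flip h), List.length_map, cycSum_map, cycSum_map,
    sub_eq_add_neg, turns, ← cycSum_neg]
  congr 1
  · congr 1
    congr 1
    funext x y
    revert x y
    decide
  · refine cycSum_eq_of_coboundary
      (fun _ => 0) ?_ h
    decide

theorem cycNorm_tv'_inv (g : F2) :
    (cycNorm (tv'⁻¹ g) : ℤ) = cycNorm g + squares 0 g - turns g := by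
  have h : cycNorm (tv'⁻¹ g) = cycNorm (tv' (flip g)) := by
    rw [← flip_tv'_flip]
    exact cycNorm_flip _
  have h1 := isCyclicallyReduced_cycWord g
  have h2 : cycNorm (tv' (flip g)) = cycNorm (tv (swap (flip g))) := cycNorm_swap _
  rw [h, h2, cycNorm_congr
    (isConj_map tv (isConj_map swap (isConj_map flip (isConj_mk_cycWord g)))).symm,
    flip_mk, swap_mk, cycNorm_tv_mk (isCyclicallyReduced_swap (isCyclicallyReduced_flip h1)),
    List.length_map, List.length_map, cycSum_map, cycSum_map, cycSum_map, cycSum_map,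
    sub_eq_add_neg, turns, ← cycSum_neg]
  congr 1
  · congr 1
    congr 1
    funext x y
    revert x y
    decide
  · refine cycSum_eq_of_coboundary
      (fun x => if x.2 then 1 else 0) ?_ h1
    decide

end F2

/-! ### Cancellation measured by common prefixes -/

namespace FreeGroup

variable {α : Type*} [DecidableEq α]

/-- The length of the longest common prefix of two lists. -/
def lcpLength {β : Type*} [DecidableEq β] : List β → List β → ℕ
  | x :: l, y :: m => if x = y then lcpLength l m + 1 else 0
  | [], _ => 0
  | _, [] => 0

theorem lcpLength_comm {β : Type*} [DecidableEq β] :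
    ∀ l m : List β, lcpLength l m = lcpLength m l
  | x :: l, y :: m => by
    simp only [lcpLength, lcpLength_comm l m, eq_comm]
  | [], [] => rfl
  | [], _ :: _ => rfl
  | _ :: _, [] => rfl

/-- The ultrametric inequality of the tree of words, by which overlaps are compared in Nielsen's
argument. -/
theorem min_le_lcpLength {β : Type*} [DecidableEq β] :
    ∀ l m n : List β, min (lcpLength l m) (lcpLength m n) ≤ lcpLength l n
  | x :: l, y :: m, z :: n => by
    have := min_le_lcpLength l m n
    simp only [lcpLength]
    split_ifs <;> simp_all
  | [], _, _ => by simp [lcpLength]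
  | _ :: _, [], _ => by simp [lcpLength]
  | _ :: _, _ :: _, [] => by simp [lcpLength]

theorem length_toWord_inv_mul_mk : ∀ {L M : List (α × Bool)}, IsReduced L → IsReduced M →
    ((mk L)⁻¹ * mk M).norm + 2 * lcpLength L M = L.length + M.length
  | [], M, _, hM => by
    simp [← one_eq_mk, lcpLength, norm, toWord_mk_of_isReduced hM]
  | x :: L, [], hL, _ => by
    simp [← one_eq_mk, lcpLength, norm, toWord_mk_of_isReduced hL, -inv_mk]
  | x :: L, y :: M, hL, hM => by
    by_cases hxy : x = y
    · subst hxy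
      have ih := length_toWord_inv_mul_mk (L := L) (M := M) (hL.infix ⟨[x], [], by simp⟩)
        (hM.infix ⟨[x], [], by simp⟩)
      have : (mk (x :: L))⁻¹ * mk (x :: M) = (mk L)⁻¹ * mk M := by
        rw [← List.singleton_append, ← mul_mk, ← List.singleton_append (l := M), ← mul_mk]
        group
      rw [this]
      simp only [lcpLength, if_true, List.length_cons]
      omega
    · have hred : IsReduced (invRev (x :: L) ++ y :: M) := by
        refine List.isChain_append.2 ⟨isReduced_invRev hL, hM, ?_⟩
        intro u hu v hv huv
        have e : invRev (x :: L) = invRev L ++ [(x.1, !x.2)] := by simp [invRev]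
        rw [e, List.getLast?_concat] at hu
        simp only [Option.mem_def, Option.some.injEq, List.head?_cons] at hu hv
        subst hu hv
        by_contra hne
        refine hxy (Prod.ext huv ?_)
        cases h1 : x.2 <;> cases h2 : y.2 <;> simp_all
      rw [inv_mk, mul_mk, norm, toWord_mk_of_isReduced hred]
      simp [lcpLength, hxy]

/-- The length of the longest common prefix of the reduced words of `x` and `y`. -/
def gromov (x y : FreeGroup α) : ℕ := lcpLength x.toWord y.toWord

theorem gromov_comm (x y : FreeGroup α) : gromov x y = gromov y x := lcpLength_comm _ _

theorem min_le_gromov (x y z : FreeGroup α) : min (gromov x y) (gromov y z) ≤ gromov x z :=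
  min_le_lcpLength _ _ _

theorem norm_inv_mul (x y : FreeGroup α) : (x⁻¹ * y).norm + 2 * gromov x y = x.norm + y.norm := by
  have := length_toWord_inv_mul_mk (isReduced_toWord (x := x)) (isReduced_toWord (x := y))
  rwa [mk_toWord, mk_toWord] at this

theorem norm_mul (x y : FreeGroup α) : (x * y).norm + 2 * gromov x⁻¹ y = x.norm + y.norm := by
  have := norm_inv_mul x⁻¹ y
  rwa [inv_inv, norm_inv_eq] at this

/-- The letters of `u` either survive as a prefix of `u * h` or are cancelled by `h`. -/
theorem gromov_self_mul (u h : FreeGroup α) : gromov u (u * h) + gromov u⁻¹ h = u.norm := by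
  have h1 := norm_inv_mul u (u * h)
  rw [inv_mul_cancel_left] at h1
  have h2 := norm_mul u h
  omega

/-- Equivalently, y² is longer than y: squaring doubles the cyclic core, which is nonempty, and
keeps the conjugator. -/
theorem two_mul_gromov_inv_lt {y : FreeGroup α} (hy : y ≠ 1) : 2 * gromov y⁻¹ y < y.norm := by
  have h1 := norm_mul y y
  suffices y.norm < (y * y).norm by omega
  have h2 := congrArg List.length (reduceCyclically.reduce_flatten_replicate_succ
    (isReduced_toWord (x := y)) 1)
  rw [one_add_one_eq_two, ← toWord_pow, pow_two] at h2
  have h3 := congrArg List.length (reduceCyclically.conj_conjugator_reduceCyclically y.toWord)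
  simp only [List.replicate, List.flatten_cons, List.flatten_nil, List.length_append,
    invRev_length, List.append_nil] at h2 h3
  have h4 : (reduceCyclically y.toWord).length ≠ 0 := by
    intro h0
    have h5 := reduceCyclically.conj_conjugator_reduceCyclically y.toWord
    rw [List.length_eq_zero_iff.1 h0, List.append_nil] at h5
    apply hy
    rw [← mk_toWord (x := y), ← h5, ← mul_mk, ← inv_mk, mul_inv_cancel]
  unfold norm
  omega

end FreeGroup

/-! ### Nielsen's theorem and positive factorizations -/

namespace F2

open FreeGroup

/-- Nielsen's condition: in the product of three letters that do not cancel, the images of the outer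
letters do not cancel the image of the middle one. -/
def IsNielsen (θ : MulAut F2) : Prop :=
  ∀ x y z : Fin 2 × Bool, Compatible x y → Compatible y z →
    gromov (θ (mk [x]))⁻¹ (θ (mk [y])) + gromov (θ (mk [y]))⁻¹ (θ (mk [z])) < (θ (mk [y])).norm

/-- Every letter leaves at least one letter of its image uncancelled. The first conclusion is the
induction invariant: what follows `x` does not affect the cancellation on its left. -/
theorem IsNielsen.length_le {θ : MulAut F2} (hθ : IsNielsen θ) (L : List (Fin 2 × Bool))
    (x : Fin 2 × Bool) (hL : IsReduced (x :: L)) (y : Fin 2 × Bool) (hyx : Compatible y x) :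
    gromov (θ (mk [y]))⁻¹ (θ (mk (x :: L))) = gromov (θ (mk [y]))⁻¹ (θ (mk [x])) ∧
      (x :: L).length + gromov (θ (mk [y]))⁻¹ (θ (mk [x])) ≤ (θ (mk (x :: L))).norm := by
  induction L generalizing x y with
  | nil =>
    have := hθ y x x hyx (fun _ => rfl)
    refine ⟨rfl, ?_⟩
    simp only [List.length_cons, List.length_nil]
    omega
  | cons z l ih =>
    rw [isReduced_cons_cons] at hL
    obtain ⟨h1, h2⟩ := ih z hL.2 x hL.1
    have h3 := hθ y x z hyx hL.1
    have e : θ (mk (x :: z :: l)) = θ (mk [x]) * θ (mk (z :: l)) := by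
      rw [← _root_.map_mul, mul_mk]; rfl
    rw [e]
    have h4 := norm_mul (θ (mk [x])) (θ (mk (z :: l)))
    have h5 := gromov_self_mul (θ (mk [x])) (θ (mk (z :: l)))
    -- By Nielsen's condition the image of `x` agrees with the whole product further than with the
    -- inverse image of `y`; the ultrametric inequality in both directions then equates the two
    -- overlaps.
    have h6 := min_le_gromov (θ (mk [y]))⁻¹ (θ (mk [x])) (θ (mk [x]) * θ (mk (z :: l)))
    have h7 := min_le_gromov (θ (mk [y]))⁻¹ (θ (mk [x]) * θ (mk (z :: l))) (θ (mk [x]))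
    rw [gromov_comm _ (θ (mk [x]))] at h7
    simp only [List.length_cons] at h2 ⊢
    omega

theorem mk_mem_letters (x : Fin 2 × Bool) : mk [x] ∈ letters := by
  obtain ⟨i, s⟩ := x
  fin_cases i <;> cases s
  · exact Or.inr (Or.inr (Or.inl rfl))
  · exact Or.inl rfl
  · exact Or.inr (Or.inr (Or.inr rfl))
  · exact Or.inr (Or.inl rfl)

theorem mem_letters_iff {g : F2} : g ∈ letters ↔ g.norm = 1 := by
  constructor
  · rintro (rfl | rfl | rfl | rfl) <;> decide
  · intro h
    obtain ⟨x, hx⟩ := List.length_eq_one_iff.1 h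
    rw [← mk_toWord (x := g), hx]
    exact mk_mem_letters x

theorem isPermutation_of_mapsTo {φ : MulAut F2} (h : ∀ x ∈ letters, φ x ∈ letters) :
    IsPermutation φ := by
  have hfin : letters.Finite := by unfold letters; exact Set.toFinite _
  refine Set.eq_of_subset_of_ncard_le (Set.image_subset_iff.2 h) ?_ hfin
  rw [Set.ncard_image_of_injective _ φ.injective]

/-- Since θ does not shorten words, the preimage of a letter has length at most one. -/
theorem IsNielsen.isPermutation_inv {θ : MulAut F2} (hθ : IsNielsen θ) : IsPermutation θ⁻¹ := by
  refine isPermutation_of_mapsTo fun g hg => ?_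
  rw [mem_letters_iff] at hg ⊢
  have h0 : θ (θ⁻¹ g) = g := by simp
  have h1 : θ⁻¹ g ≠ 1 := by
    intro h
    rw [h, _root_.map_one] at h0
    rw [← h0] at hg
    simp at hg
  generalize θ⁻¹ g = k at h0 h1
  have h2 : k.toWord ≠ [] := by simpa using h1
  obtain ⟨x, L, hL⟩ := List.exists_cons_of_ne_nil h2
  have h3 := (hθ.length_le L x (hL ▸ isReduced_toWord) x (fun _ => rfl)).2
  rw [← hL, mk_toWord, h0, hg] at h3
  have h4 : k.toWord.length ≠ 0 := by simp [hL]
  unfold FreeGroup.norm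
  omega

theorem exists_permutation (x y : Fin 2 × Bool) (h : x.1 ≠ y.1) :
    ∃ π, IsPermutation π ∧ π a = mk [x] ∧ π b = mk [y] := by
  have h1 := isPermutation_flip
  have h2 := isPermutation_swap
  have ha : mk [((0 : Fin 2), true)] = a := rfl
  have hb : mk [((1 : Fin 2), true)] = b := rfl
  have hA : mk [((0 : Fin 2), false)] = a⁻¹ := rfl
  have hB : mk [((1 : Fin 2), false)] = b⁻¹ := rfl
  have h3 : IsPermutation negate := ((h2.mul h1).mul h2).mul h1
  obtain ⟨i, s⟩ := x
  obtain ⟨j, t⟩ := y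
  fin_cases i <;> fin_cases j <;> cases s <;> cases t <;> simp [ha, hb, hA, hB] at h ⊢
  · exact ⟨negate, h3, by simp, by simp⟩
  · exact ⟨negate * flip, h3.mul h1, by simp, by simp⟩
  · exact ⟨flip, h1, by simp, by simp⟩
  · exact ⟨1, isPermutation_one, by simp, by simp⟩
  · exact ⟨negate * swap, h3.mul h2, by simp, by simp⟩
  · exact ⟨flip * swap, h1.mul h2, by simp, by simp⟩
  · exact ⟨negate * flip * swap, (h3.mul h1).mul h2, by simp, by simp⟩
  · exact ⟨swap, h2, by simp, by simp⟩

/-- The subgroup generated by the inner automorphisms, the permutations and the one-letter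
automorphisms. -/
def elementary : Subgroup (MulAut F2) := Subgroup.closure (insert tv J)

theorem tv_mem_elementary : tv ∈ elementary := Subgroup.subset_closure (Set.mem_insert _ _)

theorem mem_elementary_of_mem_J {φ : MulAut F2} (h : φ ∈ J) : φ ∈ elementary :=
  Subgroup.subset_closure (Set.mem_insert_of_mem _ h)

/-- Minimality against one-letter automorphisms bounds each cancellation by half of either factor.
Nielsen's condition can then fail only when the middle image is consumed exactly half from each
side, and such a configuration allows a shorter pair of generators. -/
theorem isNielsen_of_minimal {θ : MulAut F2} (hθ : ∀ ψ ∈ elementary,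
    (θ a).norm + (θ b).norm ≤ (θ (ψ a)).norm + (θ (ψ b)).norm) : IsNielsen θ := by
  have hone : ∀ x : Fin 2 × Bool, θ (mk [x]) ≠ 1 := by
    intro x h
    rw [MulEquiv.map_eq_one_iff] at h
    have := mem_letters_iff.1 (mk_mem_letters x)
    rw [h] at this
    simp at this
  have hinv : ∀ x : Fin 2 × Bool, mk [(x.1, !x.2)] = (mk [x])⁻¹ := fun x => by simp [invRev]
  have hsum : ∀ x y : Fin 2 × Bool, x.1 ≠ y.1 →
      (θ a).norm + (θ b).norm = (θ (mk [x])).norm + (θ (mk [y])).norm := by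
    intro x y hxy
    have hA : ∀ x : Fin 2 × Bool, (θ (mk [x])).norm = if x.1 = 0 then (θ a).norm
        else (θ b).norm := by
      rintro ⟨i, s⟩
      fin_cases i <;> cases s
      · change (θ a⁻¹).norm = _; rw [_root_.map_inv, norm_inv_eq]; rfl
      · rfl
      · change (θ b⁻¹).norm = _; rw [_root_.map_inv, norm_inv_eq]; rfl
      · rfl
    rw [hA, hA]
    have : x.1 = 0 ∧ y.1 = 1 ∨ x.1 = 1 ∧ y.1 = 0 := by omega
    rcases this with ⟨h1, h2⟩ | ⟨h1, h2⟩ <;> simp [h1, h2, add_comm]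
  have hmul : ∀ x y : Fin 2 × Bool, x.1 ≠ y.1 →
      (θ (mk [x])).norm ≤ (θ (mk [x]) * θ (mk [y])).norm := by
    intro x y hxy
    obtain ⟨π, hπ, h1, h2⟩ := exists_permutation y x hxy.symm
    have h3 := hθ (π * tv) (mul_mem (mem_elementary_of_mem_J hπ.mem_J) tv_mem_elementary)
    rw [hsum y x hxy.symm] at h3
    simp only [MulAut.mul_apply, tv_a, tv_b, _root_.map_mul, h1, h2] at h3
    omega
  have hhalf : ∀ x y : Fin 2 × Bool, x.1 ≠ y.1 →
      2 * gromov (θ (mk [x]))⁻¹ (θ (mk [y])) ≤ (θ (mk [x])).norm ∧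
      2 * gromov (θ (mk [x]))⁻¹ (θ (mk [y])) ≤ (θ (mk [y])).norm := by
    intro x y hxy
    have h1 := hmul x y hxy
    have h2 := hmul (y.1, !y.2) (x.1, !x.2) (fun h => hxy h.symm)
    rw [hinv, hinv, _root_.map_inv, _root_.map_inv, ← mul_inv_rev, norm_inv_eq, norm_inv_eq] at h2
    have h3 := norm_mul (θ (mk [x])) (θ (mk [y]))
    omega
  intro x y z hxy hyz
  have hstrict := two_mul_gromov_inv_lt (hone y)
  by_cases h1 : x.1 = y.1
  · have : x = y := Prod.ext h1 (hxy h1)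
    subst this
    by_cases h2 : x.1 = z.1
    · have : x = z := Prod.ext h2 (hyz h2)
      subst this
      omega
    · have := (hhalf x z h2).1
      omega
  by_cases h2 : y.1 = z.1
  · have : y = z := Prod.ext h2 (hyz h2)
    subst this
    have := (hhalf x y h1).2
    omega
  have h3 := (hhalf x y h1).2
  have h4 := (hhalf y z h2).1
  by_contra hcon
  have h5 : 2 * gromov (θ (mk [x]))⁻¹ (θ (mk [y])) = (θ (mk [y])).norm := by omega
  have h6 : 2 * gromov (θ (mk [y]))⁻¹ (θ (mk [z])) = (θ (mk [y])).norm := by omega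
  have hxz : x.1 = z.1 := by omega
  -- If z were x⁻¹, both halves of the image of y would match the same word, and y's image would
  -- cancel half of itself against its own square, contrary to `hstrict`.
  by_cases h7 : x.2 = z.2
  swap
  · have h8 : z = (x.1, !x.2) := Prod.ext hxz.symm (by cases h : x.2 <;> cases h' : z.2 <;> simp_all)
    rw [h8, hinv, _root_.map_inv] at h6
    have := min_le_gromov (θ (mk [y]))⁻¹ (θ (mk [x]))⁻¹ (θ (mk [y]))
    omega
  have h8 : z = x := (Prod.ext hxz h7).symm
  rw [h8] at h6
  have h9 := (hhalf x y h1).1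
  -- the half-half cancellation is removed by a conjugation
  obtain ⟨π, hπ, h10, h11⟩ := exists_permutation (y.1, !y.2) (x.1, !x.2) (fun h => h1 h.symm)
  rw [hinv] at h10 h11
  have hnorm := hsum x y h1
  set u := θ (mk [x])
  set v := θ (mk [y])
  set m := gromov u⁻¹ v with hm
  set p : F2 := mk (v.toWord.take m) with hp
  set q : F2 := mk (v.toWord.drop m) with hq
  have hpq : v = p * q := by rw [hp, hq, mul_mk, List.take_append_drop, mk_toWord]
  have hpw : p.toWord = v.toWord.take m :=
    toWord_mk_of_isReduced (isReduced_toWord.infix (List.take_prefix _ _).isInfix)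
  have hqw : q.toWord = v.toWord.drop m :=
    toWord_mk_of_isReduced (isReduced_toWord.infix (List.drop_suffix _ _).isInfix)
  have hvl : v.toWord.length = v.norm := rfl
  have hpn : p.norm = m := by
    unfold FreeGroup.norm; rw [hpw, List.length_take]; omega
  have hqn : q.norm = m := by
    unfold FreeGroup.norm; rw [hqw, List.length_drop]; omega
  have hc1 : gromov p v = m := by
    have := norm_inv_mul p v
    rw [hpq, inv_mul_cancel_left, ← hpq] at this
    omega
  have hc2 : gromov q⁻¹ v⁻¹ = m := by
    have := norm_inv_mul q⁻¹ v⁻¹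
    rw [hpq, mul_inv_rev, inv_mul_cancel_left, ← mul_inv_rev, ← hpq, norm_inv_eq, norm_inv_eq,
      norm_inv_eq] at this
    omega
  have hc3 : m ≤ gromov u⁻¹ p := by
    have := min_le_gromov u⁻¹ v p
    rw [gromov_comm v p] at this
    omega
  have hc4 : m ≤ gromov q⁻¹ u := by
    have := min_le_gromov q⁻¹ v⁻¹ u
    omega
  have hc4' : gromov q⁻¹ u ≤ m := by
    have := norm_mul q u
    have h12 := norm_mul_le q⁻¹ (q * u)
    rw [inv_mul_cancel_left, norm_inv_eq] at h12
    omega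
  have hc5 : m ≤ gromov (q * u)⁻¹ p := by
    have h12 := gromov_self_mul u⁻¹ q⁻¹
    rw [← mul_inv_rev, inv_inv, norm_inv_eq, gromov_comm u] at h12
    have h13 := min_le_gromov (q * u)⁻¹ u⁻¹ p
    rw [gromov_comm _ u⁻¹] at h13
    omega
  have h12 := norm_mul (q * u) p
  have h13 := norm_mul q u
  obtain ⟨k, hk⟩ : ∃ k, θ k = p⁻¹ := ⟨θ⁻¹ p⁻¹, by simp⟩
  -- With v = pq and |p| = |q| = m, the new pair is (qp)⁻¹, (qup)⁻¹, of lengths at most 2m and |u| -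
  -- 2m. The old total is |u| + 2m with m > 0.
  have h14 := hθ (MulAut.conj k * (π * tv)) (mul_mem
    (mem_elementary_of_mem_J (mem_J_of_mem_Inn (conj_mem_Inn _)))
    (mul_mem (mem_elementary_of_mem_J hπ.mem_J) tv_mem_elementary))
  simp only [MulAut.mul_apply, MulAut.conj_apply, tv_a, tv_b, _root_.map_mul, h10, h11,
    _root_.map_inv, hk, inv_inv] at h14
  change _ ≤ ((p⁻¹ * v * p)⁻¹).norm + ((p⁻¹ * u * p)⁻¹ * (p⁻¹ * v * p)⁻¹).norm at h14
  have h15 : (p⁻¹ * v * p)⁻¹ = (q * p)⁻¹ := by rw [hpq]; group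
  have h16 : (p⁻¹ * u * p)⁻¹ * (p⁻¹ * v * p)⁻¹ = (q * u * p)⁻¹ := by rw [hpq]; group
  rw [h16, h15, norm_inv_eq, norm_inv_eq] at h14
  have h17 := norm_mul_le q p
  omega

/-- Nielsen's theorem: the automorphism group of `F₂` is generated by the permutations, the inner
and the one-letter automorphisms. -/
theorem elementary_eq_top : elementary = ⊤ := by
  rw [Subgroup.eq_top_iff']
  intro φ
  obtain ⟨ψ, hψ⟩ := exists_minimalFor_of_wellFoundedLT (fun ψ => ψ ∈ elementary)
    (fun ψ => (φ (ψ a)).norm + (φ (ψ b)).norm) ⟨1, one_mem _⟩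
  have hmin : IsNielsen (φ * ψ) := by
    refine isNielsen_of_minimal fun χ hχ => ?_
    have := hψ.2 (mul_mem hψ.1 hχ)
    simp only [MulAut.mul_apply] at this ⊢
    omega
  have h1 := mem_elementary_of_mem_J (J.inv_mem hmin.isPermutation_inv.mem_J)
  rw [inv_inv] at h1
  have := mul_mem h1 (inv_mem hψ.1)
  rwa [mul_inv_cancel_right] at this

/-- The products of the automorphisms `tv` and `tv'`. -/
inductive IsPositive : MulAut F2 → Prop
  | one : IsPositive 1
  | tv_mul {φ : MulAut F2} : IsPositive φ → IsPositive (tv * φ)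
  | tv'_mul {φ : MulAut F2} : IsPositive φ → IsPositive (tv' * φ)

/-- The automorphisms `j * φ * j'` modulo inner automorphisms, where `φ` is positive and `j`, `j'`
lie in `J`. -/
def IsFactored (φ : MulAut F2) : Prop :=
  ∃ j ∈ J, ∃ χ, IsPositive χ ∧ ∃ j' ∈ J, out φ = out (j * χ * j')

theorem IsFactored.congr {φ ψ : MulAut F2} (h : IsFactored φ) (e : out ψ = out φ) :
    IsFactored ψ := by
  obtain ⟨j, hj, χ, hχ, j', hj', h⟩ := h
  exact ⟨j, hj, χ, hχ, j', hj', e.trans h⟩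

theorem IsFactored.J_mul {φ ψ : MulAut F2} (h : IsFactored φ) (hψ : ψ ∈ J) :
    IsFactored (ψ * φ) := by
  obtain ⟨j, hj, χ, hχ, j', hj', h⟩ := h
  exact ⟨ψ * j, J.mul_mem hψ hj, χ, hχ, j', hj', by rw [_root_.map_mul, h, ← _root_.map_mul]; rfl⟩

/-- An inverse move meeting the first positive factor either cancels it or merges with it into a
permutation times a positive move. If there is no factor left, `flip` turns the inverse move into a
positive one. -/
theorem isFactored_move_mul {χ j' : MulAut F2} (hχ : IsPositive χ) (hj' : j' ∈ J) (i : Fin 4) :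
    IsFactored (move i * χ * j') := by
  have pos : ∀ {χ j' : MulAut F2}, IsPositive χ → j' ∈ J → IsFactored (χ * j') :=
    fun {χ j'} hχ hj' => ⟨1, J.one_mem, χ, hχ, j', hj', rfl⟩
  have hfs := J.mul_mem flip_mem_J swap_mem_J
  have hsf := J.mul_mem swap_mem_J flip_mem_J
  fin_cases i
  · exact pos hχ.tv_mul hj'
  · exact pos hχ.tv'_mul hj'
  · change IsFactored (tv⁻¹ * χ * j')
    cases hχ with
    | one =>
      refine (((pos IsPositive.one.tv_mul (J.mul_mem flip_mem_J hj'))).J_mul flip_mem_J).congr ?_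
      simp only [_root_.map_mul, ← flip_tv_flip, mul_one, mul_assoc]
    | tv_mul h =>
      rw [inv_mul_cancel_left]
      exact pos h hj'
    | @tv'_mul φ h =>
      refine ((pos h.tv_mul hj').J_mul hsf).congr ?_
      have := out_tv_inv_mul_tv'
      simp only [_root_.map_mul] at this ⊢
      rw [← mul_assoc, this]
      simp only [mul_assoc]
  · change IsFactored (tv'⁻¹ * χ * j')
    cases hχ with
    | one =>
      refine (((pos IsPositive.one.tv'_mul (J.mul_mem flip_mem_J hj'))).J_mul flip_mem_J).congr ?_
      simp only [_root_.map_mul, ← flip_tv'_flip, mul_one, mul_assoc]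
    | @tv_mul φ h =>
      refine ((pos h.tv'_mul hj').J_mul hfs).congr ?_
      have := out_tv'_inv_mul_tv
      simp only [_root_.map_mul] at this ⊢
      rw [← mul_assoc, this]
      simp only [mul_assoc]
    | tv'_mul h =>
      rw [inv_mul_cancel_left]
      exact pos h hj'

/-- Permutations normalize the one-letter automorphisms modulo inner automorphisms. -/
theorem exists_move_mul_eq {j : MulAut F2} (hj : j ∈ J) (i : Fin 4) :
    ∃ k, out (move i * j) = out (j * move k) := by
  obtain ⟨π, hπ, e⟩ := exists_permutation_of_mem_J hj
  obtain ⟨k, hk⟩ := ((isOneLetter_move i).conj hπ.inv).exists_move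
  refine ⟨k, ?_⟩
  simp only [_root_.map_mul, inv_inv, _root_.map_inv] at hk ⊢
  rw [e, ← hk]; group

theorem IsFactored.move_mul {φ : MulAut F2} (h : IsFactored φ) (i : Fin 4) :
    IsFactored (move i * φ) := by
  obtain ⟨j, hj, χ, hχ, j', hj', h⟩ := h
  obtain ⟨k, hk⟩ := exists_move_mul_eq hj i
  refine ((isFactored_move_mul hχ hj' k).J_mul hj).congr ?_
  simp only [_root_.map_mul] at hk h ⊢
  rw [h, ← mul_assoc, ← mul_assoc, hk]
  simp only [mul_assoc]

theorem isFactored (φ : MulAut F2) : IsFactored φ := by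
  have hφ : φ ∈ Subgroup.closure (insert tv (J : Set (MulAut F2))) := by
    have : φ ∈ elementary := elementary_eq_top ▸ Subgroup.mem_top φ
    exact this
  induction hφ using Subgroup.closure_induction_left with
  | one => exact ⟨1, J.one_mem, 1, .one, 1, J.one_mem, rfl⟩
  | mul_left x hx y _ ih =>
    rcases hx with rfl | hx
    · exact ih.move_mul 0
    · exact ih.J_mul hx
  | inv_mul_cancel x hx y _ ih =>
    rcases hx with rfl | hx
    · exact ih.move_mul 2
    · exact ih.J_mul (J.inv_mem hx)

end F2

/-! ### How squares and turns change under the moves -/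

namespace F2

open FreeGroup

theorem cycNorm_congr_J {x y : F2} (h : JEquiv x y) : cycNorm x = cycNorm y :=
  h.congr_of_invariant (fun _ _ => cycNorm_congr) cycNorm_flip cycNorm_swap

theorem cycNorm_eq_of_out_mul {φ ψ χ : MulAut F2} {g : F2} (h : out (φ * ψ) = out χ) :
    cycNorm (φ (ψ g)) = cycNorm (χ g) := by
  rw [← MulAut.mul_apply]
  exact cycNorm_congr (isConj_of_out_eq h g)

/-- The inverse move restores the length, so the two length formulas add up to zero. -/
theorem turns_tv (g : F2) : turns (tv g) = squares 1 (tv g) + squares 1 g + turns g := by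
  have h1 := cycNorm_tv_inv (tv g)
  have h2 := cycNorm_tv g
  rw [show tv⁻¹ (tv g) = g by simp] at h1
  omega

theorem turns_tv' (g : F2) : turns (tv' g) = squares 0 (tv' g) + squares 0 g + turns g := by
  have h1 := cycNorm_tv'_inv (tv' g)
  have h2 := cycNorm_tv' g
  rw [show tv'⁻¹ (tv' g) = g by simp] at h1
  omega

theorem turns_tv_inv (g : F2) : turns (tv⁻¹ g) = turns g - squares 1 g - squares 1 (tv⁻¹ g) := by
  have h1 := cycNorm_tv (tv⁻¹ g)
  have h2 := cycNorm_tv_inv g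
  rw [show tv (tv⁻¹ g) = g by simp] at h1
  omega

theorem turns_tv'_inv (g : F2) :
    turns (tv'⁻¹ g) = turns g - squares 0 g - squares 0 (tv'⁻¹ g) := by
  have h1 := cycNorm_tv' (tv'⁻¹ g)
  have h2 := cycNorm_tv'_inv g
  rw [show tv' (tv'⁻¹ g) = g by simp] at h1
  omega

theorem cycNorm_J_mul {ψ : MulAut F2} (hψ : ψ ∈ J) (φ : MulAut F2) (g : F2) :
    cycNorm ((ψ * φ) g) = cycNorm (φ g) := (cycNorm_congr_J (jEquiv_apply hψ (φ g))).symm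

theorem flip_mul_swap_mem_J : flip * swap ∈ J := J.mul_mem flip_mem_J swap_mem_J

theorem swap_mul_flip_mem_J : swap * flip ∈ J := J.mul_mem swap_mem_J flip_mem_J

/-- By the relation in Out, `tv'⁻¹ (tv g)` and `tv' g` have the same cyclic length; compute it in
both ways. -/
theorem squares_zero_tv (g : F2) :
    squares 0 (tv g) = turns (tv g) + squares 0 g - squares 1 g := by
  have h1 := cycNorm_eq_of_out_mul (g := g) out_tv'_inv_mul_tv
  rw [cycNorm_J_mul flip_mul_swap_mem_J] at h1
  have h2 := cycNorm_tv'_inv (tv g)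
  have h3 := cycNorm_tv g
  have h4 := cycNorm_tv' g
  omega

theorem squares_one_tv' (g : F2) :
    squares 1 (tv' g) = turns (tv' g) + squares 1 g - squares 0 g := by
  have h1 := cycNorm_eq_of_out_mul (g := g) out_tv_inv_mul_tv'
  rw [cycNorm_J_mul swap_mul_flip_mem_J] at h1
  have h2 := cycNorm_tv_inv (tv' g)
  have h3 := cycNorm_tv g
  have h4 := cycNorm_tv' g
  omega

theorem squares_zero_tv_inv (g : F2) :
    squares 0 (tv⁻¹ g) = -turns (tv⁻¹ g) + squares 0 g - squares 1 g := by
  have h1 := cycNorm_eq_of_out_mul (g := g) out_tv'_mul_tv_inv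
  rw [cycNorm_J_mul swap_mul_flip_mem_J] at h1
  have h2 := cycNorm_tv' (tv⁻¹ g)
  have h3 := cycNorm_tv_inv g
  have h4 := cycNorm_tv'_inv g
  omega

theorem squares_one_tv'_inv (g : F2) :
    squares 1 (tv'⁻¹ g) = -turns (tv'⁻¹ g) + squares 1 g - squares 0 g := by
  have h1 := cycNorm_eq_of_out_mul (g := g) out_tv_mul_tv'_inv
  rw [cycNorm_J_mul flip_mul_swap_mem_J] at h1
  have h2 := cycNorm_tv (tv'⁻¹ g)
  have h3 := cycNorm_tv_inv g
  have h4 := cycNorm_tv'_inv g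
  omega

/-- The lengths of an element and of its images under a move and its inverse determine the squares:
the turns drop out of the sum. Invariance of lengths is all that is needed. -/
theorem squares_congr {i : Fin 2} {x y : F2} (h : IsConj x y) : squares i x = squares i y := by
  have h0 := cycNorm_congr h
  have h1 := fun φ : MulAut F2 => cycNorm_congr (isConj_map φ h)
  fin_cases i
  · have h2 := cycNorm_tv' x
    have h3 := cycNorm_tv'_inv x
    rw [h0, h1] at h2 h3
    have h4 := cycNorm_tv' y
    have h5 := cycNorm_tv'_inv y
    simp only [Fin.zero_eta]
    omega
  · have h2 := cycNorm_tv x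
    have h3 := cycNorm_tv_inv x
    rw [h0, h1] at h2 h3
    have h4 := cycNorm_tv y
    have h5 := cycNorm_tv_inv y
    simp only [Fin.mk_one]
    omega

theorem cycNorm_tv_flip (g : F2) : cycNorm (tv (flip g)) = cycNorm (tv⁻¹ g) := by
  rw [← cycNorm_congr (isConj_of_out_eq flip_tv_flip g)]
  exact (cycNorm_flip _).symm

theorem cycNorm_tv_inv_flip (g : F2) : cycNorm (tv⁻¹ (flip g)) = cycNorm (tv g) := by
  rw [← cycNorm_tv_flip, flip_flip]

theorem cycNorm_tv'_flip (g : F2) : cycNorm (tv' (flip g)) = cycNorm (tv'⁻¹ g) := by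
  rw [← flip_tv'_flip]
  exact (cycNorm_flip _).symm

theorem cycNorm_tv'_inv_flip (g : F2) : cycNorm (tv'⁻¹ (flip g)) = cycNorm (tv' g) := by
  rw [← cycNorm_tv'_flip, flip_flip]

theorem cycNorm_tv'_swap (g : F2) : cycNorm (tv' (swap g)) = cycNorm (tv g) := by
  have : tv' (swap g) = swap (tv g) := by simp [tv']
  rw [this, cycNorm_swap]

theorem cycNorm_tv'_inv_swap (g : F2) : cycNorm (tv'⁻¹ (swap g)) = cycNorm (tv⁻¹ g) := by
  have : tv'⁻¹ (swap g) = swap (tv⁻¹ g) := by rw [tv'_inv]; simp [MulAut.mul_apply]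
  rw [this, cycNorm_swap]

theorem squares_flip (i : Fin 2) (g : F2) : squares i (flip g) = squares i g := by
  have h0 := cycNorm_flip g
  fin_cases i
  · have h2 := cycNorm_tv' (flip g)
    have h3 := cycNorm_tv'_inv (flip g)
    rw [cycNorm_tv'_flip] at h2
    rw [cycNorm_tv'_inv_flip] at h3
    have h4 := cycNorm_tv' g
    have h5 := cycNorm_tv'_inv g
    simp only [Fin.zero_eta]
    omega
  · have h2 := cycNorm_tv (flip g)
    have h3 := cycNorm_tv_inv (flip g)
    rw [cycNorm_tv_flip] at h2
    rw [cycNorm_tv_inv_flip] at h3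
    have h4 := cycNorm_tv g
    have h5 := cycNorm_tv_inv g
    simp only [Fin.mk_one]
    omega

theorem squares_zero_swap (g : F2) : squares 0 (swap g) = squares 1 g := by
  have h0 := cycNorm_swap g
  have h2 := cycNorm_tv' (swap g)
  have h3 := cycNorm_tv'_inv (swap g)
  rw [cycNorm_tv'_swap] at h2
  rw [cycNorm_tv'_inv_swap] at h3
  have h4 := cycNorm_tv g
  have h5 := cycNorm_tv_inv g
  omega

theorem squares_one_swap (g : F2) : squares 1 (swap g) = squares 0 g := by
  rw [← squares_zero_swap, swap_swap]

/-- Neither `aa` nor `bb` nor their inverses occur in the cyclic word of `g`. -/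
def SquareFree (g : F2) : Prop := squares 0 g = 0 ∧ squares 1 g = 0

theorem squareFree_iff (g : F2) : SquareFree g ↔ squares 0 g + squares 1 g = 0 := by
  have h0 := squares_nonneg 0 g
  have h1 := squares_nonneg 1 g
  unfold SquareFree
  omega

theorem squareFree_congr {x y : F2} (h : JEquiv x y) : SquareFree x ↔ SquareFree y := by
  rw [squareFree_iff, squareFree_iff]
  rw [h.congr_of_invariant (f := fun g => squares 0 g + squares 1 g)]
  · intro x y h
    simp only [squares_congr h]
  · intro x
    simp only [squares_flip]
  · intro x
    simp only [squares_zero_swap, squares_one_swap]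
    ring

/-! ### Monotone lengths, level moves and tables -/

/-- No one-letter automorphism makes the cyclic word of `g` shorter. -/
def IsLocMin (g : F2) : Prop := ∀ i, cycNorm g ≤ cycNorm (move i g)

theorem isLocMin_congr {x y : F2} (h : JEquiv x y) (hx : IsLocMin x) : IsLocMin y := by
  obtain ⟨j, hj, rfl⟩ := h
  intro i
  obtain ⟨k, hk⟩ := exists_move_mul_eq hj i
  rw [cycNorm_eq_of_out_mul hk, cycNorm_J_mul hj, ← cycNorm_congr_J (jEquiv_apply hj x)]
  exact hx k

/-- The two inequalities say that neither positive move shortens. They persist, because by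
`turns_tv` and `turns_tv'` the turns after a positive move are nonnegative. -/
theorem IsPositive.cycNorm_le {χ : MulAut F2} (hχ : IsPositive χ) {g : F2}
    (h0 : 0 ≤ squares 0 g + turns g) (h1 : 0 ≤ squares 1 g + turns g) :
    cycNorm g ≤ cycNorm (χ g) ∧ 0 ≤ squares 0 (χ g) + turns (χ g) ∧
      0 ≤ squares 1 (χ g) + turns (χ g) := by
  induction hχ with
  | one => exact ⟨le_rfl, h0, h1⟩
  | @tv_mul φ _ ih =>
    rw [MulAut.mul_apply]
    have h2 := cycNorm_tv (φ g)
    have h3 := turns_tv (φ g)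
    have h4 := squares_nonneg 0 (tv (φ g))
    have h5 := squares_nonneg 1 (tv (φ g))
    omega
  | @tv'_mul φ _ ih =>
    rw [MulAut.mul_apply]
    have h2 := cycNorm_tv' (φ g)
    have h3 := turns_tv' (φ g)
    have h4 := squares_nonneg 0 (tv' (φ g))
    have h5 := squares_nonneg 1 (tv' (φ g))
    omega

/-- A subset of `F₂` that is invariant under `J` and under the one-letter automorphisms that
preserve the cyclic length contains all images of minimal length of its locally minimal elements. -/
theorem mem_of_level {S : Set F2} (hJ : ∀ x ∈ S, ∀ y, JEquiv x y → y ∈ S)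
    (hS : ∀ x ∈ S, ∀ i, cycNorm (move i x) = cycNorm x → move i x ∈ S) {w : F2} (hw : w ∈ S)
    (hmin : IsLocMin w) (φ : MulAut F2) :
    cycNorm w ≤ cycNorm (φ w) ∧ (cycNorm (φ w) = cycNorm w → φ w ∈ S) := by
  have pos : ∀ χ, IsPositive χ → ∀ g ∈ S, IsLocMin g → cycNorm g ≤ cycNorm (χ g) ∧
      (cycNorm (χ g) = cycNorm g → χ g ∈ S) := by
    intro χ hχ g hg hmin
    have h0 : 0 ≤ squares 0 g + turns g := by
      have h1 := hmin 1
      have h2 := cycNorm_tv' g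
      rw [move_one] at h1
      omega
    have h1 : 0 ≤ squares 1 g + turns g := by
      have h1 := hmin 0
      have h2 := cycNorm_tv g
      rw [move_zero] at h1
      omega
    refine ⟨(hχ.cycNorm_le h0 h1).1, ?_⟩
    induction hχ with
    | one => exact fun _ => hg
    | @tv_mul φ hφ ih =>
      intro h
      have h2 := hφ.cycNorm_le h0 h1
      have h3 := cycNorm_tv (φ g)
      rw [MulAut.mul_apply] at h ⊢
      -- Lengths are monotone along the product, so equality at the end forces equality at each
      -- intermediate factor.
      exact hS _ (ih (by omega)) 0 (by rw [move_zero]; omega)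
    | @tv'_mul φ hφ ih =>
      intro h
      have h2 := hφ.cycNorm_le h0 h1
      have h3 := cycNorm_tv' (φ g)
      rw [MulAut.mul_apply] at h ⊢
      exact hS _ (ih (by omega)) 1 (by rw [move_one]; omega)
  obtain ⟨j, hj, χ, hχ, j', hj', h⟩ := isFactored φ
  have h1 : JEquiv (χ (j' w)) (φ w) :=
    (jEquiv_apply hj _).trans (JEquiv.of_out_eq h w).symm
  have h2 := jEquiv_apply hj' w
  obtain ⟨h3, h4⟩ := pos χ hχ (j' w) (hJ w hw _ h2) (isLocMin_congr h2 hmin)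
  rw [← cycNorm_congr_J h1, cycNorm_congr_J h2]
  exact ⟨h3, fun h5 => hJ _ (h4 h5) _ h1⟩

/-- The elements `u i` are of cyclic length `m`, and the one-letter automorphism `move k` maps `u i`
to an element equivalent to `u t` if `tgt i k = some t`, and to a longer one if
`tgt i k = none`. -/
structure IsLevelTable {n : ℕ} (u : Fin n → F2) (tgt : Fin n → Fin 4 → Option (Fin n))
    (m : ℕ) : Prop where
  cycNorm_eq : ∀ i, cycNorm (u i) = m
  equiv_of_some : ∀ i k t, tgt i k = some t → JEquiv (move k (u i)) (u t)
  lt_of_none : ∀ i k, tgt i k = none → m < cycNorm (move k (u i))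

namespace IsLevelTable

variable {n m : ℕ} {u : Fin n → F2} {tgt : Fin n → Fin 4 → Option (Fin n)}

/-- Elements of `J` only permute the moves, so the union of the classes of the entries is closed
under level moves and `mem_of_level` applies. -/
theorem level (h : IsLevelTable u tgt m) (i : Fin n) (φ : MulAut F2) :
    m ≤ cycNorm (φ (u i)) ∧ (cycNorm (φ (u i)) = m → ∃ t, JEquiv (φ (u i)) (u t)) := by
  have hmin : IsLocMin (u i) := by
    intro k
    rw [h.cycNorm_eq]
    cases e : tgt i k with
    | none => exact (h.lt_of_none i k e).le
    | some t => rw [cycNorm_congr_J (h.equiv_of_some i k t e), h.cycNorm_eq]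
  have := mem_of_level (S := {g | ∃ t, JEquiv g (u t)})
    (fun x ⟨t, ht⟩ y hy => ⟨t, hy.symm.trans ht⟩) ?_ ⟨i, JEquiv.refl _⟩ hmin φ
  · rwa [h.cycNorm_eq] at this
  · rintro x ⟨t, ht⟩ k hk
    obtain ⟨j, hj, rfl⟩ := ht.symm
    obtain ⟨l, hl⟩ := exists_move_mul_eq hj k
    have h1 : JEquiv (move k (j (u t))) (move l (u t)) :=
      (JEquiv.of_out_eq hl (u t)).trans (jEquiv_apply hj _).symm
    rw [cycNorm_congr_J h1, ← cycNorm_congr_J (jEquiv_apply hj (u t)), h.cycNorm_eq] at hk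
    cases e : tgt t l with
    | none => exact absurd hk (h.lt_of_none t l e).ne'
    | some s => exact ⟨s, h1.trans (h.equiv_of_some t l s e)⟩

end IsLevelTable

theorem apply_mem_of_isAutClass {W : Set F2} (hW : IsAutClass W) {x : F2} (hx : x ∈ W)
    (φ : MulAut F2) : φ x ∈ W := by
  obtain ⟨w, rfl⟩ := hW
  obtain ⟨ψ, rfl⟩ := hx
  exact ⟨φ * ψ, rfl⟩

theorem mem_of_isConj {W : Set F2} (hW : IsAutClass W) {x y : F2} (hx : x ∈ W)
    (h : IsConj x y) : y ∈ W := by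
  obtain ⟨g, hg⟩ := isConj_iff.1 h
  have := apply_mem_of_isAutClass hW hx (MulAut.conj g)
  rwa [MulAut.conj_apply, hg] at this

theorem exists_aut_of_mem {W : Set F2} (hW : IsAutClass W) {x y : F2} (hx : x ∈ W)
    (hy : y ∈ W) : ∃ φ : MulAut F2, φ x = y := by
  obtain ⟨w, rfl⟩ := hW
  obtain ⟨ψ, rfl⟩ := hx
  obtain ⟨χ, rfl⟩ := hy
  exact ⟨χ * ψ⁻¹, by simp [MulAut.mul_apply]⟩

theorem norm_mk_cycWord (g : F2) : (mk (cycWord g)).norm = cycNorm g := by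
  have h := isCyclicallyReduced_cycWord g
  rw [FreeGroup.norm, toWord_mk_of_isReduced h.isReduced]
  rfl

/-- In a class whose minimal cyclic length is `m`, the minimal words are those of length `m`. -/
theorem isMinimal_iff {W : Set F2} (hW : IsAutClass W) {x : F2} {m : ℕ} (hx : x ∈ W)
    (hm : cycNorm x = m) (hmin : ∀ φ : MulAut F2, m ≤ cycNorm (φ x)) {v : F2} (hv : v ∈ W) :
    IsMinimal v ↔ v.norm = m := by
  have h1 : ∀ y ∈ W, m ≤ y.norm := by
    intro y hy
    obtain ⟨φ, rfl⟩ := exists_aut_of_mem hW hx hy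
    exact (hmin φ).trans (cycNorm_le_norm _)
  constructor
  · intro h
    obtain ⟨φ, hφ⟩ := exists_aut_of_mem hW hv (mem_of_isConj hW hx (isConj_mk_cycWord x).symm)
    have h2 := h φ
    rw [hφ, norm_mk_cycWord, hm] at h2
    exact le_antisymm h2 (h1 v hv)
  · intro h φ
    rw [h]
    exact h1 _ (apply_mem_of_isAutClass hW hv φ)

theorem IsMinimal.isCyclic {v : F2} (h : IsMinimal v) : IsCyclic v := by
  refine isCyclicallyReduced_of_cycNorm_eq (le_antisymm (cycNorm_le_norm v) ?_)
  obtain ⟨g, hg⟩ := isConj_iff.1 (isConj_mk_cycWord v).symm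
  have := h (MulAut.conj g)
  rwa [MulAut.conj_apply, hg, norm_mk_cycWord] at this

namespace IsLevelTable

variable {n m : ℕ} {u : Fin n → F2} {tgt : Fin n → Fin 4 → Option (Fin n)}

/-- The vertices that the entries of a table represent, and their numbers of edges. -/
theorem exists_vertex [NeZero n] (h : IsLevelTable u tgt m) {W : Set F2} (hW : IsAutClass W)
    (hu : ∀ i, u i ∈ W) :
    ∃ e : Fin n → Vertex W, Function.Surjective e ∧
      (∀ i, ∃ w : MinimalWord W, JEquiv w.1 (u i) ∧ Quotient.mk (jSetoid W) w = e i) ∧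
      (∀ i j, e i = e j → JEquiv (u i) (u j)) ∧
      ((∀ i j, JEquiv (u i) (u j) → i = j) → ∀ i j, (Gamma W).edges (e i) (e j) =
        (Finset.univ.filter fun k => tgt i k = some j).card) := by
  have hmin : ∀ {v}, v ∈ W → (IsMinimal v ↔ v.norm = m) :=
    isMinimal_iff hW (hu 0) (h.cycNorm_eq 0) fun φ => (h.level 0 φ).1
  -- Entries need not be cyclically reduced, hence need not be minimal words; their cyclic
  -- reductions are.
  let r : Fin n → MinimalWord W := fun i => ⟨FreeGroup.mk (cycWord (u i)),
    mem_of_isConj hW (hu i) (isConj_mk_cycWord _).symm,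
    (hmin (mem_of_isConj hW (hu i) (isConj_mk_cycWord _).symm)).2
      (by rw [norm_mk_cycWord, h.cycNorm_eq])⟩
  have hr : ∀ i, JEquiv (r i).1 (u i) := fun i => .of_isConj (isConj_mk_cycWord _)
  refine ⟨fun i => Quotient.mk (jSetoid W) (r i), ?_, fun i => ⟨r i, hr i, rfl⟩, ?_, ?_⟩
  · intro q
    induction q using Quotient.inductionOn with
    | h v =>
      obtain ⟨φ, hφ⟩ := exists_aut_of_mem hW (hu 0) v.2.1
      have h1 := cycNorm_eq_norm v.2.2.isCyclic
      rw [(hmin v.2.1).1 v.2.2, ← hφ] at h1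
      obtain ⟨t, ht⟩ := (h.level 0 φ).2 h1
      rw [hφ] at ht
      exact ⟨t, Quotient.sound (s := jSetoid W) ((hr t).trans ht.symm)⟩
  · intro i j hij
    have h1 : JEquiv (r i).1 (r j).1 := Quotient.exact (s := jSetoid W) hij
    exact (hr i).symm.trans (h1.trans (hr j))
  · intro hinj i j
    change edgeCount (r i).1 (r j).1 = _
    classical
    rw [edgeCount_congr (hr i) (hr j), edgeCount_eq_card]
    congr 1
    ext k
    simp only [Finset.mem_filter, Finset.mem_univ, true_and]
    cases e : tgt i k with
    | none =>
      have h1 := h.lt_of_none i k e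
      simp only [reduceCtorEq, iff_false]
      intro h2
      rw [cycNorm_congr_J h2, h.cycNorm_eq] at h1
      exact lt_irrefl _ h1
    | some t =>
      have h1 := h.equiv_of_some i k t e
      rw [Option.some_inj]
      exact ⟨fun h2 => hinj _ _ (h1.symm.trans h2), fun h2 => h2 ▸ h1⟩

theorem card_vertex [NeZero n] (h : IsLevelTable u tgt m) {W : Set F2} (hW : IsAutClass W)
    (hu : ∀ i, u i ∈ W) : Nat.card (Vertex W) ≠ 0 ∧ Nat.card (Vertex W) ≤ n := by
  obtain ⟨e, he, -⟩ := h.exists_vertex hW hu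
  have : Finite (Vertex W) := Finite.of_surjective e he
  have : Nonempty (Vertex W) := ⟨e 0⟩
  exact ⟨Nat.card_pos.ne', by simpa using Nat.card_le_card_of_surjective e he⟩

end IsLevelTable

/-! ### From subword counts to sums over junctions -/

theorem pairSum_eq_sum (f : Fin 2 × Bool → Fin 2 × Bool → ℤ) (d : Fin 2 × Bool) :
    ∀ L : List (Fin 2 × Bool),
      pairSum f L = ∑ i ∈ Finset.range (L.length - 1), f (L.getD i d) (L.getD (i + 1) d)
  | [] => rfl
  | [_] => rfl
  | x :: y :: l => by
    rw [pairSum, pairSum_eq_sum f d (y :: l), List.length_cons, Nat.add_sub_cancel,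
      List.length_cons, Nat.add_sub_cancel, List.length_cons, Finset.sum_range_succ',
      add_comm]
    simp only [List.getD_cons_succ, List.getD_cons_zero]

theorem cycSum_eq_sum (f : Fin 2 × Bool → Fin 2 × Bool → ℤ) (d : Fin 2 × Bool)
    (L : List (Fin 2 × Bool)) :
    cycSum f L = ∑ i ∈ Finset.range L.length, f (L.getD i d) (L.getD ((i + 1) % L.length) d) := by
  cases L with
  | nil => rfl
  | cons x L =>
    rw [cycSum_cons, pairSum_eq_sum f d]
    simp only [List.length_cons, List.length_append, List.length_nil, zero_add,
      Nat.add_sub_cancel]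
    refine Finset.sum_congr rfl fun i hi => ?_
    rw [Finset.mem_range] at hi
    rw [← List.cons_append, List.getD_append _ _ _ _ (by simpa using hi)]
    congr 1
    rcases (Nat.lt_succ_iff.1 hi).lt_or_eq with h | rfl
    · rw [Nat.mod_eq_of_lt (by omega), List.getD_append _ _ _ _ (by simpa using h)]
    · rw [Nat.mod_self, List.getD_append_right _ _ _ _ (by simp)]
      simp

theorem pair_prefix_rotate_iff {L : List (Fin 2 × Bool)} (hL : 2 ≤ L.length) {i : ℕ}
    (hi : i < L.length) (x y d : Fin 2 × Bool) :
    [x, y] <+: L.rotate i ↔ L.getD i d = x ∧ L.getD ((i + 1) % L.length) d = y := by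
  have h0 : (L.rotate i)[0]? = some (L.getD i d) := by
    rw [List.getElem?_rotate (by omega), zero_add, Nat.mod_eq_of_lt hi, List.getD_eq_getElem?_getD,
      List.getElem?_eq_getElem hi]
    rfl
  have h1 : (L.rotate i)[1]? = some (L.getD ((i + 1) % L.length) d) := by
    have : (i + 1) % L.length < L.length := Nat.mod_lt _ (by omega)
    rw [List.getElem?_rotate (by omega), add_comm 1, List.getD_eq_getElem?_getD,
      List.getElem?_eq_getElem this]
    rfl
  generalize L.rotate i = M at *
  match M with
  | [] => simp at h0
  | [_] => simp at h1
  | z :: t :: M =>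
    simp only [List.getElem?_cons_zero, List.getElem?_cons_succ, Option.some.injEq] at h0 h1
    rw [← h0, ← h1]
    simp [List.cons_prefix_cons, eq_comm]

/-- Length one is a true exception: the only letter follows itself around the cycle and `cycSum`
sees a pair there, whereas a subword longer than the word is not counted. -/
theorem subwordCount_eq_cycSum {u w : F2} {x y x' y' : Fin 2 × Bool} (hu : u.toWord = [x, y])
    (hu' : (u⁻¹).toWord = [x', y']) (hw : IsCyclic w) (h1 : w.norm ≠ 1) :
    (subwordCount u w : ℤ) = cycSum
      (fun s t => if (s = x ∧ t = y) ∨ (s = x' ∧ t = y') then 1 else 0) (cycWord w) := by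
  have hcyc : cycWord w = w.toWord := reduceCyclically_eq_self hw
  have h2 : w.toWord.length ≠ 1 := h1
  rw [hcyc, cycSum_eq_sum _ (0, true)]
  unfold subwordCount
  rw [Finset.card_filter, Nat.cast_sum, hu, hu']
  refine Finset.sum_congr rfl fun i hi => ?_
  rw [Finset.mem_range] at hi
  have h3 : 2 ≤ w.toWord.length := by omega
  simp only [pair_prefix_rotate_iff h3 hi _ _ (0, true)]
  split_ifs <;> simp

theorem subwordCount_aa {w : F2} (hw : IsCyclic w) (h1 : w.norm ≠ 1) :
    (subwordCount (a * a) w : ℤ) = squares 0 w := by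
  rw [subwordCount_eq_cycSum (x := (0, true)) (y := (0, true)) (x' := (0, false))
    (y' := (0, false)) (by decide) (by decide) hw h1]
  unfold squares
  congr 1
  funext x y
  revert x y
  decide

theorem subwordCount_bb {w : F2} (hw : IsCyclic w) (h1 : w.norm ≠ 1) :
    (subwordCount (b * b) w : ℤ) = squares 1 w := by
  rw [subwordCount_eq_cycSum (x := (1, true)) (y := (1, true)) (x' := (1, false))
    (y' := (1, false)) (by decide) (by decide) hw h1]
  unfold squares
  congr 1
  funext x y
  revert x y
  decide

theorem subwordCount_ab_sub {w : F2} (hw : IsCyclic w) (h1 : w.norm ≠ 1) :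
    (subwordCount (a * b) w : ℤ) - subwordCount (a * b⁻¹) w = turns w := by
  rw [subwordCount_eq_cycSum (x := (0, true)) (y := (1, true)) (x' := (1, false))
    (y' := (0, false)) (by decide) (by decide) hw h1,
    subwordCount_eq_cycSum (x := (0, true)) (y := (1, false)) (x' := (1, true))
    (y' := (0, false)) (by decide) (by decide) hw h1, sub_eq_add_neg, ← cycSum_neg, ← cycSum_add]
  unfold turns
  congr 1
  funext x y
  revert x y
  decide

theorem isAlternating_iff {w : F2} (hw : IsCyclic w) (h1 : w.norm ≠ 1) :
    IsAlternating w ↔ SquareFree w := by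
  have h2 := subwordCount_aa hw h1
  have h3 := subwordCount_bb hw h1
  unfold IsAlternating SquareFree
  rw [← h2, ← h3]
  simp only [Nat.cast_eq_zero]
  tauto

theorem IsLevelTable.pointedIso {n m : ℕ} [NeZero n] {u : Fin n → F2}
    {tgt : Fin n → Fin 4 → Option (Fin n)} (h : IsLevelTable u tgt m) {W : Set F2}
    (hW : IsAutClass W) (hu : ∀ i, u i ∈ W) (hinj : ∀ i j, JEquiv (u i) (u j) → i = j)
    (hm : m ≠ 1) (halt : ∀ i, SquareFree (u i) ↔ i = 0) {M : Matrix (Fin n) (Fin n) ℕ}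
    (hM : ∀ i j, M i j = (Finset.univ.filter fun k => tgt i k = some j).card) :
    ∃ v₀ : Vertex W, (∀ v : Vertex W, v.HasAlternating ↔ v = v₀) ∧
      (Gamma W).PointedIso v₀ (ofMatrix M) 0 := by
  obtain ⟨e, he, hrep, heq, hedge⟩ := h.exists_vertex hW hu
  have hmin : ∀ {v}, v ∈ W → (IsMinimal v ↔ v.norm = m) :=
    isMinimal_iff hW (hu 0) (h.cycNorm_eq 0) fun φ => (h.level 0 φ).1
  have halt' : ∀ w : MinimalWord W, IsAlternating w.1 ↔ SquareFree w.1 := fun w =>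
    isAlternating_iff w.2.2.isCyclic (by rw [(hmin w.2.1).1 w.2.2]; exact hm)
  refine ⟨e 0, fun v => ⟨?_, ?_⟩, ?_⟩
  · rintro ⟨w, hw, rfl⟩
    obtain ⟨i, hi⟩ := he (Quotient.mk (jSetoid W) w)
    obtain ⟨w', hw', hi'⟩ := hrep i
    have h1 : JEquiv w'.1 w.1 := Quotient.exact (s := jSetoid W) (hi'.trans hi)
    rw [halt', ← squareFree_congr h1, squareFree_congr hw', halt] at hw
    rw [← hi, hw]
  · rintro rfl
    obtain ⟨w, hw, hi⟩ := hrep 0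
    exact ⟨w, (halt' w).2 ((squareFree_congr hw).2 ((halt 0).2 rfl)), hi⟩
  · have hbij : Function.Bijective e := ⟨fun i j hij => hinj _ _ (heq i j hij), he⟩
    refine ⟨(Equiv.ofBijective e hbij).symm, ?_, ?_⟩
    · rw [Equiv.symm_apply_eq]; rfl
    · intro x y
      obtain ⟨i, rfl⟩ := he x
      obtain ⟨j, rfl⟩ := he y
      have h1 : ∀ i, (Equiv.ofBijective e hbij).symm (e i) = i := fun i =>
        (Equiv.ofBijective e hbij).symm_apply_apply i
      rw [hedge hinj, h1, h1]
      exact (hM i j).symm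

end F2

/-! ### Alternating words preserved by `tv` -/

namespace F2

open FreeGroup

theorem pairSum_append (f : Fin 2 × Bool → Fin 2 × Bool → ℤ) (L M : List (Fin 2 × Bool))
    (x : Fin 2 × Bool) :
    pairSum f (L ++ x :: M) = pairSum f (L ++ [x]) + pairSum f (x :: M) := by
  induction L with
  | nil => simp [pairSum]
  | cons y l ih =>
    cases l with
    | nil => simp [pairSum]
    | cons z l =>
      simp only [List.cons_append, pairSum] at ih ⊢
      rw [ih, add_assoc]

-- The local form of the rigidity of alternating words: a block of a power of b and a power of a
-- cannot shrink without creating a square of b, and it keeps its length only by being reproduced.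
set_option synthInstance.maxSize 2000 in
set_option synthInstance.maxHeartbeats 200000 in
theorem chunk_chunk : ∀ x y z : Fin 2 × Bool, x.1 = 1 → y.1 = 0 → z.1 = 1 →
    pairSum (square 1) (chunk x y ++ chunk y z ++ [z]) ≤ 0 →
    2 ≤ (chunk x y ++ chunk y z).length ∧
      ((chunk x y ++ chunk y z).length = 2 → chunk x y ++ chunk y z = [x, y]) := by
  decide

/-- An alternating word is fixed by the transducer if its image is alternating and not longer. -/
theorem transduce_eq_of_length (k : ℕ) : ∀ (l : List (Fin 2 × Bool)), l.length ≤ k →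
    ∀ x z : Fin 2 × Bool, x.1 = 1 → z.1 = 1 →
    (x :: (l ++ [z])).IsChain (fun s t => s.1 ≠ t.1) →
    pairSum (square 1) (transduce (x :: (l ++ [z])) ++ [z]) ≤ 0 →
    (x :: l).length ≤ (transduce (x :: (l ++ [z]))).length ∧
      ((transduce (x :: (l ++ [z]))).length = (x :: l).length →
        transduce (x :: (l ++ [z])) = x :: l) := by
  induction k with
  | zero =>
    intro l hl x z hx hz hc
    rw [List.length_eq_zero_iff.1 (Nat.le_zero.1 hl)] at hc
    simp [hx, hz] at hc
  | succ k ih =>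
    intro l hl x z hx hz hc hs
    match l, hl, hc, hs with
    | [], _, hc, _ => simp [hx, hz] at hc
    | [y], _, hc, hs =>
      simp only [List.cons_append, List.nil_append, List.isChain_cons_cons, hx] at hc
      have hy : y.1 = 0 := by omega
      simpa [transduce] using chunk_chunk x y z hx hy hz (by simpa [transduce] using hs)
    | y :: x' :: l, hl, hc, hs =>
      simp only [List.cons_append, List.isChain_cons_cons, hx] at hc
      have hy : y.1 = 0 := by omega
      have hx' : x'.1 = 1 := by omega
      have hred : IsReduced (x' :: (l ++ [z])) :=
        hc.2.2.imp fun _ _ h h' => absurd h' h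
      have hhead := (head_transduce _ _ hred).2
      have ih' := ih l (by simp only [List.length_cons] at hl; omega) x' z hx' hz hc.2.2
      have hT : transduce (x :: ((y :: x' :: l) ++ [z]))
          = chunk x y ++ chunk y x' ++ transduce (x' :: (l ++ [z])) := by
        simp [transduce]
      rw [hT] at hs ⊢
      generalize transduce (x' :: (l ++ [z])) = T at *
      have h0 := pairSum_nonneg (square_nonneg 1)
      cases T with
      | nil =>
        have := (ih' (by simp [pairSum])).1
        simp at this
      | cons h T =>
        -- Only an output for a power of a may start with a different letter, so the split at `x'`
        -- cuts the output exactly where the square count needs it.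
        have hh : h = x' := by
          rcases hhead h rfl with h1 | h1
          · exact h1
          · rw [hx'] at h1; simp at h1
        subst hh
        rw [List.append_assoc, List.cons_append, pairSum_append] at hs
        have h1 := h0 (chunk x y ++ chunk y h ++ [h])
        have h2 := h0 (h :: (T ++ [z]))
        obtain ⟨h3, h4⟩ := ih' (by rw [List.cons_append]; omega)
        obtain ⟨h5, h6⟩ := chunk_chunk x y h hx hy hx' (by omega)
        simp only [List.length_cons, List.length_append] at h3 h4 h5 h6 ⊢
        refine ⟨by omega, fun h7 => ?_⟩
        rw [h6 (by omega), h4 (by omega)]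
        rfl

theorem isChain_of_pairSum {L : List (Fin 2 × Bool)} (hL : IsReduced L)
    (h0 : pairSum (square 0) L = 0) (h1 : pairSum (square 1) L = 0) :
    L.IsChain (fun s t => s.1 ≠ t.1) := by
  induction L with
  | nil => exact List.isChain_nil
  | cons x l ih =>
    cases l with
    | nil => exact List.isChain_singleton _
    | cons y l =>
      rw [isReduced_cons_cons] at hL
      simp only [pairSum] at h0 h1
      have h2 := pairSum_nonneg (square_nonneg 0) (y :: l)
      have h3 := pairSum_nonneg (square_nonneg 1) (y :: l)
      have h4 := square_nonneg 0 x y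
      have h5 := square_nonneg 1 x y
      rw [List.isChain_cons_cons]
      refine ⟨fun h => ?_, ih hL.2 (by omega) (by omega)⟩
      have hxy : x = y := Prod.ext h (hL.1 h)
      have h6 : square 0 x y = 0 := by omega
      have h7 : square 1 x y = 0 := by omega
      simp only [square, hxy, true_and, ite_eq_right_iff, one_ne_zero, imp_false] at h6 h7
      omega

/-- If the image of a word without squares under `a ↦ a`, `b ↦ ba` has the same cyclic length and no
squares of `b`, then the automorphism preserves the cyclic word. -/
theorem isConj_tv_of_squares_eq_zero {g : F2} (hg : SquareFree g) (ht : turns g = 0)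
    (h : squares 1 (tv g) = 0) : IsConj (tv g) g := by
  have hlen : cycNorm (tv g) = cycNorm g := by
    have := cycNorm_tv g
    have := hg.2
    omega
  obtain ⟨L, hL, hLg, hhead⟩ : ∃ L : List (Fin 2 × Bool), IsCyclicallyReduced L ∧
      IsConj (mk L) g ∧ ∀ x ∈ L.head?, x.1 = 1 := by
    have h0 := isCyclicallyReduced_cycWord g
    have h1 := isConj_mk_cycWord g
    have h2 := isChain_of_pairSum (isReduced_closeUp h0) hg.1 hg.2
    generalize cycWord g = L at *
    match L, h0, h1, h2 with
    | [], h0, h1, _ => exact ⟨[], h0, h1, by simp⟩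
    | [x], _, _, h2 => simp at h2
    | x :: y :: l, h0, h1, h2 =>
      by_cases hx : x.1 = 1
      · exact ⟨x :: y :: l, h0, h1, by simpa using hx⟩
      -- Rotated to begin with a power of b, the word has an image beginning with the same letter,
      -- so that closing up agrees for word and image.
      · refine ⟨(y :: l) ++ [x], h0.concat_of_cons, ?_, ?_⟩
        · exact (isConj_mk_of_isRotated (L := x :: y :: l) ⟨1, by simp⟩).symm.trans h1
        · simp only [List.cons_append, List.isChain_cons_cons] at h2
          simp only [List.cons_append, List.head?_cons, Option.mem_def, Option.some.injEq,
            forall_eq']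
          omega
  have h0 : squares 0 (mk L) = 0 := (squares_congr hLg).trans hg.1
  have h1 : squares 1 (mk L) = 0 := (squares_congr hLg).trans hg.2
  have h2 : squares 1 (tv (mk L)) = 0 := (squares_congr (isConj_map tv hLg)).trans h
  have h3 : cycNorm (tv (mk L)) = L.length := by
    rw [cycNorm_congr (isConj_map tv hLg), hlen, ← cycNorm_congr hLg, cycNorm_mk hL]
  have h4 := isCyclicallyReduced_cycTransduce hL
  rw [cycNorm_congr (isConj_tv_mk hL), cycNorm_mk h4] at h3
  rw [squares_congr (isConj_tv_mk hL)] at h2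
  unfold squares at h0 h1 h2
  rw [cycWord_mk hL] at h0 h1
  rw [cycWord_mk h4] at h2
  have hc := isChain_of_pairSum (isReduced_closeUp hL) h0 h1
  have key : cycTransduce L = L := by
    cases L with
    | nil => rfl
    | cons x l =>
      have hx : x.1 = 1 := hhead x rfl
      have h5 : ∀ h ∈ (cycTransduce (x :: l)).head?, h = x := by
        intro h hh
        rcases (head_transduce (l ++ [x]) x (isReduced_closeUp hL)).2 h hh with h6 | h6
        · exact h6
        · rw [hx] at h6; simp at h6
      have h6 : cycSum (square 1) (cycTransduce (x :: l))
          = pairSum (square 1) (cycTransduce (x :: l) ++ [x]) := by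
        generalize cycTransduce (x :: l) = T at *
        cases T with
        | nil => simp at h3
        | cons y T =>
          rw [h5 y rfl]; rfl
      exact (transduce_eq_of_length l.length l le_rfl x x hx hx hc (h6 ▸ h2.le)).2 h3
  have h5 := isConj_tv_mk hL
  rw [key] at h5
  exact ((isConj_map tv hLg).symm.trans h5).trans hLg

/-! ### A parity obstruction to exchanging the generators -/

theorem sum_range_mul_of_periodic {f : ℕ → ℤ} {m : ℕ} (hf : Function.Periodic f m) (k : ℕ) :
    ∑ i ∈ Finset.range (k * m), f i = k * ∑ i ∈ Finset.range m, f i := by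
  induction k with
  | zero => simp
  | succ k ih =>
    rw [Nat.succ_mul, Finset.sum_range_add, ih]
    have : ∀ i ∈ Finset.range m, f (k * m + i) = f i := fun i _ => by
      rw [add_comm]
      exact hf.nat_mul k i
    rw [Finset.sum_congr rfl this]
    push_cast; ring

theorem odd_sum_of_odd {f : ℕ → ℤ} (hf : ∀ i, Odd (f i)) {r : ℕ} (hr : Odd r) :
    Odd (∑ i ∈ Finset.range r, f i) := by
  have key : ∀ r : ℕ, Even ((∑ i ∈ Finset.range r, f i) - r) := by
    intro r
    induction r with
    | zero => simp
    | succ r ih =>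
      rw [Finset.sum_range_succ]
      obtain ⟨c, hc⟩ := ih
      obtain ⟨e, he⟩ := hf r
      exact ⟨c + e, by push_cast; omega⟩
  obtain ⟨c, hc⟩ := key r
  obtain ⟨e, he⟩ := hr
  exact ⟨c + e, by push_cast [he] at hc ⊢; omega⟩

/-- `1` at pairs of letters of different type and equal sign, `-1` at pairs of different type and
different sign. -/
def signChange (x y : Fin 2 × Bool) : ℤ := if x.1 = y.1 then 0 else if x.2 = y.2 then 1 else -1

theorem cycSum_signChange {L : List (Fin 2 × Bool)} (hL : IsCyclicallyReduced L) :
    cycSum signChange L = cycSum turn L + cycSum turn L := by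
  rw [← cycSum_add]
  refine cycSum_eq_of_coboundary
    (fun x => if x = (1, true) then 0 else if x = (1, false) then 2 else 1) ?_ hL
  decide

/-- The cyclic word of a nontrivial word without squares and with as many occurrences of `ab` as of
`ab⁻¹` is not preserved by a map on letters that exchanges the two generators. -/
theorem not_isConj_of_exchange {φ : MulAut F2} {π : Fin 2 × Bool → Fin 2 × Bool}
    (hφ : ∀ x, φ (mk [x]) = mk [π x]) (h1 : ∀ x, (π x).1 = x.1 + 1)
    (hπ : ∀ x y, Compatible x y → Compatible (π x) (π y))
    (h2 : ∀ x y, signChange (π x) (π y) = signChange x y)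
    {g : F2} (hg : SquareFree g) (ht : turns g = 0) (h0 : cycNorm g ≠ 0) : ¬ IsConj (φ g) g := by
  intro hconj
  have hL := isCyclicallyReduced_cycWord g
  have hLg := isConj_mk_cycWord g
  have h3 : IsConj (mk (cycWord g)) (mk ((cycWord g).map π)) := by
    rw [← apply_mk_of_letter hφ]
    exact (hLg.trans hconj.symm).trans (isConj_map φ hLg.symm)
  -- The exchange of letters acts on the cyclic word as rotation by `r`. From here on the word is
  -- treated as an n-periodic sequence `e`.
  obtain ⟨r, hr⟩ := isRotated_of_isConj hL (isCyclicallyReduced_map hπ hL) h3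
  have ht' : cycSum turn (cycWord g) = 0 := ht
  have hs := cycSum_signChange hL
  rw [ht', cycSum_eq_sum _ (0, true)] at hs
  have hg0 := hg.1
  have hg1 := hg.2
  unfold squares at hg0 hg1
  rw [cycSum_eq_sum _ (0, true)] at hg0 hg1
  have hn : (cycWord g).length ≠ 0 := h0
  generalize cycWord g = L at *
  set n := L.length with hnL
  let e : ℕ → Fin 2 × Bool := fun i => L.getD (i % n) (0, true)
  have he : ∀ i, e (i + n) = e i := fun i => by simp only [e, Nat.add_mod_right]
  have hpair : ∀ (f : Fin 2 × Bool → Fin 2 × Bool → ℤ) (i : ℕ), i < n →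
      f (L.getD i (0, true)) (L.getD ((i + 1) % n) (0, true)) = f (e i) (e (i + 1)) :=
    fun f i hi => by simp only [e, Nat.mod_eq_of_lt hi]
  have hsq : ∀ c, ∑ i ∈ Finset.range n,
      square c (L.getD i (0, true)) (L.getD ((i + 1) % n) (0, true)) = 0 → ∀ i,
        square c (e i) (e (i + 1)) = 0 := by
    intro c hc i
    rw [Finset.sum_eq_zero_iff_of_nonneg fun i _ => square_nonneg c _ _] at hc
    have := hc (i % n) (Finset.mem_range.2 (Nat.mod_lt _ (by omega)))
    simpa only [e, Nat.mod_add_mod] using this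
  have hcompat : ∀ i, Compatible (e i) (e (i + 1)) := by
    have h4 := isReduced_closeUp hL
    intro i
    have hi : i % n < n := Nat.mod_lt _ (by omega)
    have h5 := List.isChain_iff_getElem.1 h4 (i % n) (by
      simp only [List.length_append, List.length_take]; omega)
    have h6 : ∀ (h : i % n < (L ++ L.take 1).length), (L ++ L.take 1)[i % n] = e i := by
      intro h
      rw [List.getElem_append_left hi]
      simp only [e]
      rw [List.getD_eq_getElem _ _ hi]
    have h7 : ∀ (h : i % n + 1 < (L ++ L.take 1).length),
        (L ++ L.take 1)[i % n + 1] = e (i + 1) := by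
      intro h
      simp only [e]
      rw [← Nat.mod_add_mod]
      rcases (Nat.succ_le_of_lt hi).lt_or_eq with h8 | h8
      · rw [List.getElem_append_left h8, Nat.mod_eq_of_lt h8, List.getD_eq_getElem _ _ h8]
      · rw [List.getElem_append_right (by omega)]
        have h9 : i % n + 1 = n := h8
        have h10 : (i % n + 1) % n = 0 := by rw [h9, Nat.mod_self]
        rw [h10, List.getD_eq_getElem _ _ (by omega)]
        simp [h9, ← hnL]
    rw [h6, h7] at h5
    exact h5
  have htype : ∀ i, (e (i + 1)).1 = (e i).1 + 1 := by
    intro i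
    have h4 := hsq 0 hg0 i
    have h5 := hsq 1 hg1 i
    have h6 := hcompat i
    revert h4 h5 h6
    generalize e i = x
    generalize e (i + 1) = y
    revert x y
    decide
  have hrot : ∀ i, e (i + r) = π (e i) := by
    intro i
    have hi : i % n < n := Nat.mod_lt _ (by omega)
    have h4 := congrArg (fun M => M[i % n]?) hr
    rw [List.getElem?_rotate hi, List.getElem?_map, ← hnL] at h4
    have h5 : (i % n + r) % n < n := Nat.mod_lt _ (by omega)
    rw [List.getElem?_eq_getElem h5, List.getElem?_eq_getElem hi, Option.map_some,
      Option.some.injEq] at h4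
    simp only [e]
    rw [← Nat.mod_add_mod, List.getD_eq_getElem _ _ h5, List.getD_eq_getElem _ _ hi, h4]
  -- The two generators alternate along the word, so a shift that exchanges them is odd.
  have hodd : Odd r := by
    have h4 : ∀ k, (e (k + k)).1 = (e 0).1 := by
      intro k
      induction k with
      | zero => rfl
      | succ k ih =>
        rw [show k + 1 + (k + 1) = k + k + 1 + 1 by ring, htype, htype, ih]
        generalize (e 0).1 = d
        revert d
        decide
    have h6 := hrot 0
    rw [zero_add] at h6
    by_contra hcon
    rw [Nat.not_odd_iff_even] at hcon
    obtain ⟨c, hc⟩ := hcon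
    have h5 := h4 c
    rw [← hc, h6, h1] at h5
    exact absurd (add_eq_left.1 h5) (by decide)
  let f : ℕ → ℤ := fun i => signChange (e i) (e (i + 1))
  have hfn : Function.Periodic f n := fun i => by
    simp only [f]
    rw [he, add_right_comm, he]
  have hfr : Function.Periodic f r := fun i => by
    simp only [f]
    rw [hrot, add_right_comm, hrot, h2]
  have hfo : ∀ i, Odd (f i) := by
    intro i
    have h4 := htype i
    simp only [f]
    revert h4
    generalize e i = x
    generalize e (i + 1) = y
    revert x y
    decide
  have hsum : ∑ i ∈ Finset.range n, f i = 0 := by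
    rw [← hs.trans (add_zero 0)]
    exact Finset.sum_congr rfl fun i hi => (hpair signChange i (Finset.mem_range.1 hi)).symm
  -- Sum the signs over n·r places in two ways. The sum over n is twice the turns, hence zero, so
  -- the sum over r vanishes as well; but it consists of an odd number of odd terms.
  have h4 := sum_range_mul_of_periodic hfn r
  have h5 := sum_range_mul_of_periodic hfr n
  rw [hsum, mul_zero, mul_comm] at h4
  rw [h4] at h5
  have h6 : ∑ i ∈ Finset.range r, f i = 0 := by
    rcases mul_eq_zero.1 h5.symm with h7 | h7
    · exact absurd (by exact_mod_cast h7) hn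
    · exact h7
  have h7 := odd_sum_of_odd hfo hodd
  rw [h6] at h7
  exact absurd h7 (by decide)

theorem negate_mk_singleton (x : Fin 2 × Bool) : negate (mk [x]) = mk [(x.1, !x.2)] := by
  obtain ⟨i, s⟩ := x
  fin_cases i <;> cases s
  · change negate a⁻¹ = a; simp
  · change negate a = a⁻¹; simp
  · change negate b⁻¹ = b; simp
  · change negate b = b⁻¹; simp

theorem not_isConj_swap {g : F2} (hg : SquareFree g) (ht : turns g = 0) (h0 : cycNorm g ≠ 0) :
    ¬ IsConj (swap g) g :=
  not_isConj_of_exchange (fun x => swap_mk [x]) (by decide) (by decide) (by decide) hg ht h0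

theorem not_isConj_negate_swap {g : F2} (hg : SquareFree g) (ht : turns g = 0)
    (h0 : cycNorm g ≠ 0) : ¬ IsConj ((negate * swap) g) g :=
  not_isConj_of_exchange (π := fun x => (x.1 + 1, !x.2))
    (fun x => by
      rw [MulAut.mul_apply, swap_mk, List.map_singleton, negate_mk_singleton]
      rfl)
    (by decide) (by decide) (by decide) hg ht h0

end F2

/-! ### The neighbours of a balanced word -/

namespace F2

open FreeGroup

theorem out_negate_mul_tv : out (negate * tv) = out (tv * negate) :=
  out_eq_of_conj a (by simp) (by simp)

theorem out_negate_mul_tv' : out (negate * tv') = out (tv' * negate) :=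
  out_eq_of_conj b (by simp) (by simp)

theorem out_flip_mul_tv : out (flip * tv) = out (tv⁻¹ * flip) := by
  rw [_root_.map_mul out tv⁻¹, ← flip_tv_flip, ← _root_.map_mul, mul_assoc, flip_mul_flip, mul_one]

theorem out_flip_mul_tv' : out (flip * tv') = out (tv'⁻¹ * flip) := by
  rw [← flip_tv'_flip, mul_assoc, flip_mul_flip, mul_one]

theorem swap_mul_tv' : swap * tv' = tv * swap := by
  rw [tv', ← mul_assoc, ← mul_assoc, swap_mul_swap, one_mul]

theorem negate_mem_J : negate ∈ J :=
  J.mul_mem (J.mul_mem (J.mul_mem swap_mem_J flip_mem_J) swap_mem_J) flip_mem_J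

theorem JEquiv.exists_move {x y : F2} (h : JEquiv x y) (i : Fin 4) :
    ∃ k, JEquiv (move i x) (move k y) := by
  obtain ⟨j, hj, rfl⟩ := h.symm
  obtain ⟨k, hk⟩ := exists_move_mul_eq hj i
  exact ⟨k, (JEquiv.of_out_eq hk y).trans (jEquiv_apply hj _).symm⟩

theorem jEquiv_tv_inv_tv' (g : F2) : JEquiv (tv⁻¹ (tv' g)) (tv g) :=
  (JEquiv.of_out_eq out_tv_inv_mul_tv' g).trans (jEquiv_apply swap_mul_flip_mem_J _).symm

theorem jEquiv_tv'_inv_tv (g : F2) : JEquiv (tv'⁻¹ (tv g)) (tv' g) :=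
  (JEquiv.of_out_eq out_tv'_inv_mul_tv g).trans (jEquiv_apply flip_mul_swap_mem_J _).symm

theorem jEquiv_tv'_tv_inv (g : F2) : JEquiv (tv' (tv⁻¹ g)) (tv'⁻¹ g) :=
  (JEquiv.of_out_eq out_tv'_mul_tv_inv g).trans (jEquiv_apply swap_mul_flip_mem_J _).symm

theorem jEquiv_tv_tv'_inv (g : F2) : JEquiv (tv (tv'⁻¹ g)) (tv⁻¹ g) :=
  (JEquiv.of_out_eq out_tv_mul_tv'_inv g).trans (jEquiv_apply flip_mul_swap_mem_J _).symm

theorem jEquiv_tv_flip (g : F2) : JEquiv (tv (flip g)) (tv⁻¹ g) := by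
  have h := JEquiv.of_out_eq out_flip_mul_tv (flip g)
  simp only [MulAut.mul_apply, flip_flip] at h
  exact (jEquiv_flip _).trans h

theorem jEquiv_tv'_flip (g : F2) : JEquiv (tv' (flip g)) (tv'⁻¹ g) := by
  have h := JEquiv.of_out_eq out_flip_mul_tv' (flip g)
  simp only [MulAut.mul_apply, flip_flip] at h
  exact (jEquiv_flip _).trans h

/-- `g` is without squares in its cyclic word, and all one-letter automorphisms preserve its cyclic
length. -/
structure IsBalanced (g : F2) : Prop where
  squareFree : SquareFree g
  turns_eq : turns g = 0

namespace IsBalanced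

variable {w : F2}

theorem cycNorm_move (hw : IsBalanced w) (i : Fin 4) : cycNorm (move i w) = cycNorm w := by
  obtain ⟨⟨h0, h1⟩, ht⟩ := hw
  have h2 := cycNorm_tv w
  have h3 := cycNorm_tv' w
  have h4 := cycNorm_tv_inv w
  have h5 := cycNorm_tv'_inv w
  fin_cases i
  · change cycNorm (tv w) = _; omega
  · change cycNorm (tv' w) = _; omega
  · change cycNorm (tv⁻¹ w) = _; omega
  · change cycNorm (tv'⁻¹ w) = _; omega

theorem swap (hw : IsBalanced w) : IsBalanced (swap w) := by
  have h0 : SquareFree (F2.swap w) := (squareFree_congr (jEquiv_swap w)).1 hw.squareFree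
  refine ⟨h0, ?_⟩
  have h2 := hw.cycNorm_move 0
  have h3 := cycNorm_tv' (F2.swap w)
  have h4 := h0.1
  rw [cycNorm_tv'_swap, cycNorm_swap] at h3
  rw [move_zero] at h2
  omega

theorem flip (hw : IsBalanced w) : IsBalanced (flip w) := by
  have h0 : SquareFree (F2.flip w) := (squareFree_congr (jEquiv_flip w)).1 hw.squareFree
  refine ⟨h0, ?_⟩
  have h2 := hw.cycNorm_move 2
  have h3 := cycNorm_tv (F2.flip w)
  have h4 := h0.2
  rw [cycNorm_tv_flip, cycNorm_flip] at h3
  rw [move_two] at h2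
  omega

theorem squares_tv (hw : IsBalanced w) : squares 0 (tv w) = turns (tv w) ∧
    squares 1 (tv w) = turns (tv w) := by
  obtain ⟨⟨h0, h1⟩, ht⟩ := hw
  have := squares_zero_tv w
  have := turns_tv w
  omega

theorem squares_tv' (hw : IsBalanced w) : squares 0 (tv' w) = turns (tv' w) ∧
    squares 1 (tv' w) = turns (tv' w) := by
  obtain ⟨⟨h0, h1⟩, ht⟩ := hw
  have := squares_one_tv' w
  have := turns_tv' w
  omega

theorem isConj_tv_of_squareFree (hw : IsBalanced w) (h : SquareFree (tv w)) :
    IsConj (tv w) w :=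
  isConj_tv_of_squares_eq_zero hw.1 hw.2 h.2

theorem turns_tv_pos (hw : IsBalanced w) (h : ¬ SquareFree (tv w)) : 0 < turns (tv w) := by
  obtain ⟨h1, h2⟩ := hw.squares_tv
  have h3 := squares_nonneg 0 (tv w)
  rw [squareFree_iff] at h
  omega

theorem turns_tv'_pos (hw : IsBalanced w) (h : ¬ SquareFree (tv' w)) : 0 < turns (tv' w) := by
  obtain ⟨h1, h2⟩ := hw.squares_tv'
  have h3 := squares_nonneg 0 (tv' w)
  rw [squareFree_iff] at h
  omega

theorem lt_cycNorm_tv (hw : IsBalanced w) (h : ¬ SquareFree (tv w)) :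
    cycNorm w < cycNorm (tv (tv w)) ∧ cycNorm w < cycNorm (tv' (tv w)) := by
  have h0 := hw.turns_tv_pos h
  obtain ⟨h1, h2⟩ := hw.squares_tv
  have h3 := cycNorm_tv (tv w)
  have h4 := cycNorm_tv' (tv w)
  have h5 := hw.cycNorm_move 0
  rw [move_zero] at h5
  omega

theorem lt_cycNorm_tv' (hw : IsBalanced w) (h : ¬ SquareFree (tv' w)) :
    cycNorm w < cycNorm (tv (tv' w)) ∧ cycNorm w < cycNorm (tv' (tv' w)) := by
  have h0 := hw.turns_tv'_pos h
  obtain ⟨h1, h2⟩ := hw.squares_tv'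
  have h3 := cycNorm_tv (tv' w)
  have h4 := cycNorm_tv' (tv' w)
  have h5 := hw.cycNorm_move 1
  rw [move_one] at h5
  omega

theorem isConj_inv_apply {φ : MulAut F2} (h : IsConj (φ w) w) : IsConj (φ⁻¹ w) w := by
  have := isConj_map φ⁻¹ h
  rw [← MulAut.mul_apply, inv_mul_cancel, MulAut.one_apply] at this
  exact this.symm

/-- Squarefreeness of `tv w` means that `tv` fixes w up to conjugacy, and then so does its inverse,
which is `tv` conjugated by `flip`. This transfers statements about `tv` to `tv⁻¹`. -/
theorem squareFree_tv_flip_iff (hw : IsBalanced w) :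
    SquareFree (tv (F2.flip w)) ↔ SquareFree (tv w) := by
  rw [squareFree_congr (jEquiv_tv_flip w)]
  have hsq : ∀ {x}, IsConj x w → SquareFree x := fun h =>
    (squareFree_congr (.of_isConj h)).2 hw.1
  constructor
  · intro h
    have h1 : IsConj (tv (F2.flip w)) (F2.flip w) :=
      hw.flip.isConj_tv_of_squareFree ((squareFree_congr (jEquiv_tv_flip w)).2 h)
    have h2 := isConj_of_out_eq out_flip_mul_tv (F2.flip w)
    simp only [MulAut.mul_apply, flip_flip] at h2
    have h3 := h2.symm.trans (isConj_map F2.flip h1)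
    rw [flip_flip] at h3
    have h4 := isConj_inv_apply h3
    rw [inv_inv] at h4
    exact hsq h4
  · exact fun h => hsq (isConj_inv_apply (hw.isConj_tv_of_squareFree h))

theorem squareFree_tv_inv_iff (hw : IsBalanced w) :
    SquareFree (tv⁻¹ w) ↔ SquareFree (tv w) := by
  rw [← squareFree_congr (jEquiv_tv_flip w), hw.squareFree_tv_flip_iff]

theorem jEquiv_tv_swap (w : F2) : JEquiv (tv (F2.swap w)) (tv' w) := by
  rw [← MulAut.mul_apply, ← swap_mul_tv']
  exact (jEquiv_swap (tv' w)).symm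

theorem jEquiv_tv'_swap (w : F2) : JEquiv (tv' (F2.swap w)) (tv w) := by
  have := jEquiv_tv_swap (F2.swap w)
  rw [swap_swap] at this
  exact this.symm

theorem jEquiv_tv'_inv_swap (w : F2) : JEquiv (tv'⁻¹ (F2.swap w)) (tv⁻¹ w) := by
  rw [tv'_inv, MulAut.mul_apply, MulAut.mul_apply, swap_swap]
  exact (jEquiv_swap _).symm

theorem jEquiv_tv_inv_swap (w : F2) : JEquiv (tv⁻¹ (F2.swap w)) (tv'⁻¹ w) := by
  have := jEquiv_tv'_inv_swap (F2.swap w)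
  rw [swap_swap] at this
  exact this.symm

theorem squareFree_tv'_inv_iff (hw : IsBalanced w) :
    SquareFree (tv'⁻¹ w) ↔ SquareFree (tv' w) := by
  rw [← squareFree_congr (jEquiv_tv_inv_swap w), ← squareFree_congr (jEquiv_tv_swap w),
    hw.swap.squareFree_tv_inv_iff]

theorem lt_cycNorm_tv_inv (hw : IsBalanced w) (h : ¬ SquareFree (tv w)) :
    cycNorm w < cycNorm (tv⁻¹ (tv⁻¹ w)) ∧ cycNorm w < cycNorm (tv'⁻¹ (tv⁻¹ w)) := by
  have h1 := hw.flip.lt_cycNorm_tv (by rwa [hw.squareFree_tv_flip_iff])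
  rw [cycNorm_flip] at h1
  have h2 : IsConj (tv (F2.flip w)) (F2.flip (tv⁻¹ w)) := by
    have := isConj_of_out_eq out_flip_mul_tv (F2.flip w)
    simp only [MulAut.mul_apply, flip_flip] at this
    have := isConj_map F2.flip this
    rwa [flip_flip] at this
  rw [cycNorm_congr (isConj_map tv h2), cycNorm_congr (isConj_map tv' h2), cycNorm_tv_flip,
    cycNorm_tv'_flip] at h1
  exact h1

theorem lt_cycNorm_tv'_inv (hw : IsBalanced w) (h : ¬ SquareFree (tv' w)) :
    cycNorm w < cycNorm (tv⁻¹ (tv'⁻¹ w)) ∧ cycNorm w < cycNorm (tv'⁻¹ (tv'⁻¹ w)) := by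
  have h1 := hw.swap.lt_cycNorm_tv_inv (by rwa [squareFree_congr (jEquiv_tv_swap w)])
  have h2 : tv⁻¹ (F2.swap w) = F2.swap (tv'⁻¹ w) := by
    rw [tv'_inv, MulAut.mul_apply, MulAut.mul_apply, swap_swap]
  rw [cycNorm_swap, h2, cycNorm_tv'_inv_swap] at h1
  have h3 := cycNorm_tv'_inv_swap (F2.swap (tv'⁻¹ w))
  rw [swap_swap] at h3
  rw [h3]
  exact h1.symm

/-- The images of a balanced word under the two positive one-letter automorphisms are not
equivalent. -/
theorem not_jEquiv_tv_tv' (hw : IsBalanced w) (h0 : cycNorm w ≠ 0) (h1 : ¬ SquareFree (tv w))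
    (h2 : ¬ SquareFree (tv' w)) : ¬ JEquiv (tv' w) (tv w) := by
  rintro ⟨j, hj, e⟩
  obtain ⟨π, hπ, hout⟩ := exists_permutation_of_mem_J hj
  have h3 : IsConj (tv w) (π (tv' w)) := by
    rw [← e]
    exact isConj_of_out_eq hout _
  -- If ρ commutes with the moves, undoing `tv'` makes tv' w equivalent to w, or undoing `tv` makes
  -- w conjugate to its image under an exchange of the generators.
  have comm : ∀ {ρ : MulAut F2} (_ : ρ ∈ J), out (ρ * tv) = out (tv * ρ) →
      out (ρ * tv') = out (tv' * ρ) → ¬ IsConj ((ρ * F2.swap) w) w →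
      ¬ IsConj (tv w) (ρ (tv' w)) ∧ ¬ IsConj (tv w) ((ρ * F2.swap) (tv' w)) := by
    intro ρ hρ c1 c2 hs
    constructor
    · intro h
      have h4 := isConj_map tv'⁻¹ (h.trans (isConj_of_out_eq c2 w))
      rw [MulAut.mul_apply, ← MulAut.mul_apply _ tv'⁻¹ tv' (ρ w), inv_mul_cancel,
        MulAut.one_apply] at h4
      have h5 : JEquiv (tv' w) w := (jEquiv_tv'_inv_tv w).symm.trans
        ((JEquiv.of_isConj h4).trans (jEquiv_apply hρ w).symm)
      exact h2 ((squareFree_congr h5).2 hw.1)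
    · intro h
      have e1 : (ρ * F2.swap) (tv' w) = (ρ * tv) (F2.swap w) := by
        rw [← MulAut.mul_apply, mul_assoc, swap_mul_tv', ← mul_assoc]; rfl
      rw [e1] at h
      have h4 := isConj_map tv⁻¹ (h.trans (isConj_of_out_eq c1 (F2.swap w)))
      rw [MulAut.mul_apply, ← MulAut.mul_apply _ tv⁻¹ tv (ρ _), ← MulAut.mul_apply _ tv⁻¹ tv w,
        inv_mul_cancel, MulAut.one_apply, MulAut.one_apply] at h4
      exact hs h4.symm
  -- If ρ inverts the moves, a further positive move brings one side back to the length of w,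
  -- although it lengthens `tv w`.
  have anti : ∀ {ρ : MulAut F2} (_ : ρ ∈ J), out (ρ * tv) = out (tv⁻¹ * ρ) →
      out (ρ * tv') = out (tv'⁻¹ * ρ) →
      ¬ IsConj (tv w) (ρ (tv' w)) ∧ ¬ IsConj (tv w) ((ρ * F2.swap) (tv' w)) := by
    intro ρ hρ c1 c2
    obtain ⟨h6, h7⟩ := hw.lt_cycNorm_tv h1
    constructor
    · intro h
      have h4 := isConj_map tv' (h.trans (isConj_of_out_eq c2 w))
      rw [MulAut.mul_apply, ← MulAut.mul_apply _ tv' tv'⁻¹ (ρ w), mul_inv_cancel,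
        MulAut.one_apply] at h4
      rw [cycNorm_congr h4, ← cycNorm_congr_J (jEquiv_apply hρ w)] at h7
      exact lt_irrefl _ h7
    · intro h
      have e1 : (ρ * F2.swap) (tv' w) = (ρ * tv) (F2.swap w) := by
        rw [← MulAut.mul_apply, mul_assoc, swap_mul_tv', ← mul_assoc]; rfl
      rw [e1] at h
      have h4 := isConj_map tv (h.trans (isConj_of_out_eq c1 (F2.swap w)))
      rw [MulAut.mul_apply, ← MulAut.mul_apply _ tv tv⁻¹ (ρ _), mul_inv_cancel,
        MulAut.one_apply] at h4
      rw [cycNorm_congr h4, ← cycNorm_congr_J (jEquiv_apply hρ _), cycNorm_swap] at h6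
      exact lt_irrefl _ h6
  have c_one := comm J.one_mem (by simp) (by simp)
    (by rw [one_mul]; exact not_isConj_swap hw.1 hw.2 h0)
  have c_neg := comm negate_mem_J out_negate_mul_tv out_negate_mul_tv'
    (not_isConj_negate_swap hw.1 hw.2 h0)
  have c_flip := anti flip_mem_J out_flip_mul_tv out_flip_mul_tv'
  have c_both := anti (J.mul_mem negate_mem_J flip_mem_J)
    (by
      have h4 := out_flip_mul_tv
      have hc : Commute (out negate) (out tv) := by
        simpa only [Commute, SemiconjBy, _root_.map_mul] using out_negate_mul_tv
      simp only [_root_.map_mul, _root_.map_inv] at h4 ⊢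
      rw [mul_assoc, h4, ← mul_assoc, hc.inv_right.eq, mul_assoc])
    (by
      have h4 := out_flip_mul_tv'
      have hc : Commute (out negate) (out tv') := by
        simpa only [Commute, SemiconjBy, _root_.map_mul] using out_negate_mul_tv'
      simp only [_root_.map_mul, _root_.map_inv] at h4 ⊢
      rw [mul_assoc, h4, ← mul_assoc, hc.inv_right.eq, mul_assoc])
  obtain ⟨ρ, hρ, rfl | rfl⟩ := hπ.cases <;>
    simp only [Set.mem_insert_iff, Set.mem_singleton_iff] at hρ <;>
    rcases hρ with rfl | rfl | rfl | rfl
  · exact c_one.1 h3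
  · exact c_neg.1 h3
  · exact c_flip.1 h3
  · exact c_both.1 h3
  · exact c_one.2 h3
  · exact c_neg.2 h3
  · exact c_flip.2 h3
  · exact c_both.2 h3

end IsBalanced

end F2

/-! ### The four graphs -/

namespace F2

open FreeGroup

theorem IsLevelTable.of_forall {n m : ℕ} {u : Fin n → F2} {tgt : Fin n → Fin 4 → Option (Fin n)}
    (h1 : ∀ i, cycNorm (u i) = m)
    (h2 : ∀ i k, (tgt i k).elim (m < cycNorm (move k (u i))) fun t => JEquiv (move k (u i)) (u t)) :
    IsLevelTable u tgt m where
  cycNorm_eq := h1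
  equiv_of_some i k t h := by simpa [h] using h2 i k
  lt_of_none i k h := by simpa [h] using h2 i k

/-- Inequivalence of the entries of a list of words, of which only the first is square-free. -/
theorem eq_of_jEquiv {n : ℕ} [NeZero n] {u : Fin n → F2} (halt : ∀ i, SquareFree (u i) ↔ i = 0)
    (h : ∀ i j, i ≠ 0 → i < j → ¬ JEquiv (u i) (u j)) (i j : Fin n) (hij : JEquiv (u i) (u j)) :
    i = j := by
  have h1 := squareFree_congr hij
  rw [halt, halt] at h1
  by_cases hi : i = 0
  · rw [hi, h1.1 hi]
  · rcases lt_trichotomy i j with h2 | h2 | h2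
    · exact absurd hij (h i j hi h2)
    · exact h2
    · exact absurd hij.symm (h j i (fun hj => hi (h1.2 hj)) h2)

theorem squareFree_of_cycNorm_eq_zero {g : F2} (h : cycNorm g = 0) : SquareFree g := by
  have : cycWord g = [] := List.length_eq_zero_iff.1 h
  simp [SquareFree, squares, this, cycSum, pairSum]

namespace IsBalanced

variable {w : F2} {W : Set F2}

theorem isConj_tv'_of_squareFree (hw : IsBalanced w) (h : SquareFree (tv' w)) :
    IsConj (tv' w) w := by
  have h1 := hw.swap.isConj_tv_of_squareFree ((squareFree_congr (jEquiv_tv_swap w)).2 h)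
  have := isConj_map F2.swap h1
  rwa [swap_swap] at this

theorem tv_inv_tv (g : F2) : tv⁻¹ (tv g) = g := by simp
theorem tv_tv_inv (g : F2) : tv (tv⁻¹ g) = g := by simp
theorem tv'_inv_tv' (g : F2) : tv'⁻¹ (tv' g) = g := by simp
theorem tv'_tv'_inv (g : F2) : tv' (tv'⁻¹ g) = g := by simp

theorem pointedIso_graphR4 (hw : IsBalanced w) (hW : IsAutClass W) (hwW : w ∈ W)
    (hm : cycNorm w ≠ 1) (h1 : SquareFree (tv w)) (h2 : SquareFree (tv' w)) :
    ∃ v₀ : Vertex W, (∀ v : Vertex W, v.HasAlternating ↔ v = v₀) ∧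
      (Gamma W).PointedIso v₀ graphR4 0 := by
  have e1 := hw.isConj_tv_of_squareFree h1
  have e2 := hw.isConj_tv'_of_squareFree h2
  have h : IsLevelTable ![w] ![![some 0, some 0, some 0, some 0]] (cycNorm w) := by
    refine .of_forall (fun i => by fin_cases i; rfl) fun i k => ?_
    fin_cases i
    fin_cases k
    · exact .of_isConj e1
    · exact .of_isConj e2
    · exact .of_isConj (isConj_inv_apply e1)
    · exact .of_isConj (isConj_inv_apply e2)
  refine h.pointedIso hW (fun i => by fin_cases i; exact hwW) (fun i j _ => Subsingleton.elim i j)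
    hm (fun i => ?_) fun i j => by fin_cases i; fin_cases j; rfl
  fin_cases i
  simpa using hw.1

theorem pointedIso_graphR5 (hw : IsBalanced w) (hW : IsAutClass W) (hwW : w ∈ W)
    (hm : cycNorm w ≠ 1) (h1 : SquareFree (tv w)) (h2 : ¬ SquareFree (tv' w)) :
    ∃ v₀ : Vertex W, (∀ v : Vertex W, v.HasAlternating ↔ v = v₀) ∧
      (Gamma W).PointedIso v₀ graphR5 0 := by
  have e1 := hw.isConj_tv_of_squareFree h1
  obtain ⟨l1, l2⟩ := hw.lt_cycNorm_tv' h2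
  have h : IsLevelTable ![w, tv' w]
      ![![some 0, some 1, some 0, some 1], ![none, none, some 0, some 0]] (cycNorm w) := by
    refine .of_forall (fun i => ?_) fun i k => ?_
    · fin_cases i
      · rfl
      · exact hw.cycNorm_move 1
    · fin_cases i <;> fin_cases k
      · exact .of_isConj e1
      · exact .refl _
      · exact .of_isConj (isConj_inv_apply e1)
      · exact (JEquiv.of_isConj (isConj_map tv'⁻¹ e1)).symm.trans (jEquiv_tv'_inv_tv w)
      · exact l1
      · exact l2
      · exact (jEquiv_tv_inv_tv' w).trans (.of_isConj e1)
      · exact (tv'_inv_tv' w).symm ▸ .refl w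
  have halt : ∀ i, SquareFree (![w, tv' w] i) ↔ i = 0 := by
    intro i
    fin_cases i
    · simpa using hw.1
    · simpa using h2
  refine h.pointedIso hW (fun i => ?_) (eq_of_jEquiv halt ?_) hm halt
      fun i j => by fin_cases i <;> fin_cases j <;> rfl
  · fin_cases i
    · exact hwW
    · exact apply_mem_of_isAutClass hW hwW tv'
  · have h3 : ∀ i j : Fin 2, i ≠ 0 → ¬ i < j := by decide
    exact fun i j hi hij => absurd hij (h3 i j hi)

theorem not_jEquiv_of_squareFree {x y : F2} (hx : SquareFree x) (hy : ¬ SquareFree y) :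
    ¬ JEquiv x y := fun h => hy ((squareFree_congr h).1 hx)

theorem not_jEquiv_of_lt {x y : F2} (h : cycNorm x < cycNorm y) : ¬ JEquiv x y :=
  fun e => h.ne (cycNorm_congr_J e)

theorem generic (hw : IsBalanced w) (h1 : ¬ SquareFree (tv w)) (h2 : ¬ SquareFree (tv' w)) :
    ¬ JEquiv (tv w) (tv' w) ∧ ¬ JEquiv (tv⁻¹ w) (tv'⁻¹ w) := by
  have h0 : cycNorm w ≠ 0 := by
    intro h
    have h3 := hw.cycNorm_move 0
    rw [h] at h3
    exact h1 (squareFree_of_cycNorm_eq_zero h3)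
  refine ⟨fun h => hw.not_jEquiv_tv_tv' h0 h1 h2 h.symm, fun h => ?_⟩
  refine hw.flip.not_jEquiv_tv_tv' (by rwa [cycNorm_flip]) (by rwa [hw.squareFree_tv_flip_iff])
    ?_ ((jEquiv_tv'_flip w).trans (h.symm.trans (jEquiv_tv_flip w).symm))
  rwa [squareFree_congr (jEquiv_tv'_flip w), hw.squareFree_tv'_inv_iff]

/-- If one of the first two neighbours of a balanced word is equivalent to one of the last two, then
so are their neighbours. -/
theorem neighbours (hw : IsBalanced w) (h1 : ¬ SquareFree (tv w)) (h2 : ¬ SquareFree (tv' w)) :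
    (JEquiv (tv w) (tv⁻¹ w) ↔ JEquiv (tv' w) (tv'⁻¹ w)) ∧
      (JEquiv (tv w) (tv'⁻¹ w) ↔ JEquiv (tv' w) (tv⁻¹ w)) := by
  have hx := not_jEquiv_of_squareFree hw.1 h1
  have hy := not_jEquiv_of_squareFree hw.1 h2
  have c1 : cycNorm (tv w) = cycNorm w := hw.cycNorm_move 0
  have c2 : cycNorm (tv' w) = cycNorm w := hw.cycNorm_move 1
  obtain ⟨l1, l2⟩ := hw.lt_cycNorm_tv_inv h1
  obtain ⟨l3, l4⟩ := hw.lt_cycNorm_tv'_inv h2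
  -- Level moves from tv⁻¹ w lead only to w and to the other outer vertex tv'⁻¹ w of its triangle;
  -- `key2` is the mirror image.
  have key1 : ∀ {x}, cycNorm x = cycNorm w → ¬ JEquiv w x →
      (∃ k, JEquiv x (move k (tv⁻¹ w))) → JEquiv x (tv'⁻¹ w) := by
    rintro x hc hx ⟨k, hk⟩
    fin_cases k
    · change JEquiv x (tv (tv⁻¹ w)) at hk
      rw [tv_tv_inv] at hk
      exact absurd hk.symm hx
    · exact hk.trans (jEquiv_tv'_tv_inv w)
    · exact absurd hk (not_jEquiv_of_lt (hc ▸ l1))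
    · exact absurd hk (not_jEquiv_of_lt (hc ▸ l2))
  have key2 : ∀ {x}, cycNorm x = cycNorm w → ¬ JEquiv w x →
      (∃ k, JEquiv x (move k (tv'⁻¹ w))) → JEquiv x (tv⁻¹ w) := by
    rintro x hc hx ⟨k, hk⟩
    fin_cases k
    · exact hk.trans (jEquiv_tv_tv'_inv w)
    · change JEquiv x (tv' (tv'⁻¹ w)) at hk
      rw [tv'_tv'_inv] at hk
      exact absurd hk.symm hx
    · exact absurd hk (not_jEquiv_of_lt (hc ▸ l3))
    · exact absurd hk (not_jEquiv_of_lt (hc ▸ l4))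
  have n1 : ∀ {y}, JEquiv (tv w) y → ∃ k, JEquiv (tv' w) (move k y) := fun h => by
    obtain ⟨k, hk⟩ := h.exists_move 3
    exact ⟨k, (jEquiv_tv'_inv_tv w).symm.trans hk⟩
  have n2 : ∀ {y}, JEquiv (tv' w) y → ∃ k, JEquiv (tv w) (move k y) := fun h => by
    obtain ⟨k, hk⟩ := h.exists_move 2
    exact ⟨k, (jEquiv_tv_inv_tv' w).symm.trans hk⟩
  exact ⟨⟨fun h => key1 c2 hy (n1 h), fun h => key2 c1 hx (n2 h)⟩,
    ⟨fun h => key2 c2 hy (n1 h), fun h => key1 c1 hx (n2 h)⟩⟩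

/-- The case in which one of the permutations that exchange the two triangles at a balanced word
preserves it. -/
theorem pointedIso_graphR6 (hw : IsBalanced w) (hW : IsAutClass W) (hwW : w ∈ W)
    (hm : cycNorm w ≠ 1) (h1 : ¬ SquareFree (tv w)) (h2 : ¬ SquareFree (tv' w))
    (h : JEquiv (tv w) (tv⁻¹ w) ∨ JEquiv (tv w) (tv'⁻¹ w)) :
    ∃ v₀ : Vertex W, (∀ v : Vertex W, v.HasAlternating ↔ v = v₀) ∧
      (Gamma W).PointedIso v₀ graphR6 0 := by
  obtain ⟨n1, n2⟩ := hw.neighbours h1 h2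
  obtain ⟨l1, l2⟩ := hw.lt_cycNorm_tv h1
  obtain ⟨l3, l4⟩ := hw.lt_cycNorm_tv' h2
  have halt : ∀ i, SquareFree (![w, tv w, tv' w] i) ↔ i = 0 := by
    intro i
    fin_cases i
    · simpa using hw.1
    · simpa using h1
    · simpa using h2
  have hinj : ∀ i j : Fin 3, i ≠ 0 → i < j →
      ¬ JEquiv (![w, tv w, tv' w] i) (![w, tv w, tv' w] j) := by
    intro i j hi hij
    obtain ⟨rfl, rfl⟩ : i = 1 ∧ j = 2 := by omega
    exact (hw.generic h1 h2).1
  have hu : ∀ i, ![w, tv w, tv' w] i ∈ W := by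
    intro i
    fin_cases i
    · exact hwW
    · exact apply_mem_of_isAutClass hW hwW tv
    · exact apply_mem_of_isAutClass hW hwW tv'
  have hlen : ∀ i, cycNorm (![w, tv w, tv' w] i) = cycNorm w := by
    intro i
    fin_cases i
    · rfl
    · exact hw.cycNorm_move 0
    · exact hw.cycNorm_move 1
  -- The triangles can be glued in two ways. They differ only in which vertices the inverse moves
  -- reach from w, so the edge numbers agree.
  rcases h with h | h
  · have ht : IsLevelTable ![w, tv w, tv' w]
        ![![some 1, some 2, some 1, some 2], ![none, none, some 0, some 2],
          ![none, none, some 1, some 0]] (cycNorm w) := by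
      refine .of_forall hlen fun i k => ?_
      fin_cases i <;> fin_cases k
      · exact .refl _
      · exact .refl _
      · exact h.symm
      · exact (n1.1 h).symm
      · exact l1
      · exact l2
      · exact (tv_inv_tv w).symm ▸ .refl w
      · exact jEquiv_tv'_inv_tv w
      · exact l3
      · exact l4
      · exact jEquiv_tv_inv_tv' w
      · exact (tv'_inv_tv' w).symm ▸ .refl w
    exact ht.pointedIso hW hu (eq_of_jEquiv halt hinj) hm halt
      fun i j => by fin_cases i <;> fin_cases j <;> rfl
  · have ht : IsLevelTable ![w, tv w, tv' w]
        ![![some 1, some 2, some 2, some 1], ![none, none, some 0, some 2],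
          ![none, none, some 1, some 0]] (cycNorm w) := by
      refine .of_forall hlen fun i k => ?_
      fin_cases i <;> fin_cases k
      · exact .refl _
      · exact .refl _
      · exact (n2.1 h).symm
      · exact h.symm
      · exact l1
      · exact l2
      · exact (tv_inv_tv w).symm ▸ .refl w
      · exact jEquiv_tv'_inv_tv w
      · exact l3
      · exact l4
      · exact jEquiv_tv_inv_tv' w
      · exact (tv'_inv_tv' w).symm ▸ .refl w
    exact ht.pointedIso hW hu (eq_of_jEquiv halt hinj) hm halt
      fun i j => by fin_cases i <;> fin_cases j <;> rfl

theorem pointedIso_graphR7 (hw : IsBalanced w) (hW : IsAutClass W) (hwW : w ∈ W)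
    (hm : cycNorm w ≠ 1) (h1 : ¬ SquareFree (tv w)) (h2 : ¬ SquareFree (tv' w))
    (h : ¬ JEquiv (tv w) (tv⁻¹ w)) (h' : ¬ JEquiv (tv w) (tv'⁻¹ w)) :
    ∃ v₀ : Vertex W, (∀ v : Vertex W, v.HasAlternating ↔ v = v₀) ∧
      (Gamma W).PointedIso v₀ graphR7 0 := by
  obtain ⟨n1, n2⟩ := hw.neighbours h1 h2
  obtain ⟨g1, g2⟩ := hw.generic h1 h2
  obtain ⟨l1, l2⟩ := hw.lt_cycNorm_tv h1
  obtain ⟨l3, l4⟩ := hw.lt_cycNorm_tv' h2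
  obtain ⟨l5, l6⟩ := hw.lt_cycNorm_tv_inv h1
  obtain ⟨l7, l8⟩ := hw.lt_cycNorm_tv'_inv h2
  have halt : ∀ i, SquareFree (![w, tv w, tv' w, tv⁻¹ w, tv'⁻¹ w] i) ↔ i = 0 := by
    intro i
    fin_cases i
    · exact iff_of_true hw.1 rfl
    · exact iff_of_false h1 (by decide)
    · exact iff_of_false h2 (by decide)
    · exact iff_of_false (hw.squareFree_tv_inv_iff.not.2 h1) (by decide)
    · exact iff_of_false (hw.squareFree_tv'_inv_iff.not.2 h2) (by decide)
  have hinj : ∀ i j : Fin 5, i ≠ 0 → i < j →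
      ¬ JEquiv (![w, tv w, tv' w, tv⁻¹ w, tv'⁻¹ w] i) (![w, tv w, tv' w, tv⁻¹ w, tv'⁻¹ w] j) := by
    intro i j hi hij
    have : (i = 1 ∧ j = 2) ∨ (i = 1 ∧ j = 3) ∨ (i = 1 ∧ j = 4) ∨ (i = 2 ∧ j = 3) ∨
      (i = 2 ∧ j = 4) ∨ (i = 3 ∧ j = 4) := by omega
    rcases this with ⟨rfl, rfl⟩ | ⟨rfl, rfl⟩ | ⟨rfl, rfl⟩ | ⟨rfl, rfl⟩ | ⟨rfl, rfl⟩ | ⟨rfl, rfl⟩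
    · exact g1
    · exact h
    · exact h'
    · exact n2.not.1 h'
    · exact n1.not.1 h
    · exact g2
  have ht : IsLevelTable ![w, tv w, tv' w, tv⁻¹ w, tv'⁻¹ w]
      ![![some 1, some 2, some 3, some 4], ![none, none, some 0, some 2],
        ![none, none, some 1, some 0], ![some 0, some 4, none, none],
        ![some 3, some 0, none, none]] (cycNorm w) := by
    refine .of_forall (fun i => ?_) fun i k => ?_
    · fin_cases i
      · rfl
      · exact hw.cycNorm_move 0
      · exact hw.cycNorm_move 1
      · exact hw.cycNorm_move 2
      · exact hw.cycNorm_move 3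
    fin_cases i <;> fin_cases k
    · exact .refl _
    · exact .refl _
    · exact .refl _
    · exact .refl _
    · exact l1
    · exact l2
    · exact (tv_inv_tv w).symm ▸ .refl w
    · exact jEquiv_tv'_inv_tv w
    · exact l3
    · exact l4
    · exact jEquiv_tv_inv_tv' w
    · exact (tv'_inv_tv' w).symm ▸ .refl w
    · exact (tv_tv_inv w).symm ▸ .refl w
    · exact jEquiv_tv'_tv_inv w
    · exact l5
    · exact l6
    · exact jEquiv_tv_tv'_inv w
    · exact (tv'_tv'_inv w).symm ▸ .refl w
    · exact l7
    · exact l8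
  refine ht.pointedIso hW (fun i => ?_) (eq_of_jEquiv halt hinj) hm halt
      fun i j => by fin_cases i <;> fin_cases j <;> rfl
  fin_cases i
  · exact hwW
  · exact apply_mem_of_isAutClass hW hwW tv
  · exact apply_mem_of_isAutClass hW hwW tv'
  · exact apply_mem_of_isAutClass hW hwW tv⁻¹
  · exact apply_mem_of_isAutClass hW hwW tv'⁻¹

/-- The graphs of the classes of balanced words. -/
theorem exists_pointedIso (hw : IsBalanced w) (hW : IsAutClass W) (hwW : w ∈ W)
    (hm : cycNorm w ≠ 1) :
    ∃ v₀ : Vertex W, (∀ v : Vertex W, v.HasAlternating ↔ v = v₀) ∧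
      ((Gamma W).PointedIso v₀ graphR4 0 ∨ (Gamma W).PointedIso v₀ graphR5 0 ∨
        (Gamma W).PointedIso v₀ graphR6 0 ∨ (Gamma W).PointedIso v₀ graphR7 0) := by
  by_cases h1 : SquareFree (tv w) <;> by_cases h2 : SquareFree (tv' w)
  · obtain ⟨v, h3, h4⟩ := hw.pointedIso_graphR4 hW hwW hm h1 h2
    exact ⟨v, h3, Or.inl h4⟩
  · obtain ⟨v, h3, h4⟩ := hw.pointedIso_graphR5 hW hwW hm h1 h2
    exact ⟨v, h3, Or.inr (Or.inl h4)⟩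
  -- Replacing w by its image under `swap` exchanges the roles of `tv` and `tv'`.
  · obtain ⟨v, h3, h4⟩ := hw.swap.pointedIso_graphR5 hW
      (apply_mem_of_isAutClass hW hwW F2.swap) (by rwa [cycNorm_swap])
      ((squareFree_congr (jEquiv_tv_swap w)).2 h2)
      (fun h => h1 ((squareFree_congr (jEquiv_tv'_swap w)).1 h))
    exact ⟨v, h3, Or.inr (Or.inl h4)⟩
  · by_cases h : JEquiv (tv w) (tv⁻¹ w) ∨ JEquiv (tv w) (tv'⁻¹ w)
    · obtain ⟨v, h3, h4⟩ := hw.pointedIso_graphR6 hW hwW hm h1 h2 h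
      exact ⟨v, h3, Or.inr (Or.inr (Or.inl h4))⟩
    · rw [not_or] at h
      obtain ⟨v, h3, h4⟩ := hw.pointedIso_graphR7 hW hwW hm h1 h2 h.1 h.2
      exact ⟨v, h3, Or.inr (Or.inr (Or.inr h4))⟩

theorem card_vertex (hw : IsBalanced w) (hW : IsAutClass W) (hwW : w ∈ W)
    (hm : cycNorm w ≠ 1) : Nat.card (Vertex W) ∈ ({1, 2, 3, 5} : Set ℕ) := by
  have key : ∀ {n : ℕ} {v : Vertex W} {G : MultiDigraph (Fin n)} {x : Fin n},
      (Gamma W).PointedIso v G x → Nat.card (Vertex W) = n := by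
    rintro n v G x ⟨e, -, -⟩
    rw [Nat.card_congr e, Nat.card_fin]
  obtain ⟨v, -, h | h | h | h⟩ := hw.exists_pointedIso hW hwW hm <;> rw [key h] <;> simp

end IsBalanced

/-! ### Minimal alternating words and general root classes -/

theorem IsMinimal.isLocMin {w : F2} (h : IsMinimal w) : IsLocMin w := by
  intro i
  obtain ⟨g, hg⟩ := isConj_iff.1 (isConj_mk_cycWord (move i w)).symm
  have := h (MulAut.conj g * move i)
  rw [MulAut.mul_apply, MulAut.conj_apply, hg, norm_mk_cycWord] at this
  exact (cycNorm_le_norm w).trans this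

/-- Without squares, `tv` and `tv⁻¹` change the length by opposite amounts, the turns up to sign;
minimality forces both to be zero. -/
theorem IsMinimal.isBalanced {w : F2} (h : IsMinimal w) (h1 : w.norm ≠ 1) (ha : IsAlternating w) :
    IsBalanced w := by
  have hs := (isAlternating_iff h.isCyclic h1).1 ha
  refine ⟨hs, ?_⟩
  have h2 := h.isLocMin 0
  have h3 := h.isLocMin 2
  have h4 := cycNorm_tv w
  have h5 := cycNorm_tv_inv w
  have h6 := hs.2
  rw [move_zero] at h2
  rw [move_two] at h3
  omega

theorem cycNorm_ne_one {W : Set F2} (hW : IsAutClass W) (h1 : ∀ w ∈ W, FreeGroup.norm w ≠ 1)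
    {w : F2} (hw : w ∈ W) : cycNorm w ≠ 1 := by
  rw [← norm_mk_cycWord]
  exact h1 _ (mem_of_isConj hW hw (isConj_mk_cycWord w).symm)

/-- The class of the generators has a single vertex. -/
theorem card_vertex_of_norm_eq_one {W : Set F2} (hW : IsAutClass W) {v : F2} (hv : v ∈ W)
    (h : v.norm = 1) : Nat.card (Vertex W) = 1 := by
  have hmin : IsMinimal v := by
    intro φ
    rw [h, Nat.one_le_iff_ne_zero, Ne, FreeGroup.norm_eq_zero, MulEquiv.map_eq_one_iff,
      ← FreeGroup.norm_eq_zero, h]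
    exact one_ne_zero
  have hnorm : ∀ w : MinimalWord W, w.1 ∈ letters := by
    intro w
    obtain ⟨φ, hφ⟩ := exists_aut_of_mem hW w.2.1 hv
    obtain ⟨ψ, hψ⟩ := exists_aut_of_mem hW hv w.2.1
    have h1 := w.2.2 φ
    have h2 := hmin ψ
    rw [hφ] at h1
    rw [hψ] at h2
    exact mem_letters_iff.2 (by omega)
  have hJ : ∀ x ∈ letters, JEquiv a x := by
    rintro x (rfl | rfl | rfl | rfl)
    · exact .refl _
    · exact ⟨swap, swap_mem_J, by simp⟩
    · exact ⟨negate, negate_mem_J, by simp⟩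
    · exact ⟨negate * swap, J.mul_mem negate_mem_J swap_mem_J, by simp⟩
  rw [Nat.card_eq_one_iff_unique]
  refine ⟨⟨fun x y => ?_⟩, ⟨Quotient.mk (jSetoid W) ⟨v, hv, hmin⟩⟩⟩
  induction x using Quotient.inductionOn with
  | h x =>
    induction y using Quotient.inductionOn with
    | h y =>
      exact Quotient.sound (s := jSetoid W) ((hJ _ (hnorm x)).symm.trans (hJ _ (hnorm y)))

/-- Only the inverse moves keep the length of w. If an image has no squares of the relevant
generator, it is balanced. Otherwise both images have negative turns, so inverse moves lengthen them
and positive moves stay in the triangle with w. Entries may coincide up to `J`; the bound by three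
is enough. -/
theorem card_vertex_of_turns_pos {W : Set F2} (hW : IsAutClass W) {w : F2} (hwW : w ∈ W)
    (hm : cycNorm w ≠ 1) (h0 : squares 0 w = turns w) (h1 : squares 1 w = turns w)
    (ht : 0 < turns w) : Nat.card (Vertex W) ∈ ({1, 2, 3, 5} : Set ℕ) := by
  have hx := apply_mem_of_isAutClass hW hwW tv⁻¹
  have hy := apply_mem_of_isAutClass hW hwW tv'⁻¹
  have c0 := cycNorm_tv w
  have c1 := cycNorm_tv' w
  have c2 := cycNorm_tv_inv w
  have c3 := cycNorm_tv'_inv w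
  have x1 := turns_tv_inv w
  have x2 := squares_zero_tv_inv w
  have x3 := squares_nonneg 1 (tv⁻¹ w)
  have y1 := turns_tv'_inv w
  have y2 := squares_one_tv'_inv w
  have y3 := squares_nonneg 0 (tv'⁻¹ w)
  by_cases hx0 : squares 1 (tv⁻¹ w) = 0
  · exact IsBalanced.card_vertex (w := tv⁻¹ w) ⟨⟨by omega, by omega⟩, by omega⟩ hW hx (by omega)
  by_cases hy0 : squares 0 (tv'⁻¹ w) = 0
  · exact IsBalanced.card_vertex (w := tv'⁻¹ w) ⟨⟨by omega, by omega⟩, by omega⟩ hW hy (by omega)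
  have x4 := cycNorm_tv_inv (tv⁻¹ w)
  have x5 := cycNorm_tv'_inv (tv⁻¹ w)
  have y4 := cycNorm_tv_inv (tv'⁻¹ w)
  have y5 := cycNorm_tv'_inv (tv'⁻¹ w)
  have h : IsLevelTable ![w, tv⁻¹ w, tv'⁻¹ w]
      ![![none, none, some 1, some 2], ![some 0, some 2, none, none],
        ![some 1, some 0, none, none]] (cycNorm w) := by
    refine .of_forall (fun i => ?_) fun i k => ?_
    · fin_cases i
      · rfl
      · change cycNorm (tv⁻¹ w) = _; omega
      · change cycNorm (tv'⁻¹ w) = _; omega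
    fin_cases i <;> fin_cases k
    · change cycNorm w < cycNorm (tv w); omega
    · change cycNorm w < cycNorm (tv' w); omega
    · exact .refl _
    · exact .refl _
    · exact (IsBalanced.tv_tv_inv w).symm ▸ .refl w
    · exact jEquiv_tv'_tv_inv w
    · change cycNorm w < cycNorm (tv⁻¹ (tv⁻¹ w)); omega
    · change cycNorm w < cycNorm (tv'⁻¹ (tv⁻¹ w)); omega
    · exact jEquiv_tv_tv'_inv w
    · exact (IsBalanced.tv'_tv'_inv w).symm ▸ .refl w
    · change cycNorm w < cycNorm (tv⁻¹ (tv'⁻¹ w)); omega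
    · change cycNorm w < cycNorm (tv'⁻¹ (tv'⁻¹ w)); omega
  obtain ⟨h2, h3⟩ := h.card_vertex hW (fun i => by
    fin_cases i
    · exact hwW
    · exact hx
    · exact hy)
  simp only [Set.mem_insert_iff, Set.mem_singleton_iff]
  omega

theorem turns_flip (g : F2) : turns (flip g) = -turns g := by
  have h1 := cycNorm_tv (flip g)
  have h2 := cycNorm_tv_inv g
  have h3 := squares_flip 1 g
  rw [cycNorm_tv_flip, cycNorm_flip] at h1
  omega

theorem card_vertex_of_isRootClass {W : Set F2} (hW : IsRootClass W) :
    Nat.card (Vertex W) ∈ ({1, 2, 3, 5} : Set ℕ) := by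
  obtain ⟨hA, w, hw, hc, h1, h2⟩ := hW
  -- The class of the generators is set apart because subword counts and junction sums disagree in
  -- length one.
  by_cases hone : ∃ v ∈ W, FreeGroup.norm v = 1
  · obtain ⟨v, hv, h⟩ := hone
    rw [card_vertex_of_norm_eq_one hA hv h]
    simp
  replace hone : ∀ v ∈ W, FreeGroup.norm v ≠ 1 := fun v hv h => hone ⟨v, hv, h⟩
  have hn := hone w hw
  have hm := cycNorm_ne_one hA hone hw
  rw [subwordCount_ab_sub hc hn, subwordCount_aa hc hn] at h1
  have h3 : squares 0 w = squares 1 w := by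
    rw [← subwordCount_aa hc hn, ← subwordCount_bb hc hn, h2]
  rcases lt_trichotomy (turns w) 0 with ht | ht | ht
  · rw [abs_of_neg ht] at h1
    -- `flip` reverses the sign of the turns and keeps the squares.
    refine card_vertex_of_turns_pos hA (apply_mem_of_isAutClass hA hw flip)
      (by rwa [cycNorm_flip]) ?_ ?_ ?_
    all_goals
      simp only [squares_flip, turns_flip]
      omega
  · rw [ht, abs_zero] at h1
    exact IsBalanced.card_vertex ⟨⟨h1.symm, by omega⟩, ht⟩ hA hw hm
  · rw [abs_of_pos ht] at h1
    exact card_vertex_of_turns_pos hA hw hm h1.symm (by omega) ht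

end F2

/-- The hypothesis on lengths excludes only the class of `a`, the automorphic conjugacy class whose
minimal words have length one. -/
theorem theorem4 :
    (∀ W : Set F2, F2.IsRootClass W →
      (∃ w ∈ W, F2.IsMinimal w ∧ F2.IsAlternating w) →
      (∀ w ∈ W, FreeGroup.norm w ≠ 1) →
      ∃ v₀ : F2.Vertex W,
        (∀ v : F2.Vertex W, v.HasAlternating ↔ v = v₀) ∧
        ((F2.Gamma W).PointedIso v₀ F2.graphR4 0 ∨
          (F2.Gamma W).PointedIso v₀ F2.graphR5 0 ∨
          (F2.Gamma W).PointedIso v₀ F2.graphR6 0 ∨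
          (F2.Gamma W).PointedIso v₀ F2.graphR7 0)) ∧
    (∀ W : Set F2, F2.IsRootClass W →
      Nat.card (F2.Vertex W) ∈ ({1, 2, 3, 5} : Set ℕ)) := by
  refine ⟨?_, fun W hW => F2.card_vertex_of_isRootClass hW⟩
  rintro W ⟨hW, -⟩ ⟨w, hw, hmin, halt⟩ hone
  exact (hmin.isBalanced (hone w hw) halt).exists_pointedIso hW hw (F2.cycNorm_ne_one hW hone hw)
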